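/- Let $\Bbbk$ be an arbitrary field and let $H$ be a Hopf algebra over $\Bbbk$ with bijective antipode. Let $V = V_1\oplus V_2$ be a direct sum in the category ${}^H_H\mathcal{YD}$ of (left-left) Yetter–Drinfeld modules over $H$, and let $\mathcal B(V)=T(V)/\mathcal J(V)$ be the Nichols algebra of $V$, a bialgebra in ${}^H_H\mathcal{YD}$ with comultiplication $\Delta$ and counit $\varepsilon$. For $\alpha=(a_1,a_2)\in\mathbb N_0^2$ let $\mathcal B^{\alpha}(V)$ be the homogeneous component of degree $\alpha$ for the $\mathbb N_0^2$-grading of $\mathcal B(V)$ with $\deg V_1=(1,0)$ and $\deg V_2=(0,1)$. Let $r\in\mathbb Q$, $r\ge 0$, and put $$B_{\ge r}=\bigoplus_{a_1\ge r a_2}\mathcal B^{(a_1,a_2)}(V),\qquad B_{>r}=\bigoplus_{a_1> r a_2}\mathcal B^{(a_1,a_2)}(V),$$ $$K_{\ge r}=\{x\in\mathcal B(V) : \Delta(x)\in B_{\ge r}\otimes \mathcal B(V)\},\qquad K_{>r}=K_{\ge r}\cap B_{>r}.$$ Then the braided bialgebra structure of $\mathcal B(V)$ induces a braided Hopf algebra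 structure on $K_{\ge r}/K_{>r}$. That is: $K_{\ge r}$ contains $1$ and is stable under the multiplication, the action and the coaction of $H$; $\Delta(K_{\ge r})\subseteq K_{\ge r}\otimes K_{\ge r}+K_{>r}\otimes\mathcal B(V)$; the multiplication, unit, action, coaction and counit restricted to $K_{\ge r}$, as well as the map obtained from $\Delta$ by projecting the part in $K_{\ge r}\otimes K_{\ge r}$ to $K_{\ge r}/K_{>r}\otimes K_{\ge r}/K_{>r}$, descend to well-defined and uniquely determined maps on $K_{\ge r}/K_{>r}$; and with these maps $K_{\ge r}/K_{>r}$ is a Hopf algebra in ${}^H_H\mathcal{YD}$ (a bialgebra in ${}^H_H\mathcal{YD}$ with an antipode that is a morphism in ${}^H_H\mathcal{YD}$). -/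

import Mathlib

open scoped TensorProduct

noncomputable section

namespace YetterDrinfeld

universe u v w w₁

/-! ### Yetter-Drinfeld modules over a Hopf algebra `H` over a field `k` -/

/-- An action `H ⊗ M → M` and a coaction `M → H ⊗ M` on a vector space `M`
(the axioms are in `YDData.IsYD`). -/
@[ext]
structure YDData (k : Type u) (H : Type v) (M : Type w) [Field k] [Ring H] [HopfAlgebra k H]
    [AddCommGroup M] [Module k M] where
  /-- the left action `h · m` -/
  act : H →ₗ[k] M →ₗ[k] M
  /-- the left coaction `m ↦ m₍₋₁₎ ⊗ m₍₀₎` -/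
  coact : M →ₗ[k] H ⊗[k] M

section

variable {k : Type u} {H : Type v} [Field k] [Ring H] [HopfAlgebra k H]
variable {M : Type w} [AddCommGroup M] [Module k M]
variable {N : Type w₁} [AddCommGroup N] [Module k N]

/-- The diagonal action of `H` on `M ⊗ N`: `h · (m ⊗ n) = (h₍₁₎ · m) ⊗ (h₍₂₎ · n)`. -/
def diagAct (α : H →ₗ[k] M →ₗ[k] M) (β : H →ₗ[k] N →ₗ[k] N) :
    H →ₗ[k] M ⊗[k] N →ₗ[k] M ⊗[k] N :=
  TensorProduct.map₂ α β ∘ₗ Coalgebra.comul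

namespace YDData

/-- `M` is a (left-left) Yetter-Drinfeld module: a left `H`-module and a left `H`-comodule with
`h₍₁₎ m₍₋₁₎ ⊗ h₍₂₎ · m₍₀₎ = (h₍₁₎ · m)₍₋₁₎ h₍₂₎ ⊗ (h₍₁₎ · m)₍₀₎`. -/
structure IsYD (D : YDData k H M) : Prop where
  one_act : ∀ m, D.act 1 m = m
  mul_act : ∀ g h m, D.act (g * h) m = D.act g (D.act h m)
  counit_coact : ∀ m,
    TensorProduct.lid k M ((Coalgebra.counit (R := k) (A := H)).rTensor M (D.coact m)) = m
  coassoc : ∀ m, TensorProduct.assoc k H H M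
      ((Coalgebra.comul (R := k) (A := H)).rTensor M (D.coact m)) =
    D.coact.lTensor H (D.coact m)
  compat : ∀ h m, diagAct (LinearMap.mul k H) D.act h (D.coact m) =
    (LinearMap.mul' k H).rTensor M (TensorProduct.rightComm k H M H
      ((D.coact ∘ₗ D.act.flip m).rTensor H (Coalgebra.comul (R := k) h)))

/-- The unit object: the ground field with `h · 1 = ε(h)` and `1 ↦ 1 ⊗ 1`. -/
def unit (k : Type u) (H : Type v) [Field k] [Ring H] [HopfAlgebra k H] : YDData k H k where
  act := LinearMap.lsmul k k ∘ₗ Coalgebra.counit (R := k) (A := H)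
  coact := LinearMap.toSpanSingleton k (H ⊗[k] k) (1 ⊗ₜ[k] 1)

/-- The tensor product: diagonal action, and codiagonal coaction
`m ⊗ n ↦ m₍₋₁₎ n₍₋₁₎ ⊗ (m₍₀₎ ⊗ n₍₀₎)`. -/
def tensor (D : YDData k H M) (E : YDData k H N) : YDData k H (M ⊗[k] N) where
  act := diagAct D.act E.act
  coact := (LinearMap.mul' k H).rTensor (M ⊗[k] N) ∘ₗ
    (TensorProduct.tensorTensorTensorComm k H M H N).toLinearMap ∘ₗ
    TensorProduct.map D.coact E.coact

/-- Morphisms: linear maps commuting with the actions and the coactions. -/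
structure IsHom (D : YDData k H M) (E : YDData k H N) (f : M →ₗ[k] N) : Prop where
  map_act : ∀ h m, f (D.act h m) = E.act h (f m)
  map_coact : ∀ m, E.coact (f m) = f.lTensor H (D.coact m)

/-- Subobjects: subspaces `P` with `H · P ⊆ P` and `coact P ⊆ H ⊗ P`. -/
structure IsSub (D : YDData k H M) (P : Submodule k M) : Prop where
  act_mem : ∀ h, ∀ m ∈ P, D.act h m ∈ P
  coact_mem : ∀ m ∈ P, D.coact m ∈ LinearMap.range (P.subtype.lTensor H)

/-- The braiding `c (m ⊗ n) = (m₍₋₁₎ · n) ⊗ m₍₀₎`. -/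
def braiding (D : YDData k H M) (E : YDData k H N) : M ⊗[k] N →ₗ[k] N ⊗[k] M :=
  (TensorProduct.lift E.act).rTensor M ∘ₗ
    (TensorProduct.rightComm k H M N).toLinearMap ∘ₗ D.coact.rTensor N

/-- For a multiplication `μ` on `M`, the multiplication
`(μ ⊗ μ) (id ⊗ c ⊗ id)` of the braided tensor product `M ⊗ M`:
`(x ⊗ y) (x' ⊗ y') = x (y₍₋₁₎ · x') ⊗ y₍₀₎ y'`. -/
def braidedMul (D : YDData k H M) (μ : M →ₗ[k] M →ₗ[k] M) :
    M ⊗[k] M →ₗ[k] M ⊗[k] M →ₗ[k] M ⊗[k] M :=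
  TensorProduct.curry <|
    TensorProduct.map (TensorProduct.lift μ) (TensorProduct.lift μ) ∘ₗ
    (TensorProduct.assoc k M M (M ⊗[k] M)).symm.toLinearMap ∘ₗ
    ((TensorProduct.assoc k M M M).toLinearMap ∘ₗ (D.braiding D).rTensor M ∘ₗ
      (TensorProduct.assoc k M M M).symm.toLinearMap).lTensor M ∘ₗ
    (TensorProduct.assoc k M M (M ⊗[k] M)).toLinearMap

end YDData

end

/-! ### Braided Hopf algebras: Hopf algebras in the category of Yetter-Drinfeld modules -/

/-- Structure maps of a braided bialgebra (the axioms are in `BraidedData.IsBialgebra`). -/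
@[ext]
structure BraidedData (k : Type u) (H : Type v) (A : Type w) [Field k] [Ring H] [HopfAlgebra k H]
    [AddCommGroup A] [Module k A] extends YDData k H A where
  /-- multiplication -/
  mul : A →ₗ[k] A →ₗ[k] A
  /-- unit element -/
  one : A
  /-- comultiplication -/
  comul : A →ₗ[k] A ⊗[k] A
  /-- counit -/
  counit : A →ₗ[k] k

section

variable {k : Type u} {H : Type v} [Field k] [Ring H] [HopfAlgebra k H]
variable {A : Type w} [AddCommGroup A] [Module k A]

namespace BraidedData

/-- `A` is a bialgebra in the braided category of Yetter-Drinfeld modules over `H`. -/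
structure IsBialgebra (D : BraidedData k H A) : Prop where
  isYD : D.toYDData.IsYD
  -- `A` is an algebra in the category
  mul_assoc : ∀ x y z, D.mul (D.mul x y) z = D.mul x (D.mul y z)
  one_mul : ∀ x, D.mul D.one x = x
  mul_one : ∀ x, D.mul x D.one = x
  mul_hom : (D.toYDData.tensor D.toYDData).IsHom D.toYDData (TensorProduct.lift D.mul)
  one_hom : (YDData.unit k H).IsHom D.toYDData (LinearMap.toSpanSingleton k A D.one)
  -- `A` is a coalgebra in the category
  comul_coassoc : ∀ x, TensorProduct.assoc k A A A (D.comul.rTensor A (D.comul x)) =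
    D.comul.lTensor A (D.comul x)
  counit_comul : ∀ x, TensorProduct.lid k A (D.counit.rTensor A (D.comul x)) = x
  comul_counit : ∀ x, TensorProduct.rid k A (D.counit.lTensor A (D.comul x)) = x
  comul_hom : D.toYDData.IsHom (D.toYDData.tensor D.toYDData) D.comul
  counit_hom : D.toYDData.IsHom (YDData.unit k H) D.counit
  -- comultiplication and counit are algebra maps, for the braided product on `A ⊗ A`
  comul_mul : ∀ x y, D.comul (D.mul x y) =
    D.toYDData.braidedMul D.mul (D.comul x) (D.comul y)
  comul_one : D.comul D.one = D.one ⊗ₜ[k] D.one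
  counit_mul : ∀ x y, D.counit (D.mul x y) = D.counit x * D.counit y
  counit_one : D.counit D.one = 1

/-- `S` is an antipode: a morphism of Yetter-Drinfeld modules which is a two-sided convolution
inverse of the identity. -/
structure IsAntipode (D : BraidedData k H A) (S : A →ₗ[k] A) : Prop where
  hom : D.toYDData.IsHom D.toYDData S
  left_inv : ∀ x, TensorProduct.lift D.mul (S.rTensor A (D.comul x)) = D.counit x • D.one
  right_inv : ∀ x, TensorProduct.lift D.mul (S.lTensor A (D.comul x)) = D.counit x • D.one

/-- `A` is a braided Hopf algebra, that is a Hopf algebra in the category of Yetter-Drinfeld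
modules over `H`. -/
structure IsHopf (D : BraidedData k H A) : Prop where
  isBialgebra : D.IsBialgebra
  exists_antipode : ∃ S : A →ₗ[k] A, D.IsAntipode S

/-- For subspaces `I ⊆ K` of `A`, the structure `E` on `K / I` is induced by the structure `D` of
`A`: all structure maps of `A` restrict to `K` and descend to `K / I`. For the comultiplication
this means that `D.comul` maps `K` into `K ⊗ K + I ⊗ A`, and that `E.comul` is obtained by
projecting the component in `K ⊗ K` to `K / I ⊗ K / I`. -/
structure IsInduced (D : BraidedData k H A) (K I : Submodule k A)
    (E : BraidedData k H (K ⧸ I.submoduleOf K)) : Prop where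
  le : I ≤ K
  act : ∀ (h : H) (x : K), ∃ y : K, (y : A) = D.act h x ∧
    E.act h ((I.submoduleOf K).mkQ x) = (I.submoduleOf K).mkQ y
  coact : ∀ x : K, ∃ y : H ⊗[k] K, K.subtype.lTensor H y = D.coact x ∧
    E.coact ((I.submoduleOf K).mkQ x) = (I.submoduleOf K).mkQ.lTensor H y
  mul : ∀ x y : K, ∃ z : K, (z : A) = D.mul x y ∧
    E.mul ((I.submoduleOf K).mkQ x) ((I.submoduleOf K).mkQ y) = (I.submoduleOf K).mkQ z
  one : ∃ z : K, (z : A) = D.one ∧ E.one = (I.submoduleOf K).mkQ z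
  comul : ∀ x : K, ∃ (y : K ⊗[k] K) (z : I ⊗[k] A),
    D.comul x = TensorProduct.map K.subtype K.subtype y + I.subtype.rTensor A z ∧
    E.comul ((I.submoduleOf K).mkQ x) =
      TensorProduct.map (I.submoduleOf K).mkQ (I.submoduleOf K).mkQ y
  counit : ∀ x : K, E.counit ((I.submoduleOf K).mkQ x) = D.counit x

end BraidedData

end

/-! ### The tensor algebra and the Nichols algebra of a Yetter-Drinfeld module -/

section

variable {k : Type u} {H : Type v} [Field k] [Ring H] [HopfAlgebra k H]
variable {V : Type w} [AddCommGroup V] [Module k V]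

/-- The action of `H` on `T(V)`, as the algebra map from `T(V)` to the convolution algebra of
linear maps `H → T(V)`; it satisfies `h · (x y) = (h₍₁₎ · x) (h₍₂₎ · y)` and extends the action
on `V`. -/
def tensorAlgebraActHom (D : YDData k H V) :
    TensorAlgebra k V →ₐ[k] WithConv (H →ₗ[k] TensorAlgebra k V) :=
  TensorAlgebra.lift k ((WithConv.linearEquiv k (H →ₗ[k] TensorAlgebra k V)).symm.toLinearMap ∘ₗ
    (D.act.compr₂ (TensorAlgebra.ι k)).flip)

/-- The Yetter-Drinfeld structure on `T(V)`; the coaction is the algebra map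
`T(V) → H ⊗ T(V)` that extends the coaction of `V`. -/
def tensorAlgebraYD (D : YDData k H V) : YDData k H (TensorAlgebra k V) where
  act := ((WithConv.linearEquiv k (H →ₗ[k] TensorAlgebra k V)).toLinearMap ∘ₗ
    (tensorAlgebraActHom D).toLinearMap).flip
  coact := (TensorAlgebra.lift k
    ((TensorAlgebra.ι k : V →ₗ[k] _).lTensor H ∘ₗ D.coact)).toLinearMap

/-- The element `v ⊗ 1 + 1 ⊗ v` of `T(V) ⊗ T(V)`. -/
def primitiveElement (k : Type u) (V : Type w) [Field k] [AddCommGroup V] [Module k V] :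
    V →ₗ[k] TensorAlgebra k V ⊗[k] TensorAlgebra k V :=
  ((TensorProduct.mk k (TensorAlgebra k V) (TensorAlgebra k V)).flip 1 +
    TensorProduct.mk k (TensorAlgebra k V) (TensorAlgebra k V) 1) ∘ₗ TensorAlgebra.ι k

/-- The braided comultiplication of `T(V)`: the algebra map to the braided tensor product
`T(V) ⊗ T(V)` with `v ↦ v ⊗ 1 + 1 ⊗ v`. It is given by
`Δ (v₁ ⋯ vₙ) = Δ(v₁) (Δ(v₂) ( ⋯ (Δ(vₙ) (1 ⊗ 1))))`, with products in the braided tensor product. -/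
def tensorAlgebraComul (D : YDData k H V) :
    TensorAlgebra k V →ₗ[k] TensorAlgebra k V ⊗[k] TensorAlgebra k V :=
  LinearMap.applyₗ (1 ⊗ₜ[k] 1) ∘ₗ
    (TensorAlgebra.lift k
      ((tensorAlgebraYD D).braidedMul (LinearMap.mul k (TensorAlgebra k V)) ∘ₗ
        primitiveElement k V) :
      TensorAlgebra k V →ₐ[k]
        Module.End k (TensorAlgebra k V ⊗[k] TensorAlgebra k V)).toLinearMap

/-- The braided bialgebra structure of the tensor algebra `T(V)`. -/
def tensorAlgebraData (D : YDData k H V) : BraidedData k H (TensorAlgebra k V) where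
  toYDData := tensorAlgebraYD D
  mul := LinearMap.mul k (TensorAlgebra k V)
  one := 1
  comul := tensorAlgebraComul D
  counit := (TensorAlgebra.algebraMapInv : TensorAlgebra k V →ₐ[k] k).toLinearMap

/-- The `ℕ`-grading of the tensor algebra. -/
abbrev tensorGrading (k : Type u) (V : Type w) [Field k] [AddCommGroup V] [Module k V] :
    ℕ → Submodule k (TensorAlgebra k V) :=
  fun n => LinearMap.range (TensorAlgebra.ι k : V →ₗ[k] TensorAlgebra k V) ^ n

/-- The subspace `I ⊗ T + T ⊗ I` of `T ⊗ T`. -/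
def coidealSubspace {T : Type w} [AddCommGroup T] [Module k T] (I : Submodule k T) :
    Submodule k (T ⊗[k] T) :=
  LinearMap.range (I.subtype.rTensor T) ⊔ LinearMap.range (I.subtype.lTensor T)

/-- The two-sided ideals `I` of `T(V)` that are homogeneous, contained in degrees `≥ 2`,
Yetter-Drinfeld submodules, and coideals. (Since `T(V)` is graded and connected, such ideals are
automatically stable under the antipode.) -/
structure IsNicholsIdeal (D : YDData k H V) (I : Ideal (TensorAlgebra k V)) : Prop where
  isTwoSided : I.IsTwoSided
  isHomogeneous : I.IsHomogeneous (tensorGrading k V)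
  degree_ge_two : ∀ x ∈ I, ∀ n < 2, GradedRing.proj (tensorGrading k V) n x = 0
  isSub : (tensorAlgebraYD D).IsSub (I.restrictScalars k)
  coideal : ∀ x ∈ I, tensorAlgebraComul D x ∈ coidealSubspace (I.restrictScalars k)
  counit_eq_zero : ∀ x ∈ I, (TensorAlgebra.algebraMapInv : TensorAlgebra k V →ₐ[k] k) x = 0

/-- The defining ideal `J(V)` of the Nichols algebra: the largest homogeneous Hopf ideal of
`T(V)` in the category of Yetter-Drinfeld modules that is contained in degrees `≥ 2`,
constructed as the sum of all of them. -/
def nicholsIdeal (D : YDData k H V) : Ideal (TensorAlgebra k V) :=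
  sSup {I | IsNicholsIdeal D I}

theorem nicholsIdeal_induction (D : YDData k H V) (p : TensorAlgebra k V → Prop)
    (mem : ∀ I, IsNicholsIdeal D I → ∀ x ∈ I, p x) (zero : p 0)
    (add : ∀ x y, p x → p y → p (x + y)) : ∀ x ∈ nicholsIdeal D, p x := by
  intro x hx
  rw [nicholsIdeal, sSup_eq_iSup'] at hx
  exact Submodule.iSup_induction _ (motive := p) hx (fun I y hy => mem I.1 I.2 y hy) zero add

theorem le_nicholsIdeal (D : YDData k H V) {I : Ideal (TensorAlgebra k V)}
    (hI : IsNicholsIdeal D I) : I ≤ nicholsIdeal D :=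
  le_sSup hI

instance nicholsIdeal_isTwoSided (D : YDData k H V) : (nicholsIdeal D).IsTwoSided := by
  refine ⟨fun {a} b ha => ?_⟩
  refine nicholsIdeal_induction D (fun x => x * b ∈ nicholsIdeal D) ?_ ?_ ?_ a ha
  · intro I hI x hx
    have := hI.isTwoSided
    exact le_nicholsIdeal D hI (I.mul_mem_right b hx)
  · simp
  · intro x y hx hy
    rw [add_mul]
    exact add_mem hx hy

/-- The Nichols algebra `B(V) = T(V) / J(V)`, as a ring. -/
abbrev NicholsAlgebra (D : YDData k H V) : Type max u w :=
  TensorAlgebra k V ⧸ nicholsIdeal D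

/-- The projection `T(V) → B(V)`. -/
def nicholsProj (D : YDData k H V) : TensorAlgebra k V →ₐ[k] NicholsAlgebra D :=
  Ideal.Quotient.mkₐ k (nicholsIdeal D)

theorem nicholsProj_eq_zero (D : YDData k H V) {x : TensorAlgebra k V}
    (hx : x ∈ nicholsIdeal D) : nicholsProj D x = 0 :=
  Ideal.Quotient.eq_zero_iff_mem.mpr hx

/-- The linear map on `B(V)` induced by a linear map on `T(V)` that vanishes on `J(V)`. -/
def nicholsLift (D : YDData k H V) {N : Type*} [AddCommGroup N] [Module k N]
    (f : TensorAlgebra k V →ₗ[k] N) (hf : ∀ x ∈ nicholsIdeal D, f x = 0) :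
    NicholsAlgebra D →ₗ[k] N :=
  ((nicholsIdeal D).restrictScalars k).liftQ f (fun x hx => hf x hx) ∘ₗ
    (Submodule.Quotient.restrictScalarsEquiv k (nicholsIdeal D)).symm.toLinearMap

theorem nicholsLift_proj (D : YDData k H V) {N : Type*} [AddCommGroup N] [Module k N]
    (f : TensorAlgebra k V →ₗ[k] N) (hf : ∀ x ∈ nicholsIdeal D, f x = 0)
    (x : TensorAlgebra k V) : nicholsLift D f hf (nicholsProj D x) = f x :=
  rfl

theorem act_nicholsIdeal (D : YDData k H V) (h : H) : ∀ x ∈ nicholsIdeal D,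
    (tensorAlgebraYD D).act h x ∈ nicholsIdeal D := by
  refine nicholsIdeal_induction D _ ?_ ?_ ?_
  · intro I hI x hx
    exact le_nicholsIdeal D hI (hI.isSub.act_mem h x hx)
  · simp
  · intro x y hx hy
    rw [map_add]
    exact add_mem hx hy

theorem coact_nicholsIdeal (D : YDData k H V) : ∀ x ∈ nicholsIdeal D,
    (nicholsProj D).toLinearMap.lTensor H ((tensorAlgebraYD D).coact x) = 0 := by
  refine nicholsIdeal_induction D _ ?_ ?_ ?_
  · intro I hI x hx
    obtain ⟨y, hy⟩ := hI.isSub.coact_mem x hx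
    rw [← hy, ← LinearMap.comp_apply, ← LinearMap.lTensor_comp]
    have h0 : (nicholsProj D).toLinearMap ∘ₗ (I.restrictScalars k).subtype = 0 :=
      LinearMap.ext fun z => nicholsProj_eq_zero D (le_nicholsIdeal D hI z.2)
    rw [h0, LinearMap.lTensor_zero, LinearMap.zero_apply]
  · simp
  · intro x y hx hy
    rw [map_add, map_add, hx, hy, add_zero]

theorem comul_nicholsIdeal (D : YDData k H V) : ∀ x ∈ nicholsIdeal D,
    TensorProduct.map (nicholsProj D).toLinearMap (nicholsProj D).toLinearMap
      (tensorAlgebraComul D x) = 0 := by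
  refine nicholsIdeal_induction D _ ?_ ?_ ?_
  · intro I hI x hx
    have h0 : (nicholsProj D).toLinearMap ∘ₗ (I.restrictScalars k).subtype = 0 :=
      LinearMap.ext fun z => nicholsProj_eq_zero D (le_nicholsIdeal D hI z.2)
    obtain ⟨_, ⟨y, rfl⟩, _, ⟨z, rfl⟩, hyz⟩ := Submodule.mem_sup.mp (hI.coideal x hx)
    rw [← hyz, map_add, LinearMap.rTensor_def, LinearMap.lTensor_def, TensorProduct.map_map,
      TensorProduct.map_map, h0, TensorProduct.map_zero_left, TensorProduct.map_zero_right]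
    simp
  · simp
  · intro x y hx hy
    rw [map_add, map_add, hx, hy, add_zero]

theorem counit_nicholsIdeal (D : YDData k H V) : ∀ x ∈ nicholsIdeal D,
    (TensorAlgebra.algebraMapInv : TensorAlgebra k V →ₐ[k] k) x = 0 := by
  refine nicholsIdeal_induction D _ ?_ ?_ ?_
  · intro I hI x hx
    exact hI.counit_eq_zero x hx
  · simp
  · intro x y hx hy
    rw [map_add, hx, hy, add_zero]

/-- The braided bialgebra structure of the Nichols algebra `B(V)`, induced by that of `T(V)`. -/
def nicholsData (D : YDData k H V) : BraidedData k H (NicholsAlgebra D) where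
  act := (nicholsLift D ((tensorAlgebraYD D).act.compr₂ (nicholsProj D).toLinearMap).flip
    (fun x hx => LinearMap.ext fun h => nicholsProj_eq_zero D (act_nicholsIdeal D h x hx))).flip
  coact := nicholsLift D ((nicholsProj D).toLinearMap.lTensor H ∘ₗ (tensorAlgebraYD D).coact)
    (coact_nicholsIdeal D)
  mul := LinearMap.mul k (NicholsAlgebra D)
  one := 1
  comul := nicholsLift D
    (TensorProduct.map (nicholsProj D).toLinearMap (nicholsProj D).toLinearMap ∘ₗ
      tensorAlgebraComul D) (comul_nicholsIdeal D)
  counit := nicholsLift D (TensorAlgebra.algebraMapInv : TensorAlgebra k V →ₐ[k] k).toLinearMap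
    (counit_nicholsIdeal D)

/-! ### The `ℕ₀²`-grading of `B(V)` for `V = V₁ ⊕ V₂`, and the subspaces defined by a slope -/

/-- The homogeneous component `B^α(V)`, `α = (a₁, a₂)`, of the `ℕ₀²`-grading with
`deg V₁ = (1, 0)` and `deg V₂ = (0, 1)`: the span of all products, in any order, of `a₁` elements
of `V₁` and `a₂` elements of `V₂`. -/
def nicholsComponent (D : YDData k H V) (V₁ V₂ : Submodule k V) (α : ℕ × ℕ) :
    Submodule k (NicholsAlgebra D) :=
  Submodule.span k {x | ∃ l : List (V₁ ⊕ V₂),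
    l.countP Sum.isLeft = α.1 ∧ l.countP Sum.isRight = α.2 ∧
    x = (l.map fun v => nicholsProj D
      (TensorAlgebra.ι k (Sum.elim (fun a : V₁ => (a : V)) (fun b : V₂ => (b : V)) v))).prod}

/-- `B_{≥ r}`, the sum of the `B^α(V)` with `a₁ ≥ r a₂`. -/
def BGe (D : YDData k H V) (V₁ V₂ : Submodule k V) (r : ℚ) : Submodule k (NicholsAlgebra D) :=
  ⨆ (α : ℕ × ℕ) (_ : (α.1 : ℚ) ≥ r * α.2), nicholsComponent D V₁ V₂ α

/-- `B_{> r}`, the sum of the `B^α(V)` with `a₁ > r a₂`. -/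
def BGt (D : YDData k H V) (V₁ V₂ : Submodule k V) (r : ℚ) : Submodule k (NicholsAlgebra D) :=
  ⨆ (α : ℕ × ℕ) (_ : (α.1 : ℚ) > r * α.2), nicholsComponent D V₁ V₂ α

/-- `K_{≥ r} = {x ∈ B(V) | Δ(x) ∈ B_{≥ r} ⊗ B(V)}`. -/
def KGe (D : YDData k H V) (V₁ V₂ : Submodule k V) (r : ℚ) : Submodule k (NicholsAlgebra D) :=
  (LinearMap.range ((BGe D V₁ V₂ r).subtype.rTensor (NicholsAlgebra D))).comap
    (nicholsData D).comul

/-- `K_{> r} = K_{≥ r} ∩ B_{> r}`. -/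
def KGt (D : YDData k H V) (V₁ V₂ : Submodule k V) (r : ℚ) : Submodule k (NicholsAlgebra D) :=
  KGe D V₁ V₂ r ⊓ BGt D V₁ V₂ r

end

end YetterDrinfeld

end

/-!
Give `V₁` the weight `1` and `V₂` the weight `-r`. Then `B(V)` is graded by weights in `ℚ`, all its
structure maps are homogeneous, and `B_{≥ r}` and `B_{> r}` are the parts of weight `≥ 0` and `> 0`.
Writing `π_q` for the projection to weight `q`, the space `K = K_{≥ r}` is the common kernel of the
maps `(π_q ⊗ id) Δ` for `q < 0`. These are morphisms of Yetter-Drinfeld modules, so `K` is a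
Yetter-Drinfeld submodule; coassociativity gives `Δ(K) ⊆ K ⊗ B(V)`; and `K` has weights `≥ 0`, as
the counit shows. On weights `≥ 0` the projection `π₀` is multiplicative, and `I = K_{> r}` is the
kernel of `π₀` on `K`. Hence `K / I` is identified with the part of weight zero of `K`, by an
injection `p : K / I → B(V)` induced by `π₀`. For `x ∈ K` the element `(π₀ ⊗ id) Δ(x)` lies in
`K ⊗ K`, because `π₀ ⊗ π_q` kills `Δ(K)` for `q < 0`, and differs from `Δ(x)` by an element of
`I ⊗ B(V)`. This is the decomposition that defines the comultiplication of `K / I`, which thus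
becomes `(π₀ ⊗ π₀) Δ` under `p`. The bialgebra axioms of `K / I` follow from those of `B(V)` along
`p` (`BraidedData.IsBialgebra.of_injective`, `IsSplitting.transport_isBialgebra`), and the induced
structure is unique because every structure map of `K / I` is determined by `p` and a retraction
of it (`IsSplitting.eq_transport`).

The antipode comes from connectedness. The elements of degree `< n` form a filtration of `B(V)` with
`Δ(x) ∈ 1 ⊗ x + B(V) ⊗ F n` for `x ∈ F (n + 1)`; it restricts to `K / I`, and any endomorphism of a
bialgebra with such a filtration that fixes `1` has a right convolution inverse, computed by an
iteration which becomes stationary (`BraidedData.IsBialgebra.exists_conv_eq`). Applied to the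
identity and then to its right inverse, this gives a two-sided inverse of the identity.

Two facts about `B(V)` itself have to be established. It is a braided bialgebra: this is proved for
`T(V)`, where the braided product on `T(V) ⊗ T(V)` is expressed by multiplication operators that
depend multiplicatively on their argument, so that the identities reduce to generators
(`tensorAlgebraData_isBialgebra`). And it is graded by weights: the sum of the weight components of
an ideal which occurs in the definition of `J(V)` is again such an ideal, so `J(V)` is stable under
the weight projections (`weightProj_mem_nicholsIdeal`).
-/

noncomputable section

namespace YetterDrinfeld

universe u v w w₁ w₂ w₃

open TensorAlgebra (ι)

/-! ### Action and coaction on the tensor algebra -/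

section General
variable {k : Type u} {H : Type v} [Field k] [Ring H] [HopfAlgebra k H]
variable {M : Type w} [AddCommGroup M] [Module k M]
variable {N : Type w₁} [AddCommGroup N] [Module k N]

theorem YDData.braidedMul_tmul (D : YDData k H M) (μ : M →ₗ[k] M →ₗ[k] M) (x y x' y' : M) :
    D.braidedMul μ (x ⊗ₜ y) (x' ⊗ₜ y') =
      TensorProduct.map (μ x ∘ₗ D.act.flip x') (μ.flip y') (D.coact y) := by
  simp only [braidedMul, braiding, TensorProduct.curry_apply, LinearMap.coe_comp,
    LinearEquiv.coe_coe, Function.comp_apply, TensorProduct.assoc_tmul, LinearMap.lTensor_tmul,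
    TensorProduct.assoc_symm_tmul, LinearMap.rTensor_tmul]
  induction D.coact y using TensorProduct.induction_on with
  | zero => simp
  | tmul h z => simp
  | add a b ha hb => simp only [TensorProduct.add_tmul, TensorProduct.tmul_add, map_add, ha, hb]

theorem YDData.tensor_coact_tmul (D : YDData k H M) (E : YDData k H N) (m : M) (n : N) :
    (D.tensor E).coact (m ⊗ₜ n) = (LinearMap.mul' k H).rTensor (M ⊗[k] N)
      (TensorProduct.tensorTensorTensorComm k H M H N (D.coact m ⊗ₜ E.coact n)) := rfl

theorem YDData.tensor_act_tmul (D : YDData k H M) (E : YDData k H N) (h : H) (m : M) (n : N) :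
    (D.tensor E).act h (m ⊗ₜ n) =
      TensorProduct.map (D.act.flip m) (E.act.flip n) (Coalgebra.comul (R := k) h) := by
  simp only [tensor, diagAct, LinearMap.coe_comp, Function.comp_apply]
  induction Coalgebra.comul (R := k) h using TensorProduct.induction_on with
  | zero => simp
  | tmul h z => simp
  | add a b ha hb => simp only [LinearMap.add_apply, map_add, ha, hb]

end General

section
variable {k : Type u} {H : Type v} [Field k] [Ring H] [HopfAlgebra k H]
variable {V : Type w} [AddCommGroup V] [Module k V]

/-- To prove a statement for all of `T(V)`, it suffices to pass from `x` to `v x` for `v ∈ V`. -/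
theorem tensorAlgebra_left_induction {P : TensorAlgebra k V → Prop} (one : P 1)
    (add : ∀ x y, P x → P y → P (x + y)) (smul : ∀ (c : k) x, P x → P (c • x))
    (ι_mul : ∀ v x, P x → P (ι k v * x)) (x : TensorAlgebra k V) : P x := by
  suffices h : ∀ y, P y → P (x * y) by simpa using h 1 one
  induction x using TensorAlgebra.induction with
  | algebraMap r => intro y hy; rw [← Algebra.smul_def]; exact smul r y hy
  | ι v => exact ι_mul v
  | mul a b ha hb => intro y hy; rw [mul_assoc]; exact ha _ (hb y hy)
  | add a b ha hb => intro y hy; rw [add_mul]; exact add _ _ (ha y hy) (hb y hy)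

variable (D : YDData k H V)

local notation "T" => TensorAlgebra k V
local notation "DT" => tensorAlgebraYD D

theorem tensorAlgebra_act_mul (h : H) (x y : T) : (DT).act h (x * y) =
    LinearMap.mul' k T (TensorProduct.map ((DT).act.flip x) ((DT).act.flip y)
      (Coalgebra.comul (R := k) h)) := by
  change (tensorAlgebraActHom D (x * y)).ofConv h = _
  rw [map_mul, LinearMap.convMul_apply]
  rfl

theorem tensorAlgebra_act_one (h : H) : (DT).act h 1 = Coalgebra.counit (R := k) h • 1 := by
  change (tensorAlgebraActHom D 1).ofConv h = _
  rw [map_one, LinearMap.convOne_apply, Algebra.algebraMap_eq_smul_one]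

theorem tensorAlgebra_act_ι (h : H) (v : V) : (DT).act h (ι k v) = ι k (D.act h v) := by
  change (tensorAlgebraActHom D (ι k v)).ofConv h = _
  rw [tensorAlgebraActHom, TensorAlgebra.lift_ι_apply]
  rfl

/-- The coaction of `T(V)`, as an algebra map. -/
def tensorAlgebraCoactHom : T →ₐ[k] H ⊗[k] T :=
  TensorAlgebra.lift k ((ι k (M := V)).lTensor H ∘ₗ D.coact)

theorem tensorAlgebraCoactHom_apply (x : T) : tensorAlgebraCoactHom D x = (DT).coact x := rfl

theorem tensorAlgebra_coact_mul (x y : T) : (DT).coact (x * y) = (DT).coact x * (DT).coact y :=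
  map_mul (tensorAlgebraCoactHom D) x y

theorem tensorAlgebra_coact_one : (DT).coact 1 = 1 := map_one (tensorAlgebraCoactHom D)

theorem tensorAlgebra_coact_ι (v : V) : (DT).coact (ι k v) = (ι k (M := V)).lTensor H (D.coact v) :=
  TensorAlgebra.lift_ι_apply _ _

variable {D} (hD : D.IsYD)
include hD

theorem tensorAlgebra_one_act (x : T) : (DT).act 1 x = x := by
  induction x using TensorAlgebra.induction with
  | algebraMap r => simp [Algebra.algebraMap_eq_smul_one, tensorAlgebra_act_one]
  | ι v => rw [tensorAlgebra_act_ι, hD.one_act]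
  | mul a b ha hb => simp [tensorAlgebra_act_mul, Algebra.TensorProduct.one_def, ha, hb]
  | add a b ha hb => rw [map_add, ha, hb]

theorem tensorAlgebra_mul_act (g h : H) (x : T) :
    (DT).act (g * h) x = (DT).act g ((DT).act h x) := by
  induction x using TensorAlgebra.induction generalizing g h with
  | algebraMap r => simp [Algebra.algebraMap_eq_smul_one, tensorAlgebra_act_one, mul_smul,
      smul_comm (Coalgebra.counit (R := k) g)]
  | ι v => simp only [tensorAlgebra_act_ι, hD.mul_act]
  | mul a b ha hb =>
    simp only [tensorAlgebra_act_mul, Bialgebra.comul_mul]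
    rw [← (Coalgebra.Repr.arbitrary k h).eq, ← (Coalgebra.Repr.arbitrary k g).eq]
    simp only [Finset.sum_mul_sum, map_sum, Algebra.TensorProduct.tmul_mul_tmul,
      TensorProduct.map_tmul, LinearMap.flip_apply, LinearMap.mul'_apply, ha, hb,
      tensorAlgebra_act_mul]
    rw [Finset.sum_comm]
    refine Finset.sum_congr rfl fun i _ => ?_
    rw [← (Coalgebra.Repr.arbitrary k g).eq]
    simp
  | add a b ha hb => simp only [map_add, ha, hb]

theorem tensorAlgebra_counit_coact (x : T) :
    TensorProduct.lid k T ((Coalgebra.counit (R := k) (A := H)).rTensor T ((DT).coact x)) = x := by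
  have : (((Algebra.TensorProduct.lid k T).toAlgHom.comp (Algebra.TensorProduct.map
      (Bialgebra.counitAlgHom k H) (AlgHom.id k T))).comp (tensorAlgebraCoactHom D)) =
      AlgHom.id k T := by
    refine TensorAlgebra.hom_ext (LinearMap.ext fun v => ?_)
    change TensorProduct.lid k T ((Coalgebra.counit (R := k) (A := H)).rTensor T
      ((DT).coact (ι k v))) = ι k v
    conv_rhs => rw [← hD.counit_coact v]
    rw [tensorAlgebra_coact_ι]
    induction D.coact v using TensorProduct.induction_on with
    | zero => simp
    | tmul h z => simp
    | add a b ha hb => simp only [map_add, ha, hb]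
  exact DFunLike.congr_fun this x

theorem tensorAlgebra_coassoc (x : T) : TensorProduct.assoc k H H T
      ((Coalgebra.comul (R := k) (A := H)).rTensor T ((DT).coact x)) =
    (DT).coact.lTensor H ((DT).coact x) := by
  have : ((Algebra.TensorProduct.assoc k k k H H T).toAlgHom.comp (Algebra.TensorProduct.map
      (Bialgebra.comulAlgHom k H) (AlgHom.id k T))).comp (tensorAlgebraCoactHom D) =
      (Algebra.TensorProduct.map (AlgHom.id k H) (tensorAlgebraCoactHom D)).comp
        (tensorAlgebraCoactHom D) := by
    refine TensorAlgebra.hom_ext (LinearMap.ext fun v => ?_)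
    change TensorProduct.assoc k H H T ((Coalgebra.comul (R := k) (A := H)).rTensor T
      ((DT).coact (ι k v))) = (DT).coact.lTensor H ((DT).coact (ι k v))
    rw [tensorAlgebra_coact_ι]
    trans ((ι k (M := V)).lTensor H).lTensor H (D.coact.lTensor H (D.coact v))
    · rw [← hD.coassoc]
      induction D.coact v using TensorProduct.induction_on with
      | zero => simp
      | tmul h z =>
        simp only [LinearMap.lTensor_tmul, LinearMap.rTensor_tmul]
        induction Coalgebra.comul (R := k) h using TensorProduct.induction_on with
        | zero => simp
        | tmul h z => simp
        | add a b ha hb => simp only [map_add, TensorProduct.add_tmul, ha, hb]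
      | add a b ha hb => simp only [map_add, ha, hb]
    · induction D.coact v using TensorProduct.induction_on with
      | zero => simp
      | tmul h z => simp [tensorAlgebra_coact_ι]
      | add a b ha hb => simp only [map_add, ha, hb]
  exact DFunLike.congr_fun this x

end

/-! ### The Yetter-Drinfeld condition for the tensor algebra -/

section
variable {k : Type u} {H : Type v} [Field k] [Ring H] [HopfAlgebra k H]
variable {V : Type w} [AddCommGroup V] [Module k V]

local notation "T" => TensorAlgebra k V
variable (D : YDData k H V)

local notation "DT" => tensorAlgebraYD D

open WithConv

/-- The linear map `H → H ⊗ T(V)`, `h ↦ x₍₋₁₎ ⊗ h · x₍₀₎`, in the convolution algebra. -/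
def actOnCoact (x : T) : WithConv (H →ₗ[k] H ⊗[k] T) :=
  toConv ((LinearMap.lTensorHom H ∘ₗ (DT).act).flip ((DT).coact x))

/-- The linear map `H → H ⊗ T(V)`, `h ↦ coact (h · x)`, in the convolution algebra. -/
def coactOfAct (x : T) : WithConv (H →ₗ[k] H ⊗[k] T) :=
  toConv ((DT).coact ∘ₗ (DT).act.flip x)

/-- The linear map `H → H ⊗ T(V)`, `h ↦ h ⊗ 1`, in the convolution algebra. -/
def inclLeft (k : Type u) (H : Type v) (V : Type w) [Field k] [Ring H] [HopfAlgebra k H]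
    [AddCommGroup V] [Module k V] : WithConv (H →ₗ[k] H ⊗[k] TensorAlgebra k V) :=
  toConv ((TensorProduct.mk k H (TensorAlgebra k V)).flip 1)

theorem coactOfAct_mul (x y : T) : coactOfAct D (x * y) = coactOfAct D x * coactOfAct D y := by
  have := LinearMap.algHom_comp_convMul_distrib (tensorAlgebraCoactHom D)
    (tensorAlgebraActHom D x) (tensorAlgebraActHom D y)
  rw [← map_mul] at this
  exact WithConv.ext this

theorem actOnCoact_mul (x y : T) : actOnCoact D (x * y) = actOnCoact D x * actOnCoact D y := by
  refine WithConv.ext (LinearMap.ext fun h => ?_)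
  rw [LinearMap.convMul_apply]
  simp only [actOnCoact, LinearMap.flip_apply, LinearMap.coe_comp, Function.comp_apply,
    LinearMap.coe_lTensorHom, tensorAlgebra_coact_mul]
  induction (DT).coact x using TensorProduct.induction_on with
  | zero => simp
  | add a b ha hb => simp only [add_mul, map_add, ha, hb, TensorProduct.map_add_left,
      LinearMap.add_apply]
  | tmul g a =>
    induction (DT).coact y using TensorProduct.induction_on with
    | zero => simp
    | add c d hc hd => simp only [mul_add, map_add, hc, hd, TensorProduct.map_add_right,
        LinearMap.add_apply]
    | tmul g' a' =>
      simp only [Algebra.TensorProduct.tmul_mul_tmul, LinearMap.lTensor_tmul,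
        tensorAlgebra_act_mul]
      induction Coalgebra.comul (R := k) h using TensorProduct.induction_on with
      | zero => simp
      | add c d hc hd => simp only [map_add, TensorProduct.tmul_add, hc, hd]
      | tmul c d => simp

/-- The left-hand side of the Yetter-Drinfeld condition as a convolution product. -/
theorem diagAct_coact_eq (h : H) (x : T) : diagAct (LinearMap.mul k H) (DT).act h ((DT).coact x) =
    (inclLeft k H V * actOnCoact D x).ofConv h := by
  rw [LinearMap.convMul_apply]
  simp only [diagAct, inclLeft, actOnCoact, LinearMap.coe_comp, Function.comp_apply]
  induction Coalgebra.comul (R := k) h using TensorProduct.induction_on with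
  | zero => simp
  | add c d hc hd => simp only [map_add, LinearMap.add_apply, hc, hd]
  | tmul c d =>
    induction (DT).coact x using TensorProduct.induction_on with
    | zero => simp
    | add a b ha hb =>
      simp only [map_add, ha, hb, TensorProduct.map_add_right, LinearMap.add_apply]
    | tmul g a => simp

/-- The right-hand side of the Yetter-Drinfeld condition as a convolution product. -/
theorem coact_act_eq (h : H) (x : T) : (LinearMap.mul' k H).rTensor T
      (TensorProduct.rightComm k H T H
        (((DT).coact ∘ₗ (DT).act.flip x).rTensor H (Coalgebra.comul (R := k) h))) =
    (coactOfAct D x * inclLeft k H V).ofConv h := by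
  rw [LinearMap.convMul_apply]
  simp only [inclLeft, coactOfAct]
  induction Coalgebra.comul (R := k) h using TensorProduct.induction_on with
  | zero => simp
  | add c d hc hd => simp only [map_add, hc, hd]
  | tmul c d =>
    simp only [LinearMap.rTensor_tmul, LinearMap.coe_comp, Function.comp_apply,
      LinearMap.flip_apply, TensorProduct.map_tmul, LinearMap.mul'_apply]
    induction (DT).coact ((DT).act c x) using TensorProduct.induction_on with
    | zero => simp
    | add a b ha hb => simp only [map_add, ha, hb, TensorProduct.add_tmul, add_mul]
    | tmul g a => simp

variable {D} (hD : D.IsYD)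
include hD

/-- The Yetter-Drinfeld condition, in the convolution algebra. Both `actOnCoact` and `coactOfAct`
are multiplicative in `x`, so it suffices to check it for `x ∈ V`. -/
theorem inclLeft_mul_actOnCoact (x : T) :
    inclLeft k H V * actOnCoact D x = coactOfAct D x * inclLeft k H V := by
  induction x using TensorAlgebra.induction with
  | algebraMap r =>
    have h1 : actOnCoact D (r • 1) = r • 1 := by
      refine WithConv.ext (LinearMap.ext fun h => ?_)
      simp [actOnCoact, tensorAlgebra_coact_one, Algebra.TensorProduct.one_def,
        tensorAlgebra_act_one, Algebra.algebraMap_eq_smul_one]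
    have h2 : coactOfAct D (r • 1) = r • 1 := by
      refine WithConv.ext (LinearMap.ext fun h => ?_)
      simp [coactOfAct, tensorAlgebra_coact_one, tensorAlgebra_act_one,
        Algebra.algebraMap_eq_smul_one]
    rw [Algebra.algebraMap_eq_smul_one, h1, h2, mul_smul_comm, smul_mul_assoc, mul_one, one_mul]
  | ι v =>
    refine WithConv.ext (LinearMap.ext fun h => ?_)
    rw [← diagAct_coact_eq, ← coact_act_eq]
    have := congrArg ((ι k (M := V)).lTensor H) (hD.compat h v)
    convert this using 1
    · rw [tensorAlgebra_coact_ι, diagAct, diagAct, LinearMap.comp_apply, LinearMap.comp_apply]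
      induction Coalgebra.comul (R := k) h using TensorProduct.induction_on with
      | zero => simp
      | add c d hc hd => simp only [map_add, LinearMap.add_apply, hc, hd]
      | tmul c d =>
        induction D.coact v using TensorProduct.induction_on with
        | zero => simp
        | add a b ha hb => simp only [map_add, ha, hb]
        | tmul g a => simp [tensorAlgebra_act_ι]
    · induction Coalgebra.comul (R := k) h using TensorProduct.induction_on with
      | zero => simp
      | add c d hc hd => simp only [map_add, hc, hd]
      | tmul c d =>
        simp only [LinearMap.rTensor_tmul, LinearMap.coe_comp, Function.comp_apply,
          LinearMap.flip_apply, tensorAlgebra_act_ι, tensorAlgebra_coact_ι]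
        induction D.coact (D.act c v) using TensorProduct.induction_on with
        | zero => simp
        | add a b ha hb => simp only [map_add, ha, hb, TensorProduct.add_tmul]
        | tmul g a => simp
  | mul a b ha hb =>
    rw [actOnCoact_mul, coactOfAct_mul, ← mul_assoc, ha, mul_assoc, hb, mul_assoc]
  | add a b ha hb =>
    have h1 : actOnCoact D (a + b) = actOnCoact D a + actOnCoact D b := by
      simp [actOnCoact]
    have h2 : coactOfAct D (a + b) = coactOfAct D a + coactOfAct D b := by
      simp [coactOfAct, LinearMap.comp_add]
    rw [h1, h2, mul_add, add_mul, ha, hb]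

theorem tensorAlgebra_isYD : (DT).IsYD where
  one_act := tensorAlgebra_one_act hD
  mul_act := tensorAlgebra_mul_act hD
  counit_coact := tensorAlgebra_counit_coact hD
  coassoc := tensorAlgebra_coassoc hD
  compat h x := by rw [diagAct_coact_eq, inclLeft_mul_actOnCoact hD, coact_act_eq]

end

/-! ### The braided product on `T(V) ⊗ T(V)` -/

section
variable {k : Type u} {H : Type v} [Field k] [Ring H] [HopfAlgebra k H]
variable {V : Type w} [AddCommGroup V] [Module k V]

local notation "T" => TensorAlgebra k V

variable {D : YDData k H V}

local notation "DT" => tensorAlgebraYD D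

/-- Left multiplication by `x ⊗ 1` on the braided tensor product `T(V) ⊗ T(V)`. -/
def mulLeft (k : Type u) (V : Type w) [Field k] [AddCommGroup V] [Module k V] :
    TensorAlgebra k V →ₐ[k] Module.End k (TensorAlgebra k V ⊗[k] TensorAlgebra k V) :=
  (Module.End.rTensorAlgHom k (TensorAlgebra k V) (TensorAlgebra k V)).comp
    (Algebra.lmul k (TensorAlgebra k V))

theorem mulLeft_tmul (x a b : T) : mulLeft k V x (a ⊗ₜ b) = (x * a) ⊗ₜ b := rfl

/-- The action of `H` on `T(V)` as an algebra map to the endomorphisms of `T(V)`. -/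
def tensorAlgebraActEnd (hD : D.IsYD) : H →ₐ[k] Module.End k T :=
  AlgHom.ofLinearMap (DT).act (LinearMap.ext (tensorAlgebra_one_act hD))
    (fun g h => LinearMap.ext (tensorAlgebra_mul_act hD g h))

/-- Left multiplication by `1 ⊗ y` on the braided tensor product `T(V) ⊗ T(V)`,
`a ⊗ b ↦ y₍₋₁₎ · a ⊗ y₍₀₎ b`; since `H` acts through an algebra map and the coaction is an algebra
map, this is one too. -/
def mulRight (hD : D.IsYD) : T →ₐ[k] Module.End k (T ⊗[k] T) :=
  Module.endTensorEndAlgHom.comp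
    ((Algebra.TensorProduct.map (tensorAlgebraActEnd hD) (Algebra.lmul k T)).comp
      (tensorAlgebraCoactHom D))

theorem mulRight_tmul (hD : D.IsYD) (y a b : T) : mulRight hD y (a ⊗ₜ b) =
    TensorProduct.map ((DT).act.flip a) ((LinearMap.mul k T).flip b) ((DT).coact y) := by
  simp only [mulRight, AlgHom.comp_apply, tensorAlgebraCoactHom_apply]
  induction (DT).coact y using TensorProduct.induction_on with
  | zero => simp
  | add s t hs ht => simp only [map_add, LinearMap.add_apply, hs, ht]
  | tmul h z => rfl

theorem braidedMul_tmul_eq (hD : D.IsYD) (x y : T) :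
    (DT).braidedMul (LinearMap.mul k T) (x ⊗ₜ y) = mulLeft k V x * mulRight hD y := by
  refine TensorProduct.ext' fun a b => ?_
  rw [YDData.braidedMul_tmul, Module.End.mul_apply, mulRight_tmul]
  induction (DT).coact y using TensorProduct.induction_on with
  | zero => simp
  | add s t hs ht => simp only [map_add, hs, ht]
  | tmul h z => rfl

/-- The exchange rule `(1 ⊗ y) (x ⊗ 1) = y₍₋₁₎ · x ⊗ y₍₀₎` for multiplication operators. -/
theorem mulRight_mul_mulLeft (hD : D.IsYD) (x y : T) : mulRight hD y * mulLeft k V x =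
    LinearMap.mul' k (Module.End k (T ⊗[k] T)) (TensorProduct.map
      ((mulLeft k V).toLinearMap ∘ₗ (DT).act.flip x) (mulRight hD).toLinearMap
        ((DT).coact y)) := by
  refine TensorProduct.ext' fun a b => ?_
  rw [Module.End.mul_apply, mulLeft_tmul, mulRight_tmul]
  let Θ : H ⊗[k] (H ⊗[k] T) →ₗ[k] T ⊗[k] T :=
    (LinearMap.mul' k T).rTensor T ∘ₗ (TensorProduct.assoc k T T T).symm.toLinearMap ∘ₗ
      TensorProduct.map ((DT).act.flip x)
        (TensorProduct.map ((DT).act.flip a) ((LinearMap.mul k T).flip b))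
  trans Θ (TensorProduct.assoc k H H T
    ((Coalgebra.comul (R := k) (A := H)).rTensor T ((DT).coact y)))
  · induction (DT).coact y using TensorProduct.induction_on with
    | zero => simp
    | add s t hs ht => simp only [map_add, hs, ht]
    | tmul h z =>
      simp only [TensorProduct.map_tmul, LinearMap.rTensor_tmul, LinearMap.flip_apply,
        tensorAlgebra_act_mul]
      induction Coalgebra.comul (R := k) h using TensorProduct.induction_on with
      | zero => simp
      | add s t hs ht => simp only [map_add, TensorProduct.add_tmul, hs, ht]
      | tmul c d => simp [Θ]
  · rw [tensorAlgebra_coassoc hD]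
    induction (DT).coact y using TensorProduct.induction_on with
    | zero => simp
    | add s t hs ht => simp only [map_add, LinearMap.add_apply, hs, ht]
    | tmul h z =>
      simp only [TensorProduct.map_tmul, LinearMap.lTensor_tmul, LinearMap.mul'_apply,
        LinearMap.comp_apply, AlgHom.toLinearMap_apply, Module.End.mul_apply, mulRight_tmul]
      induction (DT).coact z using TensorProduct.induction_on with
      | zero => simp
      | add s t hs ht => simp only [map_add, TensorProduct.tmul_add, hs, ht]
      | tmul c d => simp [Θ, mulLeft_tmul]

/-- Associativity of the braided tensor product `T(V) ⊗ T(V)`, in operator form. -/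
theorem braidedMul_braidedMul (hD : D.IsYD) (s t : T ⊗[k] T) :
    (DT).braidedMul (LinearMap.mul k T) ((DT).braidedMul (LinearMap.mul k T) s t) =
      (DT).braidedMul (LinearMap.mul k T) s ∘ₗ (DT).braidedMul (LinearMap.mul k T) t := by
  induction s using TensorProduct.induction_on with
  | zero => simp
  | add s t hs ht => simp only [map_add, LinearMap.add_apply, hs, ht, LinearMap.add_comp]
  | tmul x y =>
    induction t using TensorProduct.induction_on with
    | zero => simp
    | add s t hs ht => simp only [map_add, hs, ht, LinearMap.comp_add]
    | tmul x' y' =>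
      trans mulLeft k V x * (mulRight hD y * mulLeft k V x') * mulRight hD y'
      · rw [mulRight_mul_mulLeft, YDData.braidedMul_tmul]
        induction (DT).coact y using TensorProduct.induction_on with
        | zero => simp
        | add s t hs ht => simp only [map_add, mul_add, add_mul, hs, ht]
        | tmul h z =>
          simp only [TensorProduct.map_tmul, LinearMap.coe_comp, Function.comp_apply,
            LinearMap.flip_apply, LinearMap.mul_apply_apply, AlgHom.toLinearMap_apply,
            LinearMap.mul'_apply, braidedMul_tmul_eq hD, map_mul, mul_assoc]
      · rw [braidedMul_tmul_eq hD, braidedMul_tmul_eq hD, ← Module.End.mul_eq_comp]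
        simp only [mul_assoc]

/-- The algebra map from `T(V)` to the endomorphisms of `T(V) ⊗ T(V)` by which
`tensorAlgebraComul` is defined; it is left multiplication by `Δ(x)`, see `comulHom_eq`. -/
def comulHom (D : YDData k H V) : T →ₐ[k] Module.End k (T ⊗[k] T) :=
  TensorAlgebra.lift k ((tensorAlgebraYD D).braidedMul (LinearMap.mul k T) ∘ₗ primitiveElement k V)

theorem comulHom_apply_one (x : T) : comulHom D x (1 ⊗ₜ 1) = tensorAlgebraComul D x := rfl

theorem tensorAlgebraComul_one : tensorAlgebraComul D (1 : T) = 1 ⊗ₜ 1 := by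
  rw [← comulHom_apply_one, map_one, Module.End.one_apply]

theorem comulHom_ι (hD : D.IsYD) (v : V) :
    comulHom D (ι k v) = mulLeft k V (ι k v) + mulRight hD (ι k v) := by
  rw [comulHom, TensorAlgebra.lift_ι_apply]
  simp only [primitiveElement, LinearMap.coe_comp, Function.comp_apply, LinearMap.add_apply,
    LinearMap.flip_apply, TensorProduct.mk_apply, map_add, braidedMul_tmul_eq hD, map_one, mul_one,
    one_mul]

/-- `Δ(v x) = (v ⊗ 1 + 1 ⊗ v) Δ(x)`. -/
theorem tensorAlgebraComul_ι_mul (hD : D.IsYD) (v : V) (x : T) :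
    tensorAlgebraComul D (ι k v * x) = mulLeft k V (ι k v) (tensorAlgebraComul D x) +
      mulRight hD (ι k v) (tensorAlgebraComul D x) := by
  rw [← comulHom_apply_one, map_mul, Module.End.mul_apply, comulHom_ι hD]
  rfl

theorem comulHom_eq (hD : D.IsYD) (x : T) : comulHom D x =
    (DT).braidedMul (LinearMap.mul k T) (tensorAlgebraComul D x) := by
  induction x using tensorAlgebra_left_induction with
  | one => rw [map_one, tensorAlgebraComul_one, braidedMul_tmul_eq hD, map_one, map_one, one_mul]
  | add x y hx hy => simp only [map_add, hx, hy]
  | smul c x hx => simp only [map_smul, hx]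
  | ι_mul v x hx =>
    rw [← comulHom_apply_one (ι k v * x), map_mul, Module.End.mul_apply, comulHom_apply_one, hx,
      comulHom, TensorAlgebra.lift_ι_apply, LinearMap.comp_apply, braidedMul_braidedMul hD]
    rfl

theorem tensorAlgebraComul_mul (hD : D.IsYD) (x y : T) : tensorAlgebraComul D (x * y) =
    (DT).braidedMul (LinearMap.mul k T) (tensorAlgebraComul D x) (tensorAlgebraComul D y) := by
  rw [← comulHom_apply_one, map_mul, Module.End.mul_apply, comulHom_apply_one, comulHom_eq hD]

end

/-! ### Linearity of the comultiplication of the tensor algebra -/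

section
variable {k : Type u} {H : Type v} [Field k] [Ring H] [HopfAlgebra k H]
variable {V : Type w} [AddCommGroup V] [Module k V]

local notation "T" => TensorAlgebra k V

variable {D : YDData k H V}

local notation "DT" => tensorAlgebraYD D

open WithConv

/-- The linear map `h ↦ ε(h) e`, in the convolution algebra. -/
def convConst (k : Type u) (H : Type v) [Field k] [Ring H] [HopfAlgebra k H] {E : Type*}
    [Semiring E] [Algebra k E] (e : E) : WithConv (H →ₗ[k] E) :=
  toConv (LinearMap.toSpanSingleton k E e ∘ₗ Coalgebra.counit (R := k) (A := H))

theorem mul_convConst_apply {E : Type*} [Semiring E] [Algebra k E] (G : WithConv (H →ₗ[k] E))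
    (e : E) (h : H) : (G * convConst k H e).ofConv h = G.ofConv h * e := by
  rw [LinearMap.convMul_apply]
  trans LinearMap.mul' k E (TensorProduct.map G.ofConv (LinearMap.toSpanSingleton k E e)
    ((Coalgebra.counit (R := k) (A := H)).lTensor H (Coalgebra.comul (R := k) h)))
  · rw [convConst, ofConv_toConv, LinearMap.lTensor_def, TensorProduct.map_map,
      LinearMap.comp_id]
  · rw [Coalgebra.lTensor_counit_comul]
    simp

theorem convConst_mul {E : Type*} [Semiring E] [Algebra k E] (e e' : E) :
    convConst k H (e * e') = convConst k H e * convConst k H e' := by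
  refine WithConv.ext (LinearMap.ext fun h => ?_)
  rw [mul_convConst_apply]
  simp [convConst]

/-- `h · ((x ⊗ 1) t) = (h₍₁₎ · x ⊗ 1) (h₍₂₎ · t)`. -/
theorem act_mulLeft (h : H) (x : T) (t : T ⊗[k] T) :
    ((DT).tensor DT).act h (mulLeft k V x t) =
      LinearMap.mul' k (Module.End k (T ⊗[k] T)) (TensorProduct.map
        ((mulLeft k V).toLinearMap ∘ₗ (DT).act.flip x) (((DT).tensor DT).act)
          (Coalgebra.comul (R := k) h)) t := by
  induction t using TensorProduct.induction_on with
  | zero => simp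
  | add s t hs ht => simp only [map_add, hs, ht]
  | tmul a b =>
    let Θ : H ⊗[k] (H ⊗[k] H) →ₗ[k] T ⊗[k] T :=
      (LinearMap.mul' k T).rTensor T ∘ₗ (TensorProduct.assoc k T T T).symm.toLinearMap ∘ₗ
        TensorProduct.map ((DT).act.flip x)
          (TensorProduct.map ((DT).act.flip a) ((DT).act.flip b))
    rw [mulLeft_tmul, YDData.tensor_act_tmul]
    trans Θ (TensorProduct.assoc k H H H
      ((Coalgebra.comul (R := k) (A := H)).rTensor H (Coalgebra.comul (R := k) h)))
    · induction Coalgebra.comul (R := k) h using TensorProduct.induction_on with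
      | zero => simp
      | add s t hs ht => simp only [map_add, hs, ht]
      | tmul h z =>
        simp only [TensorProduct.map_tmul, LinearMap.rTensor_tmul, LinearMap.flip_apply,
          tensorAlgebra_act_mul]
        induction Coalgebra.comul (R := k) h using TensorProduct.induction_on with
        | zero => simp
        | add s t hs ht => simp only [map_add, TensorProduct.add_tmul, hs, ht]
        | tmul c d => simp [Θ]
    · rw [Coalgebra.coassoc_apply]
      induction Coalgebra.comul (R := k) h using TensorProduct.induction_on with
      | zero => simp
      | add s t hs ht => simp only [map_add, LinearMap.add_apply, hs, ht]
      | tmul h z =>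
        simp only [TensorProduct.map_tmul, LinearMap.lTensor_tmul, LinearMap.mul'_apply,
          LinearMap.comp_apply, AlgHom.toLinearMap_apply, Module.End.mul_apply]
        rw [YDData.tensor_act_tmul]
        induction Coalgebra.comul (R := k) z using TensorProduct.induction_on with
        | zero => simp
        | add s t hs ht => simp only [map_add, TensorProduct.tmul_add, hs, ht]
        | tmul c d => simp [Θ, mulLeft_tmul]

/-- `h · ((1 ⊗ y) t) = (1 ⊗ h₍₁₎ · y) (h₍₂₎ · t)`, by the Yetter-Drinfeld condition. -/
theorem act_mulRight (hD : D.IsYD) (h : H) (y : T) (t : T ⊗[k] T) :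
    ((DT).tensor DT).act h (mulRight hD y t) =
      LinearMap.mul' k (Module.End k (T ⊗[k] T)) (TensorProduct.map
        ((mulRight hD).toLinearMap ∘ₗ (DT).act.flip y) ((DT).tensor DT).act
          (Coalgebra.comul (R := k) h)) t := by
  induction t using TensorProduct.induction_on with
  | zero => simp
  | add s t hs ht => simp only [map_add, hs, ht]
  | tmul a b =>
    -- `Γ ((g ⊗ z) ⊗ g') = g · a ⊗ z (g' · b)`
    let Γ : (H ⊗[k] T) ⊗[k] H →ₗ[k] T ⊗[k] T :=
      (LinearMap.mul' k T).lTensor T ∘ₗ (TensorProduct.assoc k T T T).toLinearMap ∘ₗ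
        TensorProduct.map (((DT).act.flip a).rTensor T) ((DT).act.flip b)
    let Θ : H ⊗[k] (H ⊗[k] H) →ₗ[k] T ⊗[k] T :=
      Γ ∘ₗ ((TensorProduct.map₂ (LinearMap.mul k H) (DT).act).flip
        ((DT).coact y)).rTensor H ∘ₗ (TensorProduct.assoc k H H H).symm.toLinearMap
    let Θ' : H ⊗[k] (H ⊗[k] H) →ₗ[k] T ⊗[k] T :=
      Γ ∘ₗ ((LinearMap.mul' k H).rTensor T ∘ₗ (TensorProduct.rightComm k H T H).toLinearMap ∘ₗ
        ((DT).coact ∘ₗ (DT).act.flip y).rTensor H).rTensor H ∘ₗ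
          (TensorProduct.assoc k H H H).symm.toLinearMap
    trans Θ (TensorProduct.assoc k H H H
      ((Coalgebra.comul (R := k) (A := H)).rTensor H (Coalgebra.comul (R := k) h)))
    · rw [Coalgebra.coassoc_apply, mulRight_tmul]
      simp only [Θ, LinearMap.comp_apply, LinearEquiv.coe_coe]
      induction (DT).coact y using TensorProduct.induction_on with
      | zero => simp
      | add s t hs ht =>
        simp only [map_add, hs, ht, LinearMap.rTensor_add, LinearMap.add_apply]
      | tmul g z =>
        rw [TensorProduct.map_tmul, YDData.tensor_act_tmul]
        induction Coalgebra.comul (R := k) h using TensorProduct.induction_on with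
        | zero => simp
        | add s t hs ht => simp only [map_add, hs, ht]
        | tmul c d =>
          simp only [TensorProduct.map_tmul, LinearMap.lTensor_tmul, LinearMap.flip_apply,
            LinearMap.mul_apply_apply, tensorAlgebra_act_mul]
          induction Coalgebra.comul (R := k) d using TensorProduct.induction_on with
          | zero => simp
          | add s t hs ht => simp only [map_add, TensorProduct.tmul_add, hs, ht]
          | tmul e f => simp [Γ, tensorAlgebra_mul_act hD]
    trans Θ' (TensorProduct.assoc k H H H
      ((Coalgebra.comul (R := k) (A := H)).rTensor H (Coalgebra.comul (R := k) h)))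
    · induction Coalgebra.comul (R := k) h using TensorProduct.induction_on with
      | zero => simp
      | add s t hs ht => simp only [map_add, hs, ht]
      | tmul c d =>
        have := (tensorAlgebra_isYD hD).compat c y
        rw [diagAct] at this
        simp only [LinearMap.rTensor_tmul, Θ, Θ', LinearMap.comp_apply, LinearEquiv.coe_coe,
          LinearEquiv.symm_apply_apply, LinearMap.flip_apply] at this ⊢
        rw [this]
    · rw [Coalgebra.coassoc_apply]
      induction Coalgebra.comul (R := k) h using TensorProduct.induction_on with
      | zero => simp
      | add s t hs ht => simp only [map_add, LinearMap.add_apply, hs, ht]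
      | tmul c d =>
        simp only [TensorProduct.map_tmul, LinearMap.lTensor_tmul, LinearMap.mul'_apply,
          LinearMap.comp_apply, AlgHom.toLinearMap_apply, Module.End.mul_apply]
        rw [YDData.tensor_act_tmul]
        induction Coalgebra.comul (R := k) d using TensorProduct.induction_on with
        | zero => simp
        | add s t hs ht => simp only [map_add, TensorProduct.tmul_add, hs, ht]
        | tmul e f =>
          simp only [TensorProduct.map_tmul, mulRight_tmul, LinearMap.flip_apply, Θ',
            LinearMap.comp_apply, LinearEquiv.coe_coe, TensorProduct.assoc_symm_tmul,
            LinearMap.rTensor_tmul]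
          induction (DT).coact ((DT).act c y) using TensorProduct.induction_on with
          | zero => simp
          | add s t hs ht => simp only [map_add, TensorProduct.add_tmul, hs, ht]
          | tmul p q => simp [Γ, tensorAlgebra_mul_act hD]

/-- The comultiplication of `T(V)` is `H`-linear: the identity
`h · (Δ(x) t) = Δ(h₍₁₎ · x) (h₍₂₎ · t)`, written in the convolution algebra, is multiplicative in `x`
and holds for `x ∈ V`; at `t = 1 ⊗ 1` it is the claim. -/
theorem act_tensorAlgebraComul (hD : D.IsYD) (h : H) (x : T) :
    tensorAlgebraComul D ((DT).act h x) = ((DT).tensor DT).act h (tensorAlgebraComul D x) := by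
  let ρ : WithConv (H →ₗ[k] Module.End k (T ⊗[k] T)) := toConv ((DT).tensor DT).act
  let F : T → WithConv (H →ₗ[k] Module.End k (T ⊗[k] T)) := fun x =>
    toConv ((comulHom D).toLinearMap ∘ₗ (DT).act.flip x)
  have F_mul (x y : T) : F (x * y) = F x * F y := by
    have := LinearMap.algHom_comp_convMul_distrib (comulHom D)
      (tensorAlgebraActHom D x) (tensorAlgebraActHom D y)
    rw [← map_mul] at this
    exact WithConv.ext this
  have key (x : T) : ρ * convConst k H (comulHom D x) = F x * ρ := by
    induction x using TensorAlgebra.induction with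
    | algebraMap r =>
      have h1 : convConst k H (comulHom D (algebraMap k T r)) = r • 1 := by
        refine WithConv.ext (LinearMap.ext fun h => ?_)
        rw [Algebra.algebraMap_eq_smul_one, map_smul, map_one]
        simp [convConst, Algebra.algebraMap_eq_smul_one, smul_comm _ r]
      have h2 : F (algebraMap k T r) = r • 1 := by
        refine WithConv.ext (LinearMap.ext fun h => ?_)
        simp [F, tensorAlgebra_act_one, Algebra.algebraMap_eq_smul_one]
      rw [h1, h2, mul_smul_comm, smul_mul_assoc, mul_one, one_mul]
    | ι v =>
      refine WithConv.ext (LinearMap.ext fun h => LinearMap.ext fun t => ?_)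
      rw [mul_convConst_apply, LinearMap.convMul_apply, comulHom_ι hD, Module.End.mul_apply,
        LinearMap.add_apply]
      simp only [ρ, F, map_add, act_mulLeft, act_mulRight hD]
      rw [← LinearMap.add_apply]
      congr 1
      induction Coalgebra.comul (R := k) h using TensorProduct.induction_on with
      | zero => simp
      | add s t hs ht => simp only [map_add, ← hs, ← ht]; abel
      | tmul c d =>
        simp [tensorAlgebra_act_ι, comulHom_ι hD, add_mul]
    | mul a b ha hb =>
      rw [F_mul, map_mul, convConst_mul, ← mul_assoc, ha, mul_assoc, hb, mul_assoc]
    | add a b ha hb =>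
      have h1 : F (a + b) = F a + F b := by simp [F, LinearMap.comp_add]
      have h2 : convConst k H (comulHom D (a + b)) =
          convConst k H (comulHom D a) + convConst k H (comulHom D b) := by
        refine WithConv.ext (LinearMap.ext fun h => ?_)
        simp [convConst]
      rw [h1, h2, mul_add, add_mul, ha, hb]
  have := congrArg (fun f : WithConv (H →ₗ[k] Module.End k (T ⊗[k] T)) => f.ofConv h (1 ⊗ₜ 1))
    (key x)
  simp only [mul_convConst_apply, Module.End.mul_apply, comulHom_apply_one] at this
  refine Eq.trans ?_ this.symm
  rw [LinearMap.convMul_apply]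
  -- `H` acts on `1 ⊗ 1` by the counit
  trans LinearMap.mul' k (Module.End k (T ⊗[k] T)) (TensorProduct.map (F x).ofConv
    (LinearMap.toSpanSingleton k (Module.End k (T ⊗[k] T)) 1)
    ((Coalgebra.counit (R := k) (A := H)).lTensor H (Coalgebra.comul (R := k) h))) (1 ⊗ₜ 1)
  · rw [Coalgebra.lTensor_counit_comul]
    simp [F, comulHom_apply_one]
  · induction Coalgebra.comul (R := k) h using TensorProduct.induction_on with
    | zero => simp
    | add s t hs ht => simp only [map_add, LinearMap.add_apply, hs, ht]
    | tmul c d =>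
      have h1 : ((DT).tensor DT).act d (1 ⊗ₜ 1) = Coalgebra.counit (R := k) d • (1 ⊗ₜ 1) := by
        rw [YDData.tensor_act_tmul]
        conv_rhs => rw [← Coalgebra.sum_counit_smul (Coalgebra.Repr.arbitrary k d)]
        rw [← (Coalgebra.Repr.arbitrary k d).eq]
        simp [tensorAlgebra_act_one, Finset.sum_smul, TensorProduct.smul_tmul', mul_comm, smul_smul]
      simp [ρ, h1]

end

/-! ### Colinearity, coassociativity and counit of the tensor algebra -/

section
variable {k : Type u} {H : Type v} [Field k] [Ring H] [HopfAlgebra k H]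
variable {V : Type w} [AddCommGroup V] [Module k V]

local notation "T" => TensorAlgebra k V

variable {D : YDData k H V}

local notation "DT" => tensorAlgebraYD D

/-- The algebra map `x ↦ x₍₋₁₎ ⊗ F(x₍₀₎)` from `T(V)` to the endomorphisms of
`H ⊗ (T(V) ⊗ T(V))`, for an algebra map `F` from `T(V)` to the endomorphisms of
`T(V) ⊗ T(V)`. -/
def coactOperator (D : YDData k H V) (F : T →ₐ[k] Module.End k (T ⊗[k] T)) :
    T →ₐ[k] Module.End k (H ⊗[k] (T ⊗[k] T)) :=
  Module.endTensorEndAlgHom.comp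
    ((Algebra.TensorProduct.map (Algebra.lmul k H) F).comp (tensorAlgebraCoactHom D))

theorem coactOperator_apply (F : T →ₐ[k] Module.End k (T ⊗[k] T)) (x : T) :
    coactOperator D F x = TensorProduct.homTensorHomMap (RingHom.id k) H (T ⊗[k] T) H (T ⊗[k] T)
      (TensorProduct.map (LinearMap.mul k H) F.toLinearMap ((DT).coact x)) := by
  simp only [coactOperator, AlgHom.comp_apply, tensorAlgebraCoactHom_apply]
  induction (DT).coact x using TensorProduct.induction_on with
  | zero => simp
  | add s t hs ht => simp only [map_add, hs, ht]
  | tmul h z => rfl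

/-- The coaction of `(x ⊗ 1) t` is `x₍₋₁₎ t₍₋₁₎ ⊗ (x₍₀₎ ⊗ 1) t₍₀₎`. -/
theorem coact_mulLeft (x : T) (t : T ⊗[k] T) : ((DT).tensor DT).coact (mulLeft k V x t) =
    coactOperator D (mulLeft k V) x (((DT).tensor DT).coact t) := by
  induction t using TensorProduct.induction_on with
  | zero => simp
  | add s t hs ht => simp only [map_add, hs, ht]
  | tmul a b =>
    rw [mulLeft_tmul, YDData.tensor_coact_tmul, YDData.tensor_coact_tmul, coactOperator_apply,
      tensorAlgebra_coact_mul]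
    induction (DT).coact x using TensorProduct.induction_on with
    | zero => simp
    | add s t hs ht =>
      simp only [map_add, add_mul, TensorProduct.add_tmul, LinearMap.add_apply, hs, ht]
    | tmul g x' =>
      induction (DT).coact a using TensorProduct.induction_on with
      | zero => simp
      | add s t hs ht => simp only [map_add, mul_add, TensorProduct.add_tmul, hs, ht]
      | tmul c a' =>
        induction (DT).coact b using TensorProduct.induction_on with
        | zero => simp
        | add s t hs ht => simp only [map_add, TensorProduct.tmul_add, hs, ht]
        | tmul d b' => simp [mulLeft_tmul, mul_assoc]

/-- The coaction of `(1 ⊗ y) t` is `y₍₋₁₎ t₍₋₁₎ ⊗ (1 ⊗ y₍₀₎) t₍₀₎`, by the Yetter-Drinfeld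
condition. -/
theorem coact_mulRight (hD : D.IsYD) (y : T) (t : T ⊗[k] T) :
    ((DT).tensor DT).coact (mulRight hD y t) =
      coactOperator D (mulRight hD) y (((DT).tensor DT).coact t) := by
  induction t using TensorProduct.induction_on with
  | zero => simp
  | add s t hs ht => simp only [map_add, hs, ht]
  | tmul a b =>
    let Λ' : (H ⊗[k] T) ⊗[k] (H ⊗[k] T) →ₗ[k] H ⊗[k] (T ⊗[k] T) :=
      (LinearMap.mul' k H).rTensor (T ⊗[k] T) ∘ₗ
        (TensorProduct.tensorTensorTensorComm k H T H T).toLinearMap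
    -- `Λ ((c ⊗ x) ⊗ z) = c b₍₋₁₎ ⊗ (x ⊗ z b₍₀₎)`
    let Λ : (H ⊗[k] T) ⊗[k] T →ₗ[k] H ⊗[k] (T ⊗[k] T) := Λ' ∘ₗ
      (LinearMap.mulRight k ((DT).coact b) ∘ₗ TensorProduct.mk k H T 1).lTensor (H ⊗[k] T)
    let Θ : H ⊗[k] (H ⊗[k] T) →ₗ[k] H ⊗[k] (T ⊗[k] T) :=
      Λ' ∘ₗ TensorProduct.map ((DT).coact ∘ₗ (DT).act.flip a)
        (LinearMap.mulRight k ((DT).coact b))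
    let Θ' : H ⊗[k] (H ⊗[k] T) →ₗ[k] H ⊗[k] (T ⊗[k] T) :=
      Λ ∘ₗ ((TensorProduct.map₂ (LinearMap.mul k H) (DT).act).flip
        ((DT).coact a)).rTensor T ∘ₗ (TensorProduct.assoc k H H T).symm.toLinearMap
    trans Θ ((DT).coact.lTensor H ((DT).coact y))
    · rw [mulRight_tmul]
      induction (DT).coact y using TensorProduct.induction_on with
      | zero => simp
      | add s t hs ht => simp only [map_add, hs, ht]
      | tmul h z =>
        simp [YDData.tensor_coact_tmul, tensorAlgebra_coact_mul, Θ, Λ']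
    trans Θ' ((DT).coact.lTensor H ((DT).coact y))
    · rw [← tensorAlgebra_coassoc hD]
      induction (DT).coact y using TensorProduct.induction_on with
      | zero => simp
      | add s t hs ht => simp only [map_add, hs, ht]
      | tmul h z =>
        have := (tensorAlgebra_isYD hD).compat h a
        rw [diagAct] at this
        simp only [LinearMap.rTensor_tmul, Θ, Θ', LinearMap.comp_apply, LinearEquiv.coe_coe,
          LinearEquiv.symm_apply_apply, LinearMap.flip_apply] at this ⊢
        rw [this]
        induction Coalgebra.comul (R := k) h using TensorProduct.induction_on with
        | zero => simp
        | add s t hs ht => simp only [map_add, TensorProduct.add_tmul, hs, ht]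
        | tmul c d =>
          simp only [TensorProduct.assoc_tmul, TensorProduct.map_tmul, LinearMap.rTensor_tmul,
            LinearMap.comp_apply, LinearMap.flip_apply, Λ, LinearMap.lTensor_tmul,
            TensorProduct.mk_apply, LinearMap.mulRight_apply]
          induction (DT).coact ((DT).act c a) using TensorProduct.induction_on with
          | zero => simp
          | add s t hs ht => simp only [map_add, TensorProduct.add_tmul, hs, ht]
          | tmul p q =>
            induction (DT).coact b using TensorProduct.induction_on with
            | zero => simp
            | add s t hs ht => simp only [map_add, mul_add, TensorProduct.tmul_add, hs, ht]
            | tmul e f => simp [Λ', mul_assoc]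
    · rw [coactOperator_apply, YDData.tensor_coact_tmul]
      induction (DT).coact y using TensorProduct.induction_on with
      | zero => simp
      | add s t hs ht => simp only [map_add, LinearMap.add_apply, hs, ht]
      | tmul h z =>
        simp only [Θ', Λ, LinearMap.comp_apply, LinearMap.lTensor_tmul]
        induction (DT).coact a using TensorProduct.induction_on with
        | zero => simp
        | add s t hs ht =>
          simp only [map_add, TensorProduct.add_tmul, ← hs, ← ht, LinearMap.rTensor_add,
            LinearMap.add_apply]
        | tmul p q =>
          induction (DT).coact b using TensorProduct.induction_on with
          | zero => simp
          | add s t hs ht =>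
            have hadd : LinearMap.mulRight k (s + t) =
                LinearMap.mulRight k s + LinearMap.mulRight k t := by
              ext; simp [mul_add]
            simp only [map_add, TensorProduct.tmul_add, ← hs, ← ht, hadd, LinearMap.add_comp,
              LinearMap.lTensor_add, LinearMap.add_apply]
          | tmul e f =>
            simp only [TensorProduct.map_tmul, TensorProduct.tensorTensorTensorComm_tmul,
              LinearMap.rTensor_tmul, TensorProduct.homTensorHomMap_apply,
              AlgHom.toLinearMap_apply, mulRight_tmul]
            induction (DT).coact z using TensorProduct.induction_on with
            | zero => simp
            | add s t hs ht =>
              simp only [map_add, TensorProduct.tmul_add, hs, ht]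
            | tmul c d => simp [Λ', mul_assoc]

/-- The coaction of `Δ(x) t` is the product of the coactions of `Δ(x)` and `t`, written with
operators. -/
theorem coact_comulHom (hD : D.IsYD) (x : T) (t : T ⊗[k] T) :
    ((DT).tensor DT).coact (comulHom D x t) =
      coactOperator D (comulHom D) x (((DT).tensor DT).coact t) := by
  induction x using TensorAlgebra.induction generalizing t with
  | algebraMap r => simp [Algebra.algebraMap_eq_smul_one]
  | ι v =>
    rw [comulHom_ι hD, LinearMap.add_apply, map_add, coact_mulLeft, coact_mulRight hD,
      ← LinearMap.add_apply]
    congr 1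
    rw [coactOperator_apply, coactOperator_apply, coactOperator_apply, tensorAlgebra_coact_ι]
    induction D.coact v using TensorProduct.induction_on with
    | zero => simp
    | add s t hs ht => simp only [map_add, ← hs, ← ht]; abel
    | tmul h z => simp [comulHom_ι hD, TensorProduct.map_add_right]
  | mul a b ha hb => rw [map_mul, map_mul, Module.End.mul_apply, ha, hb, Module.End.mul_apply]
  | add a b ha hb => simp only [map_add, LinearMap.add_apply, ha, hb]

theorem coact_tensorAlgebraComul (hD : D.IsYD) (x : T) :
    ((DT).tensor DT).coact (tensorAlgebraComul D x) =
      (tensorAlgebraComul D).lTensor H ((DT).coact x) := by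
  rw [← comulHom_apply_one, coact_comulHom hD, YDData.tensor_coact_tmul, tensorAlgebra_coact_one,
    coactOperator_apply]
  induction (DT).coact x using TensorProduct.induction_on with
  | zero => simp
  | add s t hs ht => simp only [map_add, LinearMap.add_apply, hs, ht]
  | tmul h z => simp [Algebra.TensorProduct.one_def, comulHom_apply_one]

/-- Left multiplication by `v ⊗ 1 ⊗ 1 + 1 ⊗ v ⊗ 1 + 1 ⊗ 1 ⊗ v` on the braided tensor product of
three copies of `T(V)`. -/
def tripleMul (D : YDData k H V) (v : V) : Module.End k (T ⊗[k] (T ⊗[k] T)) :=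
  (LinearMap.mulLeft k (ι k v)).rTensor (T ⊗[k] T) +
    TensorProduct.homTensorHomMap (RingHom.id k) T (T ⊗[k] T) T (T ⊗[k] T)
      (TensorProduct.map (tensorAlgebraYD D).act (comulHom D).toLinearMap
        ((tensorAlgebraYD D).coact (ι k v)))

/-- `(id ⊗ Δ) (Δ(v) t)` is `v ⊗ 1 ⊗ 1 + 1 ⊗ v ⊗ 1 + 1 ⊗ 1 ⊗ v` times `(id ⊗ Δ) t`. -/
theorem lTensor_comulHom_ι (hD : D.IsYD) (v : V) (t : T ⊗[k] T) :
    (tensorAlgebraComul D).lTensor T (comulHom D (ι k v) t) =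
    tripleMul D v ((tensorAlgebraComul D).lTensor T t) := by
  rw [comulHom_ι hD, tripleMul]
  induction t using TensorProduct.induction_on with
  | zero => simp
  | add s t hs ht => simp only [map_add, hs, ht]
  | tmul a b =>
    rw [LinearMap.add_apply, map_add, mulLeft_tmul, mulRight_tmul, LinearMap.add_apply]
    simp only [LinearMap.lTensor_tmul, LinearMap.rTensor_tmul, LinearMap.mulLeft_apply]
    congr 1
    induction (DT).coact (ι k v) using TensorProduct.induction_on with
    | zero => simp
    | add s t hs ht => simp only [map_add, LinearMap.add_apply, hs, ht]
    | tmul h z =>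
      simp only [TensorProduct.map_tmul, LinearMap.lTensor_tmul, LinearMap.flip_apply,
        LinearMap.mul_apply_apply, TensorProduct.homTensorHomMap_apply,
        AlgHom.toLinearMap_apply]
      rw [← comulHom_apply_one (z * b), map_mul, Module.End.mul_apply, comulHom_apply_one]

/-- The operator `tripleMul` in terms of `T(V) ⊗ T(V)` and the last factor. -/
theorem assoc_comulHom_ι_tmul (hD : D.IsYD) (v : V) (s : T ⊗[k] T) (b : T) :
    TensorProduct.assoc k T T T (comulHom D (ι k v) s ⊗ₜ b) +
      TensorProduct.assoc k T T T (TensorProduct.map (((DT).tensor DT).act.flip s)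
        ((LinearMap.mul k T).flip b) ((DT).coact (ι k v))) =
    tripleMul D v (TensorProduct.assoc k T T T (s ⊗ₜ b)) := by
  induction s using TensorProduct.induction_on with
  | zero => simp
  | add s t hs ht =>
    simp only [map_add, TensorProduct.add_tmul, ← hs, ← ht, TensorProduct.map_add_left,
      LinearMap.add_apply]
    abel
  | tmul a a' =>
    rw [comulHom_ι hD, LinearMap.add_apply, mulLeft_tmul, mulRight_tmul, TensorProduct.add_tmul,
      map_add, add_assoc]
    simp only [TensorProduct.assoc_tmul, tripleMul, LinearMap.add_apply, LinearMap.rTensor_tmul,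
      LinearMap.mulLeft_apply]
    congr 1
    let Θ : H ⊗[k] (H ⊗[k] T) →ₗ[k] T ⊗[k] (T ⊗[k] T) :=
      TensorProduct.map ((DT).act.flip a)
        (TensorProduct.map ((DT).act.flip a') ((LinearMap.mul k T).flip b))
    trans TensorProduct.map ((DT).act.flip a) ((TensorProduct.mk k T T).flip b ∘ₗ
        (LinearMap.mul k T).flip a') ((DT).coact (ι k v)) +
      Θ ((DT).coact.lTensor H ((DT).coact (ι k v)))
    · rw [← tensorAlgebra_coassoc hD]
      congr 1
      · induction (DT).coact (ι k v) using TensorProduct.induction_on with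
        | zero => simp
        | add s t hs ht => simp only [map_add, TensorProduct.add_tmul, hs, ht]
        | tmul h z => simp
      · induction (DT).coact (ι k v) using TensorProduct.induction_on with
        | zero => simp
        | add s t hs ht => simp only [map_add, hs, ht]
        | tmul h z =>
          simp only [TensorProduct.map_tmul, LinearMap.flip_apply, YDData.tensor_act_tmul,
            LinearMap.rTensor_tmul]
          induction Coalgebra.comul (R := k) h using TensorProduct.induction_on with
          | zero => simp
          | add s t hs ht => simp only [map_add, TensorProduct.add_tmul, hs, ht]
          | tmul c d => simp [Θ]
    · rw [tensorAlgebra_coact_ι]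
      induction D.coact v using TensorProduct.induction_on with
      | zero => simp
      | add s t hs ht =>
        simp only [map_add, LinearMap.add_apply, ← hs, ← ht]
        abel
      | tmul h z =>
        simp [Θ, comulHom_ι hD, mulLeft_tmul, mulRight_tmul, TensorProduct.tmul_add]

/-- `(Δ ⊗ id) (Δ(v) t)` is `v ⊗ 1 ⊗ 1 + 1 ⊗ v ⊗ 1 + 1 ⊗ 1 ⊗ v` times `(Δ ⊗ id) t`. -/
theorem rTensor_comulHom_ι (hD : D.IsYD) (v : V) (t : T ⊗[k] T) : TensorProduct.assoc k T T T
    ((tensorAlgebraComul D).rTensor T (comulHom D (ι k v) t)) =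
    tripleMul D v (TensorProduct.assoc k T T T ((tensorAlgebraComul D).rTensor T t)) := by
  induction t using TensorProduct.induction_on with
  | zero => simp
  | add s t hs ht => simp only [map_add, hs, ht]
  | tmul a b =>
    rw [LinearMap.rTensor_tmul, ← assoc_comulHom_ι_tmul hD, comulHom_ι hD,
      LinearMap.add_apply, map_add, mulLeft_tmul, mulRight_tmul, map_add, LinearMap.rTensor_tmul,
      ← comulHom_ι hD,
      ← comulHom_apply_one, map_mul, Module.End.mul_apply, comulHom_apply_one]
    congr 2
    induction (DT).coact (ι k v) using TensorProduct.induction_on with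
    | zero => simp
    | add s t hs ht => simp only [map_add, hs, ht]
    | tmul h z => simp [act_tensorAlgebraComul hD]

theorem tensorAlgebraComul_coassoc (hD : D.IsYD) (x : T) :
    TensorProduct.assoc k T T T ((tensorAlgebraComul D).rTensor T (tensorAlgebraComul D x)) =
      (tensorAlgebraComul D).lTensor T (tensorAlgebraComul D x) := by
  induction x using tensorAlgebra_left_induction with
  | one => simp [tensorAlgebraComul_one]
  | add a b ha hb => simp only [map_add, ha, hb]
  | smul c a ha => simp only [map_smul, ha]
  | ι_mul v x hx =>
    rw [← comulHom_apply_one (ι k v * x), map_mul, Module.End.mul_apply, comulHom_apply_one,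
      rTensor_comulHom_ι hD, hx, lTensor_comulHom_ι hD]

theorem tensorAlgebra_counit_act (h : H) (x : T) :
    (TensorAlgebra.algebraMapInv : T →ₐ[k] k) ((DT).act h x) =
      Coalgebra.counit (R := k) h * (TensorAlgebra.algebraMapInv : T →ₐ[k] k) x := by
  induction x using TensorAlgebra.induction generalizing h with
  | algebraMap r => simp [Algebra.algebraMap_eq_smul_one, tensorAlgebra_act_one, mul_comm]
  | ι v => simp [tensorAlgebra_act_ι, TensorAlgebra.algebraMapInv]
  | mul a b ha hb =>
    rw [tensorAlgebra_act_mul, ← (Coalgebra.Repr.arbitrary k h).eq, map_mul]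
    conv_rhs => rw [← Coalgebra.sum_counit_smul (Coalgebra.Repr.arbitrary k h)]
    simp only [map_sum, TensorProduct.map_tmul, LinearMap.flip_apply, LinearMap.mul'_apply,
      map_mul, ha, hb, map_smul, smul_eq_mul, Finset.sum_mul]
    exact Finset.sum_congr rfl fun i _ => by ring
  | add a b ha hb => simp only [map_add, ha, hb, mul_add]

theorem tensorAlgebra_counit_coact_eq (x : T) :
    (TensorAlgebra.algebraMapInv : T →ₐ[k] k).toLinearMap.lTensor H ((DT).coact x) =
      (TensorAlgebra.algebraMapInv : T →ₐ[k] k) x • (1 ⊗ₜ 1) := by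
  have : (Algebra.TensorProduct.map (AlgHom.id k H) (TensorAlgebra.algebraMapInv : T →ₐ[k] k)).comp
      (tensorAlgebraCoactHom D) =
      (Algebra.ofId k (H ⊗[k] k)).comp (TensorAlgebra.algebraMapInv : T →ₐ[k] k) := by
    refine TensorAlgebra.hom_ext (LinearMap.ext fun v => ?_)
    simp only [LinearMap.comp_apply, AlgHom.toLinearMap_apply, AlgHom.comp_apply,
      tensorAlgebraCoactHom_apply, tensorAlgebra_coact_ι]
    trans 0
    · induction D.coact v using TensorProduct.induction_on with
      | zero => simp
      | add s t hs ht => simp only [map_add, hs, ht, add_zero]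
      | tmul h z => simp [TensorAlgebra.algebraMapInv]
    · simp [TensorAlgebra.algebraMapInv]
  have := DFunLike.congr_fun this x
  refine this.trans ?_
  rw [AlgHom.comp_apply, Algebra.ofId_apply, Algebra.algebraMap_eq_smul_one,
    Algebra.TensorProduct.one_def]

theorem tensorAlgebra_counit_comul (hD : D.IsYD) (x : T) : TensorProduct.lid k T
    ((TensorAlgebra.algebraMapInv : T →ₐ[k] k).toLinearMap.rTensor T
      (tensorAlgebraComul D x)) = x := by
  induction x using tensorAlgebra_left_induction with
  | one => simp [tensorAlgebraComul_one]
  | add a b ha hb => simp only [map_add, ha, hb]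
  | smul c a ha => simp only [map_smul, ha]
  | ι_mul v x hx =>
    rw [tensorAlgebraComul_ι_mul hD]
    conv_rhs => rw [← hx]
    induction tensorAlgebraComul D x using TensorProduct.induction_on with
    | zero => simp
    | add s t hs ht =>
      simp only [map_add, mul_add, ← hs, ← ht]
      abel
    | tmul a b =>
      rw [mulLeft_tmul, mulRight_tmul]
      have h1 : TensorProduct.lid k T ((TensorAlgebra.algebraMapInv : T →ₐ[k] k).toLinearMap.rTensor
          T (TensorProduct.map ((DT).act.flip a) ((LinearMap.mul k T).flip b)
            ((DT).coact (ι k v)))) = (TensorAlgebra.algebraMapInv : T →ₐ[k] k) a •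
          ((TensorProduct.lid k T ((Coalgebra.counit (R := k) (A := H)).rTensor T
            ((DT).coact (ι k v)))) * b) := by
        induction (DT).coact (ι k v) using TensorProduct.induction_on with
        | zero => simp
        | add s t hs ht => simp only [map_add, add_mul, smul_add, hs, ht]
        | tmul h z => simp [tensorAlgebra_counit_act, smul_smul, mul_comm]
      rw [map_add, map_add, h1, tensorAlgebra_counit_coact hD]
      simp [TensorAlgebra.algebraMapInv]

theorem tensorAlgebra_comul_counit (hD : D.IsYD) (x : T) : TensorProduct.rid k T
    ((TensorAlgebra.algebraMapInv : T →ₐ[k] k).toLinearMap.lTensor T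
      (tensorAlgebraComul D x)) = x := by
  induction x using tensorAlgebra_left_induction with
  | one => simp [tensorAlgebraComul_one]
  | add a b ha hb => simp only [map_add, ha, hb]
  | smul c a ha => simp only [map_smul, ha]
  | ι_mul v x hx =>
    rw [tensorAlgebraComul_ι_mul hD]
    conv_rhs => rw [← hx]
    induction tensorAlgebraComul D x using TensorProduct.induction_on with
    | zero => simp
    | add s t hs ht =>
      simp only [map_add, mul_add, ← hs, ← ht]
      abel
    | tmul a b =>
      rw [mulLeft_tmul, mulRight_tmul, tensorAlgebra_coact_ι]
      have h1 : TensorProduct.rid k T ((TensorAlgebra.algebraMapInv : T →ₐ[k] k).toLinearMap.lTensor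
          T (TensorProduct.map ((DT).act.flip a) ((LinearMap.mul k T).flip b)
            ((ι k (M := V)).lTensor H (D.coact v)))) = 0 := by
        induction D.coact v using TensorProduct.induction_on with
        | zero => simp
        | add s t hs ht => simp only [map_add, hs, ht, add_zero]
        | tmul h z => simp [TensorAlgebra.algebraMapInv]
      rw [map_add, map_add, h1, add_zero]
      simp

/-- The tensor algebra of a Yetter-Drinfeld module is a braided bialgebra. -/
theorem tensorAlgebraData_isBialgebra (hD : D.IsYD) : (tensorAlgebraData D).IsBialgebra where
  isYD := tensorAlgebra_isYD hD
  mul_assoc := mul_assoc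
  one_mul := one_mul
  mul_one := mul_one
  mul_hom :=
    { map_act := fun h m => by
        induction m using TensorProduct.induction_on with
        | zero => simp
        | add s t hs ht => simp only [map_add, hs, ht]
        | tmul a b =>
          rw [YDData.tensor_act_tmul]
          exact (tensorAlgebra_act_mul D h a b).symm
      map_coact := fun m => by
        induction m using TensorProduct.induction_on with
        | zero => simp
        | add s t hs ht => simp only [map_add, hs, ht]
        | tmul a b =>
          rw [YDData.tensor_coact_tmul]
          refine (tensorAlgebra_coact_mul D a b).trans ?_
          change _ = (TensorProduct.lift (LinearMap.mul k T)).lTensor H _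
          change (DT).coact a * (DT).coact b = (TensorProduct.lift (LinearMap.mul k T)).lTensor H
            ((LinearMap.mul' k H).rTensor _ (TensorProduct.tensorTensorTensorComm k H T H T
              ((DT).coact a ⊗ₜ (DT).coact b)))
          induction (DT).coact a using TensorProduct.induction_on with
          | zero => simp
          | add s t hs ht => simp only [map_add, add_mul, TensorProduct.add_tmul, hs, ht]
          | tmul c a' =>
            induction (DT).coact b using TensorProduct.induction_on with
            | zero => simp
            | add s t hs ht => simp only [map_add, mul_add, TensorProduct.tmul_add, hs, ht]
            | tmul d b' => simp }
  one_hom :=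
    { map_act := fun h c => by
        change (Coalgebra.counit (R := k) h * c) • (1 : T) = (DT).act h (c • 1)
        rw [map_smul, tensorAlgebra_act_one, smul_smul, mul_comm]
      map_coact := fun c => by
        change (DT).coact (c • 1) =
          (LinearMap.toSpanSingleton k T (1 : T)).lTensor H (c • (1 ⊗ₜ 1))
        rw [map_smul, tensorAlgebra_coact_one, map_smul, Algebra.TensorProduct.one_def]
        simp }
  comul_coassoc := tensorAlgebraComul_coassoc hD
  counit_comul := tensorAlgebra_counit_comul hD
  comul_counit := tensorAlgebra_comul_counit hD
  comul_hom := ⟨act_tensorAlgebraComul hD, coact_tensorAlgebraComul hD⟩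
  counit_hom :=
    { map_act := tensorAlgebra_counit_act
      map_coact := fun m => (tensorAlgebra_counit_coact_eq m).symm }
  comul_mul := tensorAlgebraComul_mul hD
  comul_one := tensorAlgebraComul_one
  counit_mul := map_mul (TensorAlgebra.algebraMapInv : T →ₐ[k] k)
  counit_one := map_one (TensorAlgebra.algebraMapInv : T →ₐ[k] k)

end

/-! ### Transfer of the axioms along morphisms -/

section
variable {k : Type u} {H : Type v} [Field k] [Ring H] [HopfAlgebra k H]
variable {M : Type w} [AddCommGroup M] [Module k M]
variable {N : Type w₁} [AddCommGroup N] [Module k N]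
variable {M' : Type w₂} [AddCommGroup M'] [Module k M']
variable {N' : Type w₃} [AddCommGroup N'] [Module k N']

namespace YDData

variable {D : YDData k H M} {E : YDData k H N} {D' : YDData k H M'} {E' : YDData k H N'}

theorem IsHom.id : D.IsHom D LinearMap.id := ⟨fun _ _ => rfl, fun _ => by simp⟩

theorem IsHom.comp {f : M →ₗ[k] N} {g : N →ₗ[k] M'} (hg : E.IsHom D' g) (hf : D.IsHom E f) :
    D.IsHom D' (g ∘ₗ f) where
  map_act h m := by simp [hf.map_act, hg.map_act]
  map_coact m := by simp [hf.map_coact, hg.map_coact, LinearMap.lTensor_comp]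

theorem IsHom.of_comp_injective {p : N →ₗ[k] M'} {f : M →ₗ[k] N} (hp : E.IsHom D' p)
    (hinj : Function.Injective p) (hpf : D.IsHom D' (p ∘ₗ f)) : D.IsHom E f where
  map_act h m := hinj (by rw [hp.map_act]; exact hpf.map_act h m)
  map_coact m := Module.Flat.lTensor_preserves_injective_linearMap (M := H) p hinj (by
    rw [← hp.map_coact, ← LinearMap.lTensor_comp_apply]
    exact hpf.map_coact m)

theorem IsHom.of_comp_surjective {q : M →ₗ[k] N} {f : N →ₗ[k] M'} (hq : D.IsHom E q)
    (hsurj : Function.Surjective q) (hfq : D.IsHom D' (f ∘ₗ q)) : E.IsHom D' f where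
  map_act h m := by
    obtain ⟨m, rfl⟩ := hsurj m
    rw [← hq.map_act]
    exact hfq.map_act h m
  map_coact m := by
    obtain ⟨m, rfl⟩ := hsurj m
    rw [hq.map_coact, ← LinearMap.lTensor_comp_apply]
    exact hfq.map_coact m

theorem IsHom.tensor {f : M →ₗ[k] M'} {g : N →ₗ[k] N'} (hf : D.IsHom D' f) (hg : E.IsHom E' g) :
    (D.tensor E).IsHom (D'.tensor E') (TensorProduct.map f g) where
  map_act h t := by
    induction t using TensorProduct.induction_on with
    | zero => simp
    | add s t hs ht => simp only [map_add, hs, ht]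
    | tmul m n =>
      rw [TensorProduct.map_tmul, tensor_act_tmul, tensor_act_tmul]
      induction Coalgebra.comul (R := k) h using TensorProduct.induction_on with
      | zero => simp
      | add s t hs ht => simp only [map_add, hs, ht]
      | tmul c d => simp [hf.map_act, hg.map_act]
  map_coact t := by
    induction t using TensorProduct.induction_on with
    | zero => simp
    | add s t hs ht => simp only [map_add, hs, ht]
    | tmul m n =>
      rw [TensorProduct.map_tmul, tensor_coact_tmul, tensor_coact_tmul, hf.map_coact,
        hg.map_coact]
      induction D.coact m using TensorProduct.induction_on with
      | zero => simp
      | add s t hs ht => simp only [map_add, TensorProduct.add_tmul, hs, ht]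
      | tmul c m' =>
        induction E.coact n using TensorProduct.induction_on with
        | zero => simp
        | add s t hs ht => simp only [map_add, TensorProduct.tmul_add, hs, ht]
        | tmul d n' => simp

/-- Naturality of the braided product on `M ⊗ M`. -/
theorem map_braidedMul {μ : M →ₗ[k] M →ₗ[k] M} {ν : N →ₗ[k] N →ₗ[k] N} {f : M →ₗ[k] N}
    (hf : D.IsHom E f) (hμ : ∀ x y, f (μ x y) = ν (f x) (f y)) (s t : M ⊗[k] M) :
    TensorProduct.map f f (D.braidedMul μ s t) =
      E.braidedMul ν (TensorProduct.map f f s) (TensorProduct.map f f t) := by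
  induction s using TensorProduct.induction_on with
  | zero => simp
  | add s t hs ht => simp only [map_add, LinearMap.add_apply, hs, ht]
  | tmul x y =>
    induction t using TensorProduct.induction_on with
    | zero => simp
    | add s t hs ht => simp only [map_add, hs, ht]
    | tmul x' y' =>
      rw [TensorProduct.map_tmul, TensorProduct.map_tmul, braidedMul_tmul, braidedMul_tmul,
        hf.map_coact]
      induction D.coact y using TensorProduct.induction_on with
      | zero => simp
      | add s t hs ht => simp only [map_add, hs, ht]
      | tmul c d => simp [hμ, hf.map_act]

section Naturality

variable {f : M →ₗ[k] N} (hf : D.IsHom E f)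
include hf

theorem IsHom.lid_counit_coact (m : M) :
    TensorProduct.lid k N ((Coalgebra.counit (R := k) (A := H)).rTensor N (E.coact (f m))) =
      f (TensorProduct.lid k M ((Coalgebra.counit (R := k) (A := H)).rTensor M (D.coact m))) := by
  rw [hf.map_coact]
  induction D.coact m using TensorProduct.induction_on with
  | zero => simp
  | add s t hs ht => simp only [map_add, hs, ht]
  | tmul c d => simp

theorem IsHom.assoc_comul_coact (m : M) : TensorProduct.assoc k H H N
      ((Coalgebra.comul (R := k) (A := H)).rTensor N (E.coact (f m))) =
    (f.lTensor H).lTensor H (TensorProduct.assoc k H H M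
      ((Coalgebra.comul (R := k) (A := H)).rTensor M (D.coact m))) := by
  rw [hf.map_coact]
  induction D.coact m using TensorProduct.induction_on with
  | zero => simp
  | add s t hs ht => simp only [map_add, hs, ht]
  | tmul h m =>
    simp only [LinearMap.lTensor_tmul, LinearMap.rTensor_tmul]
    induction Coalgebra.comul (R := k) h using TensorProduct.induction_on with
    | zero => simp
    | add s t hs ht => simp only [map_add, TensorProduct.add_tmul, hs, ht]
    | tmul c d => simp

theorem IsHom.lTensor_coact_coact (m : M) : E.coact.lTensor H (E.coact (f m)) =
    (f.lTensor H).lTensor H (D.coact.lTensor H (D.coact m)) := by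
  rw [hf.map_coact]
  induction D.coact m using TensorProduct.induction_on with
  | zero => simp
  | add s t hs ht => simp only [map_add, hs, ht]
  | tmul h m => simp [hf.map_coact]

theorem IsHom.diagAct_coact (h : H) (m : M) :
    diagAct (LinearMap.mul k H) E.act h (E.coact (f m)) =
      f.lTensor H (diagAct (LinearMap.mul k H) D.act h (D.coact m)) := by
  rw [hf.map_coact, diagAct, diagAct, LinearMap.comp_apply, LinearMap.comp_apply]
  induction Coalgebra.comul (R := k) h using TensorProduct.induction_on with
  | zero => simp
  | add s t hs ht => simp only [map_add, LinearMap.add_apply, hs, ht]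
  | tmul a b =>
    induction D.coact m using TensorProduct.induction_on with
    | zero => simp
    | add s t hs ht => simp only [map_add, hs, ht]
    | tmul c d => simp [hf.map_act]

theorem IsHom.coact_act (h : H) (m : M) :
    (LinearMap.mul' k H).rTensor N (TensorProduct.rightComm k H N H
      ((E.coact ∘ₗ E.act.flip (f m)).rTensor H (Coalgebra.comul (R := k) h))) =
    f.lTensor H ((LinearMap.mul' k H).rTensor M (TensorProduct.rightComm k H M H
      ((D.coact ∘ₗ D.act.flip m).rTensor H (Coalgebra.comul (R := k) h)))) := by
  induction Coalgebra.comul (R := k) h using TensorProduct.induction_on with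
  | zero => simp
  | add s t hs ht => simp only [map_add, hs, ht]
  | tmul a b =>
    simp only [LinearMap.rTensor_tmul, LinearMap.comp_apply, LinearMap.flip_apply,
      ← hf.map_act, hf.map_coact]
    induction D.coact (D.act a m) using TensorProduct.induction_on with
    | zero => simp
    | add s t hs ht => simp only [map_add, TensorProduct.add_tmul, hs, ht]
    | tmul c d => simp

theorem IsYD.of_surjective (hD : D.IsYD) (hsurj : Function.Surjective f) : E.IsYD where
  one_act m := by
    obtain ⟨m, rfl⟩ := hsurj m
    rw [← hf.map_act, hD.one_act]
  mul_act g h m := by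
    obtain ⟨m, rfl⟩ := hsurj m
    simp only [← hf.map_act, hD.mul_act]
  counit_coact m := by
    obtain ⟨m, rfl⟩ := hsurj m
    rw [hf.lid_counit_coact, hD.counit_coact]
  coassoc m := by
    obtain ⟨m, rfl⟩ := hsurj m
    rw [hf.assoc_comul_coact, hf.lTensor_coact_coact, hD.coassoc]
  compat h m := by
    obtain ⟨m, rfl⟩ := hsurj m
    rw [hf.diagAct_coact, hf.coact_act, hD.compat]

theorem IsYD.of_injective (hE : E.IsYD) (hinj : Function.Injective f) : D.IsYD := by
  have hinj' := Module.Flat.lTensor_preserves_injective_linearMap (M := H) f hinj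
  have hinj'' := Module.Flat.lTensor_preserves_injective_linearMap (M := H) _ hinj'
  exact
  { one_act := fun m => hinj (by rw [hf.map_act, hE.one_act])
    mul_act := fun g h m => hinj (by simp only [hf.map_act, hE.mul_act])
    counit_coact := fun m => hinj (by rw [← hf.lid_counit_coact, hE.counit_coact])
    coassoc := fun m => hinj'' (by
      rw [← hf.assoc_comul_coact, ← hf.lTensor_coact_coact, hE.coassoc])
    compat := fun h m => hinj' (by rw [← hf.diagAct_coact, ← hf.coact_act, hE.compat]) }

end Naturality

end YDData

namespace BraidedData

variable {D : BraidedData k H M} {E : BraidedData k H N}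

theorem IsBialgebra.of_surjective (hD : D.IsBialgebra) {f : M →ₗ[k] N}
    (hsurj : Function.Surjective f) (hf : D.toYDData.IsHom E.toYDData f)
    (map_mul : ∀ x y, f (D.mul x y) = E.mul (f x) (f y)) (map_one : f D.one = E.one)
    (map_comul : ∀ x, E.comul (f x) = TensorProduct.map f f (D.comul x))
    (map_counit : ∀ x, E.counit (f x) = D.counit x) : E.IsBialgebra where
  isYD := hD.isYD.of_surjective hf hsurj
  mul_assoc x y z := by
    obtain ⟨x, rfl⟩ := hsurj x
    obtain ⟨y, rfl⟩ := hsurj y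
    obtain ⟨z, rfl⟩ := hsurj z
    simp only [← map_mul, hD.mul_assoc]
  one_mul x := by
    obtain ⟨x, rfl⟩ := hsurj x
    rw [← map_one, ← map_mul, hD.one_mul]
  mul_one x := by
    obtain ⟨x, rfl⟩ := hsurj x
    rw [← map_one, ← map_mul, hD.mul_one]
  mul_hom := by
    refine (hf.tensor hf).of_comp_surjective (TensorProduct.map_surjective hsurj hsurj) ?_
    have : TensorProduct.lift E.mul ∘ₗ TensorProduct.map f f = f ∘ₗ TensorProduct.lift D.mul :=
      TensorProduct.ext' fun x y => by simp [map_mul]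
    rw [this]
    exact hf.comp hD.mul_hom
  one_hom := by
    have : LinearMap.toSpanSingleton k N E.one = f ∘ₗ LinearMap.toSpanSingleton k M D.one := by
      ext; simp [map_one]
    rw [this]
    exact hf.comp hD.one_hom
  comul_coassoc x := by
    obtain ⟨x, rfl⟩ := hsurj x
    have hc : E.comul ∘ₗ f = TensorProduct.map f f ∘ₗ D.comul := LinearMap.ext map_comul
    rw [map_comul, LinearMap.rTensor_map, LinearMap.lTensor_map, hc]
    have h1 := congrArg (TensorProduct.map f (TensorProduct.map f f)) (hD.comul_coassoc x)
    rw [LinearMap.map_lTensor] at h1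
    rw [← h1]
    induction D.comul x using TensorProduct.induction_on with
    | zero => simp
    | add s t hs ht => simp only [_root_.map_add, hs, ht]
    | tmul a b =>
      simp only [TensorProduct.map_tmul, LinearMap.rTensor_tmul, LinearMap.comp_apply]
      induction D.comul a using TensorProduct.induction_on with
      | zero => simp
      | add s t hs ht => simp only [_root_.map_add, TensorProduct.add_tmul, hs, ht]
      | tmul c d => simp
  counit_comul x := by
    obtain ⟨x, rfl⟩ := hsurj x
    conv_rhs => rw [← hD.counit_comul x]
    rw [map_comul]
    induction D.comul x using TensorProduct.induction_on with
    | zero => simp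
    | add s t hs ht => simp only [_root_.map_add, hs, ht]
    | tmul a b => simp [map_counit]
  comul_counit x := by
    obtain ⟨x, rfl⟩ := hsurj x
    conv_rhs => rw [← hD.comul_counit x]
    rw [map_comul]
    induction D.comul x using TensorProduct.induction_on with
    | zero => simp
    | add s t hs ht => simp only [_root_.map_add, hs, ht]
    | tmul a b => simp [map_counit]
  comul_hom := by
    refine hf.of_comp_surjective hsurj ?_
    have hc : E.comul ∘ₗ f = TensorProduct.map f f ∘ₗ D.comul := LinearMap.ext map_comul
    rw [hc]
    exact (hf.tensor hf).comp hD.comul_hom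
  counit_hom := by
    refine hf.of_comp_surjective hsurj ?_
    have hc : E.counit ∘ₗ f = D.counit := LinearMap.ext map_counit
    rw [hc]
    exact hD.counit_hom
  comul_mul x y := by
    obtain ⟨x, rfl⟩ := hsurj x
    obtain ⟨y, rfl⟩ := hsurj y
    rw [← map_mul, map_comul, map_comul, map_comul, hD.comul_mul,
      YDData.map_braidedMul hf map_mul]
  comul_one := by rw [← map_one, map_comul, hD.comul_one, TensorProduct.map_tmul]
  counit_mul x y := by
    obtain ⟨x, rfl⟩ := hsurj x
    obtain ⟨y, rfl⟩ := hsurj y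
    rw [← map_mul, map_counit, map_counit, map_counit, hD.counit_mul]
  counit_one := by rw [← map_one, map_counit, hD.counit_one]

/-- A structure on `N` is a braided bialgebra if `N` embeds into a braided bialgebra `M` such that
all structure maps other than the comultiplication are restricted from `M`, and the
comultiplication is `(π ⊗ π) Δ`, where `π` is an endomorphism of `M` which fixes `N`, for which
`(π ⊗ π) Δ` depends only on `π x`, and which is multiplicative as far as needed. -/
theorem IsBialgebra.of_injective (hD : D.IsBialgebra) {p : N →ₗ[k] M} {π : M →ₗ[k] M}
    (hinj : Function.Injective p) (hp : E.toYDData.IsHom D.toYDData p)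
    (hπ : D.toYDData.IsHom D.toYDData π) (hπp : ∀ x, π (p x) = p x)
    (comul_π : ∀ x, TensorProduct.map π π (D.comul (π x)) = TensorProduct.map π π (D.comul x))
    (counit_π : ∀ x, D.counit (π x) = D.counit x)
    (map_mul : ∀ x y, p (E.mul x y) = D.mul (p x) (p y)) (map_one : p E.one = D.one)
    (map_comul : ∀ x, TensorProduct.map p p (E.comul x) = TensorProduct.map π π (D.comul (p x)))
    (map_counit : ∀ x, E.counit x = D.counit (p x))
    (map_π_mul : ∀ x y, TensorProduct.map π π
      (D.toYDData.braidedMul D.mul (D.comul (p x)) (D.comul (p y))) =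
        D.toYDData.braidedMul D.mul (TensorProduct.map π π (D.comul (p x)))
          (TensorProduct.map π π (D.comul (p y)))) : E.IsBialgebra := by
  have hinj₂ : Function.Injective (TensorProduct.map p p) :=
    TensorProduct.map_injective_of_flat_flat p p hinj hinj
  have hinj₃ : Function.Injective (TensorProduct.map p (TensorProduct.map p p)) :=
    TensorProduct.map_injective_of_flat_flat p _ hinj hinj₂
  have hc : TensorProduct.map p p ∘ₗ E.comul = TensorProduct.map π π ∘ₗ D.comul ∘ₗ p :=
    LinearMap.ext map_comul
  have hcπ : TensorProduct.map π π ∘ₗ D.comul ∘ₗ π = TensorProduct.map π π ∘ₗ D.comul :=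
    LinearMap.ext comul_π
  have hε : E.counit = D.counit ∘ₗ p := LinearMap.ext map_counit
  have hεπ : D.counit ∘ₗ π = D.counit := LinearMap.ext counit_π
  exact
  { isYD := hD.isYD.of_injective hp hinj
    mul_assoc := fun x y z => hinj (by simp only [map_mul, hD.mul_assoc])
    one_mul := fun x => hinj (by rw [map_mul, map_one, hD.one_mul])
    mul_one := fun x => hinj (by rw [map_mul, map_one, hD.mul_one])
    mul_hom := by
      refine hp.of_comp_injective hinj ?_
      have : p ∘ₗ TensorProduct.lift E.mul = TensorProduct.lift D.mul ∘ₗ TensorProduct.map p p :=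
        TensorProduct.ext' fun x y => by simp [map_mul]
      rw [this]
      exact hD.mul_hom.comp (hp.tensor hp)
    one_hom := by
      refine hp.of_comp_injective hinj ?_
      have : p ∘ₗ LinearMap.toSpanSingleton k N E.one = LinearMap.toSpanSingleton k M D.one := by
        ext; simp [map_one]
      rw [this]
      exact hD.one_hom
    comul_coassoc := fun x => hinj₃ (by
      have h1 := congrArg (TensorProduct.map π (TensorProduct.map π π)) (hD.comul_coassoc (p x))
      rw [LinearMap.map_lTensor] at h1
      rw [LinearMap.map_lTensor, hc]
      trans TensorProduct.map π (TensorProduct.map π π) (TensorProduct.assoc k M M M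
        (D.comul.rTensor M (D.comul (p x))))
      · trans TensorProduct.assoc k M M M (TensorProduct.map (TensorProduct.map p p ∘ₗ E.comul) p
          (E.comul x))
        · induction E.comul x using TensorProduct.induction_on with
          | zero => simp
          | add s t hs ht => simp only [_root_.map_add, hs, ht]
          | tmul a b =>
            simp only [TensorProduct.map_tmul, LinearMap.rTensor_tmul, LinearMap.comp_apply]
            induction E.comul a using TensorProduct.induction_on with
            | zero => simp
            | add s t hs ht => simp only [_root_.map_add, TensorProduct.add_tmul, hs, ht]
            | tmul c d => simp
        · rw [hc, ← LinearMap.comp_assoc, ← LinearMap.id_comp p, TensorProduct.map_comp,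
            LinearMap.comp_apply, LinearMap.id_comp, map_comul, TensorProduct.map_map,
            LinearMap.comp_assoc, hcπ, LinearMap.id_comp]
          induction D.comul (p x) using TensorProduct.induction_on with
          | zero => simp
          | add s t hs ht => simp only [_root_.map_add, hs, ht]
          | tmul a b =>
            simp only [TensorProduct.map_tmul, LinearMap.rTensor_tmul, LinearMap.comp_apply]
            induction D.comul a using TensorProduct.induction_on with
            | zero => simp
            | add s t hs ht => simp only [_root_.map_add, TensorProduct.add_tmul, hs, ht]
            | tmul c d => simp
      · rw [h1]
        conv_rhs => rw [← LinearMap.comp_assoc, ← LinearMap.id_comp p, TensorProduct.map_comp,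
            LinearMap.comp_apply, LinearMap.id_comp, map_comul, TensorProduct.map_map,
            LinearMap.comp_assoc, hcπ, LinearMap.id_comp])
    counit_comul := fun x => hinj (by
      have h1 := congrArg π (hD.counit_comul (p x))
      rw [hπp] at h1
      rw [← h1]
      trans TensorProduct.lid k M (D.counit.rTensor M (TensorProduct.map p p (E.comul x)))
      · rw [hε]
        induction E.comul x using TensorProduct.induction_on with
        | zero => simp
        | add s t hs ht => simp only [_root_.map_add, hs, ht]
        | tmul a b => simp
      · rw [map_comul]
        induction D.comul (p x) using TensorProduct.induction_on with
        | zero => simp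
        | add s t hs ht => simp only [_root_.map_add, hs, ht]
        | tmul a b => simp [counit_π])
    comul_counit := fun x => hinj (by
      have h1 := congrArg π (hD.comul_counit (p x))
      rw [hπp] at h1
      rw [← h1]
      trans TensorProduct.rid k M (D.counit.lTensor M (TensorProduct.map p p (E.comul x)))
      · rw [hε]
        induction E.comul x using TensorProduct.induction_on with
        | zero => simp
        | add s t hs ht => simp only [_root_.map_add, hs, ht]
        | tmul a b => simp
      · rw [map_comul]
        induction D.comul (p x) using TensorProduct.induction_on with
        | zero => simp
        | add s t hs ht => simp only [_root_.map_add, hs, ht]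
        | tmul a b => simp [counit_π])
    comul_hom := by
      refine (hp.tensor hp).of_comp_injective hinj₂ ?_
      rw [hc]
      exact (hπ.tensor hπ).comp (hD.comul_hom.comp hp)
    counit_hom := by
      rw [hε]
      exact hD.counit_hom.comp hp
    comul_mul := fun x y => hinj₂ (by
      rw [map_comul, map_mul, hD.comul_mul, map_π_mul, YDData.map_braidedMul hp map_mul,
        map_comul, map_comul])
    comul_one := hinj₂ (by
      rw [map_comul, map_one, hD.comul_one, TensorProduct.map_tmul, TensorProduct.map_tmul,
        map_one, ← map_one, hπp])
    counit_mul := fun x y => by simp only [map_counit, map_mul, hD.counit_mul]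
    counit_one := by rw [map_counit, map_one, hD.counit_one] }

end BraidedData
end

/-! ### The weight grading of the tensor algebra -/

section Resolution

variable {k : Type u} [Field k] {M : Type w} [AddCommGroup M] [Module k M]
variable {N : Type w₁} [AddCommGroup N] [Module k N] {J : Type w₂}

/-- A family of endomorphisms whose sum is pointwise finite and is the identity. -/
def IsResolution (π : J → M →ₗ[k] M) : Prop :=
  ∀ x, ∃ s : Finset J, ∀ s', s ⊆ s' → ∑ q ∈ s', π q x = x

variable {π : J → M →ₗ[k] M} (hπ : IsResolution π)
include hπ

theorem IsResolution.mem {W : Submodule k M} {x : M} (h : ∀ q, π q x ∈ W) : x ∈ W := by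
  obtain ⟨s, hs⟩ := hπ x
  rw [← hs s subset_rfl]
  exact sum_mem fun q _ => h q

theorem IsResolution.eq_zero {x : M} (h : ∀ q, π q x = 0) : x = 0 := by
  rw [← Submodule.mem_bot k]
  exact hπ.mem fun q => by rw [h q]; exact zero_mem _

theorem IsResolution.of_surjective {f : M →ₗ[k] N} (hf : Function.Surjective f)
    {ρ : J → N →ₗ[k] N} (hρ : ∀ q x, ρ q (f x) = f (π q x)) : IsResolution ρ := by
  intro y
  obtain ⟨x, rfl⟩ := hf y
  obtain ⟨s, hs⟩ := hπ x
  refine ⟨s, fun s' h => ?_⟩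
  simp only [hρ, ← map_sum, hs s' h]

theorem IsResolution.rTensor : IsResolution fun q => (π q).rTensor N := by
  classical
  intro t
  induction t using TensorProduct.induction_on with
  | zero => exact ⟨∅, by simp⟩
  | tmul x y =>
    obtain ⟨s, hs⟩ := hπ x
    refine ⟨s, fun s' h => ?_⟩
    simp only [LinearMap.rTensor_tmul, ← TensorProduct.sum_tmul, hs s' h]
  | add x y hx hy =>
    obtain ⟨s, hs⟩ := hx
    obtain ⟨s₂, hs₂⟩ := hy
    refine ⟨s ∪ s₂, fun s' h => ?_⟩
    simp only [map_add, Finset.sum_add_distrib]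
    rw [hs s' (Finset.subset_union_left.trans h), hs₂ s' (Finset.subset_union_right.trans h)]

theorem IsResolution.lTensor : IsResolution fun q => (π q).lTensor N :=
  (hπ.rTensor (N := N)).of_surjective (f := (TensorProduct.comm k M N).toLinearMap)
    (TensorProduct.comm k M N).surjective fun q t => by
      induction t using TensorProduct.induction_on with
      | zero => simp
      | tmul x y => simp
      | add x y hx hy => simp only [map_add, hx, hy]

end Resolution

section
variable {k : Type u} {H : Type v} [Field k] [Ring H] [HopfAlgebra k H]
variable {V : Type w} [AddCommGroup V] [Module k V]

local notation "T" => TensorAlgebra k V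

variable {V₁ V₂ : Submodule k V} (hV : IsCompl V₁ V₂) (r : ℚ)

/-- The elements of `U` have weight `d`, where `V₁` has weight `1` and `V₂` has weight `-r`. -/
inductive HasWeight (V₁ V₂ : Submodule k V) (r : ℚ) : Submodule k V → ℚ → Prop
  | left : HasWeight V₁ V₂ r V₁ 1
  | right : HasWeight V₁ V₂ r V₂ (-r)

/-- The algebra map `T(V) → T(V)[ℚ]` which sends a word of weight `q` to the monomial of degree
`q` having this word as coefficient. The weight of a word with `a₁` letters in `V₁` and `a₂` letters
in `V₂` is `a₁ - r a₂`. -/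
def weightHom : T →ₐ[k] AddMonoidAlgebra T ℚ :=
  TensorAlgebra.lift k (LinearMap.ofIsCompl hV
    (AddMonoidAlgebra.lsingle 1 ∘ₗ ι k ∘ₗ V₁.subtype)
    (AddMonoidAlgebra.lsingle (-r) ∘ₗ ι k ∘ₗ V₂.subtype))

/-- The projection of `T(V)` to the component of weight `q`. -/
def weightProj (q : ℚ) : T →ₗ[k] T :=
  Finsupp.lapply q ∘ₗ (AddMonoidAlgebra.coeffLinearEquiv k).toLinearMap ∘ₗ
    (weightHom hV r).toLinearMap

theorem weightProj_apply (q : ℚ) (x : T) : weightProj hV r q x = (weightHom hV r x).coeff q := rfl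

variable {r} {U : Submodule k V} {d : ℚ}

theorem weightHom_ι (hU : HasWeight V₁ V₂ r U d) {v : V} (hv : v ∈ U) :
    weightHom hV r (ι k v) = AddMonoidAlgebra.single d (ι k v) := by
  rw [weightHom, TensorAlgebra.lift_ι_apply]
  cases hU with
  | left => exact LinearMap.ofIsCompl_apply_left hV ⟨v, hv⟩
  | right => exact LinearMap.ofIsCompl_apply_right hV ⟨v, hv⟩

theorem weightProj_ι_mul (hU : HasWeight V₁ V₂ r U d) {v : V} (hv : v ∈ U) (q : ℚ) (x : T) :
    weightProj hV r q (ι k v * x) = ι k v * weightProj hV r (q - d) x := by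
  rw [weightProj_apply, map_mul, weightHom_ι hV hU hv, AddMonoidAlgebra.coeff_single_mul_apply,
    weightProj_apply, sub_eq_neg_add]

theorem weightProj_mul_ι (hU : HasWeight V₁ V₂ r U d) {v : V} (hv : v ∈ U) (q : ℚ) (x : T) :
    weightProj hV r q (x * ι k v) = weightProj hV r (q - d) x * ι k v := by
  rw [weightProj_apply, map_mul, weightHom_ι hV hU hv, AddMonoidAlgebra.coeff_mul_single_apply,
    weightProj_apply, sub_eq_add_neg]

variable (r) in
theorem weightProj_one (q : ℚ) : weightProj hV r q (1 : T) = if q = 0 then 1 else 0 := by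
  rw [weightProj_apply, map_one, AddMonoidAlgebra.one_def, AddMonoidAlgebra.coeff_single,
    Finsupp.single_apply]
  simp only [eq_comm]

variable (r) in
include hV in
/-- To prove a statement for all of `T(V)`, it suffices to pass from `x` to `v x` for `v ∈ V₁` and
for `v ∈ V₂`. -/
theorem weight_induction {P : T → Prop} (one : P 1)
    (add : ∀ x y, P x → P y → P (x + y)) (smul : ∀ (c : k) x, P x → P (c • x))
    (ι_mul : ∀ U d, HasWeight V₁ V₂ r U d → ∀ v ∈ U, ∀ x, P x → P (ι k v * x)) (x : T) : P x := by
  induction x using tensorAlgebra_left_induction with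
  | one => exact one
  | add x y hx hy => exact add x y hx hy
  | smul c x hx => exact smul c x hx
  | ι_mul v x hx =>
    obtain ⟨a, ha, b, hb, rfl⟩ := Submodule.mem_sup.mp
      (show v ∈ V₁ ⊔ V₂ by rw [hV.sup_eq_top]; trivial)
    rw [map_add, add_mul]
    exact add _ _ (ι_mul _ _ .left a ha x hx) (ι_mul _ _ .right b hb x hx)

variable (r)

theorem weightProj_weightProj (a b : ℚ) (x : T) :
    weightProj hV r a (weightProj hV r b x) = if a = b then weightProj hV r b x else 0 := by
  induction x using weight_induction hV r generalizing a b with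
  | one =>
    rw [weightProj_one]
    split_ifs with h1 h2 h2
    · rw [weightProj_one, if_pos (h2.trans h1)]
    · rw [weightProj_one, if_neg fun h => h2 (h.trans h1.symm)]
    · exact map_zero _
    · exact map_zero _
  | add x y hx hy => rw [map_add, map_add, hx, hy]; split_ifs <;> simp
  | smul c x hx => rw [map_smul, map_smul, hx]; split_ifs <;> simp
  | ι_mul U d hU v hv x hx =>
    rw [weightProj_ι_mul hV hU hv, weightProj_ι_mul hV hU hv, hx]
    simp only [sub_left_inj]
    split_ifs <;> simp

/-- The multiplication of `T(V)` adds weights. -/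
theorem weightProj_weightProj_mul (a q : ℚ) (x y : T) :
    weightProj hV r q (weightProj hV r a x * y) =
      weightProj hV r a x * weightProj hV r (q - a) y := by
  induction x using weight_induction hV r generalizing a q with
  | one =>
    rw [weightProj_one]
    split_ifs with h
    · rw [h, one_mul, one_mul, sub_zero]
    · simp
  | add x y hx hy => simp only [map_add, add_mul, hx, hy]
  | smul c x hx => simp only [map_smul, smul_mul_assoc, hx]
  | ι_mul U d hU v hv x hx =>
    rw [weightProj_ι_mul hV hU hv, mul_assoc, weightProj_ι_mul hV hU hv, hx, mul_assoc,
      sub_sub_sub_cancel_right]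

theorem sum_coeff_weightHom (x : T) : (weightHom hV r x).coeff.sum (fun _ y => y) = x := by
  induction x using weight_induction hV r with
  | one => simp [AddMonoidAlgebra.one_def]
  | add x y hx hy =>
    rw [map_add, AddMonoidAlgebra.coeff_add,
      Finsupp.sum_add_index' (fun _ => rfl) (fun _ _ _ => rfl), hx, hy]
  | smul c x hx =>
    rw [map_smul, AddMonoidAlgebra.coeff_smul, Finsupp.sum_smul_index' (fun _ => rfl),
      ← Finsupp.smul_sum, hx]
  | ι_mul U d hU v hv x hx =>
    have key (f : AddMonoidAlgebra T ℚ) :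
        (AddMonoidAlgebra.single d (ι k v) * f).coeff.sum (fun _ y => y) =
          ι k v * f.coeff.sum (fun _ y => y) := by
      induction f using AddMonoidAlgebra.induction_linear with
      | zero => simp
      | add f g hf hg =>
        rw [mul_add, AddMonoidAlgebra.coeff_add, AddMonoidAlgebra.coeff_add,
          Finsupp.sum_add_index' (fun _ => rfl) (fun _ _ _ => rfl),
          Finsupp.sum_add_index' (fun _ => rfl) (fun _ _ _ => rfl), hf, hg, mul_add]
      | single m y =>
        rw [AddMonoidAlgebra.single_mul_single, AddMonoidAlgebra.coeff_single,
          AddMonoidAlgebra.coeff_single, Finsupp.sum_single_index rfl, Finsupp.sum_single_index rfl]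
    rw [map_mul, weightHom_ι hV hU hv, key, hx]

theorem isResolution_weightProj : IsResolution (weightProj hV r) := by
  refine fun x => ⟨(weightHom hV r x).coeff.support, fun s' hs' => ?_⟩
  conv_rhs => rw [← sum_coeff_weightHom hV r x]
  exact (Finsupp.sum_of_support_subset _ hs' (fun _ y => y) fun _ _ => rfl).symm

theorem counit_weightProj (q : ℚ) (x : T) :
    (TensorAlgebra.algebraMapInv : T →ₐ[k] k) (weightProj hV r q x) =
      if q = 0 then (TensorAlgebra.algebraMapInv : T →ₐ[k] k) x else 0 := by
  induction x using weight_induction hV r generalizing q with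
  | one => rw [weightProj_one]; split_ifs <;> simp
  | add x y hx hy => rw [map_add, map_add, hx, hy]; split_ifs <;> simp
  | smul c x hx => rw [map_smul, map_smul, hx]; split_ifs <;> simp
  | ι_mul U d hU v hv x hx =>
    rw [weightProj_ι_mul hV hU hv, map_mul, map_mul]
    simp [TensorAlgebra.algebraMapInv]

/-- The weight grading is compatible with the `ℕ`-grading. -/
theorem proj_weightProj (n : ℕ) (q : ℚ) (x : T) :
    GradedRing.proj (tensorGrading k V) n (weightProj hV r q x) =
      weightProj hV r q (GradedRing.proj (tensorGrading k V) n x) := by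
  induction x using weight_induction hV r generalizing q n with
  | one =>
    have h1 : GradedRing.proj (tensorGrading k V) n (1 : T) = if n = 0 then 1 else 0 := by
      rw [GradedRing.proj_apply]
      split_ifs with h
      · subst h
        exact DirectSum.decompose_of_mem_same _ SetLike.GradedOne.one_mem
      · exact DirectSum.decompose_of_mem_ne _ SetLike.GradedOne.one_mem (Ne.symm h)
    rw [weightProj_one]
    split_ifs with h <;> rw [h1] <;> split_ifs <;> simp [weightProj_one, h]
  | add x y hx hy => simp only [map_add, hx, hy]
  | smul c x hx =>
    have h1 (y : T) : GradedRing.proj (tensorGrading k V) n (c • y) =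
        c • GradedRing.proj (tensorGrading k V) n y := by
      exact map_smul (GradedAlgebra.proj (tensorGrading k V) n) c y
    rw [map_smul, h1, h1, map_smul, hx]
  | ι_mul U d hU v hv x hx =>
    have hmem : ι k v ∈ tensorGrading k V 1 := by
      rw [tensorGrading, pow_one]
      exact LinearMap.mem_range_self _ v
    have h1 (m : ℕ) (y : T) : GradedRing.proj (tensorGrading k V) m (ι k v * y) =
        if 1 ≤ m then ι k v * GradedRing.proj (tensorGrading k V) (m - 1) y else 0 := by
      rw [GradedRing.proj_apply, DirectSum.coe_decompose_mul_of_left_mem _ _ hmem]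
      rfl
    rw [weightProj_ι_mul hV hU hv, h1, h1]
    split_ifs
    · rw [hx, weightProj_ι_mul hV hU hv]
    · rw [map_zero]

variable {D : YDData k H V} (hV₁ : D.IsSub V₁) (hV₂ : D.IsSub V₂)
include hV₁ hV₂

variable {r} in
theorem HasWeight.isSub (hU : HasWeight V₁ V₂ r U d) : D.IsSub U := by
  cases hU <;> assumption

theorem weightProj_isHom (q : ℚ) :
    (tensorAlgebraYD D).IsHom (tensorAlgebraYD D) (weightProj hV r q) where
  map_act h x := by
    induction x using weight_induction hV r generalizing q h with
    | one =>
      rw [tensorAlgebra_act_one, map_smul, weightProj_one]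
      split_ifs
      · rw [tensorAlgebra_act_one]
      · simp
    | add x y hx hy => simp only [map_add, hx, hy]
    | smul c x hx => simp only [map_smul, hx]
    | ι_mul U d hU v hv x hx =>
      rw [weightProj_ι_mul hV hU hv, tensorAlgebra_act_mul, tensorAlgebra_act_mul]
      induction Coalgebra.comul (R := k) h using TensorProduct.induction_on with
      | zero => simp
      | add s t hs ht => simp only [map_add, hs, ht]
      | tmul c d =>
        simp only [TensorProduct.map_tmul, LinearMap.mul'_apply, LinearMap.flip_apply,
          tensorAlgebra_act_ι, ← hx]
        rw [weightProj_ι_mul hV hU ((hU.isSub hV₁ hV₂).act_mem c v hv)]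
  map_coact x := by
    induction x using weight_induction hV r generalizing q with
    | one =>
      rw [tensorAlgebra_coact_one, weightProj_one, Algebra.TensorProduct.one_def,
        LinearMap.lTensor_tmul, weightProj_one]
      split_ifs
      · rw [tensorAlgebra_coact_one, Algebra.TensorProduct.one_def]
      · simp
    | add x y hx hy => simp only [map_add, hx, hy]
    | smul c x hx => simp only [map_smul, hx]
    | ι_mul U d hU v hv x hx =>
      rw [weightProj_ι_mul hV hU hv, tensorAlgebra_coact_mul, tensorAlgebra_coact_mul, hx,
        tensorAlgebra_coact_ι]
      obtain ⟨y, hy⟩ := (hU.isSub hV₁ hV₂).coact_mem v hv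
      rw [← hy]
      clear hy
      induction y using TensorProduct.induction_on with
      | zero => simp
      | add s t hs ht => simp only [map_add, add_mul, hs, ht]
      | tmul c v' =>
        induction (tensorAlgebraYD D).coact x using TensorProduct.induction_on with
        | zero => simp
        | add s t hs ht => simp only [map_add, mul_add, hs, ht]
        | tmul e z => simp [weightProj_ι_mul hV hU v'.2]

/-- The comultiplication of `T(V)` is compatible with the weights. -/
theorem map_weightProj_comul_weightProj (hD : D.IsYD) (a b q : ℚ) (x : T) :
    TensorProduct.map (weightProj hV r a) (weightProj hV r b)
        (tensorAlgebraComul D (weightProj hV r q x)) =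
      if a + b = q then TensorProduct.map (weightProj hV r a) (weightProj hV r b)
        (tensorAlgebraComul D x) else 0 := by
  induction x using weight_induction hV r generalizing a b q with
  | one =>
    rw [weightProj_one]
    split_ifs with h1 h2 h2
    · rfl
    · rw [tensorAlgebraComul_one, TensorProduct.map_tmul, weightProj_one, weightProj_one]
      split_ifs with h3 h4
      · exact absurd (by rw [h1, h3, h4, add_zero]) h2
      · simp
      · simp
      · simp
    · rw [map_zero, map_zero, tensorAlgebraComul_one, TensorProduct.map_tmul, weightProj_one,
        weightProj_one]
      split_ifs with h3 h4
      · exact absurd (by rw [← h2, h3, h4, add_zero]) h1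
      · simp
      · simp
      · simp
    · simp
  | add x y hx hy => simp only [map_add, hx, hy]; split_ifs <;> simp
  | smul c x hx => simp only [map_smul, hx]; split_ifs <;> simp
  | ι_mul U d hU v hv x hx =>
    have hl (a b : ℚ) (t : T ⊗[k] T) : TensorProduct.map (weightProj hV r a) (weightProj hV r b)
        (mulLeft k V (ι k v) t) = mulLeft k V (ι k v)
          (TensorProduct.map (weightProj hV r (a - d)) (weightProj hV r b) t) := by
      induction t using TensorProduct.induction_on with
      | zero => simp
      | add s t hs ht => simp only [map_add, hs, ht]
      | tmul y z => simp [mulLeft_tmul, weightProj_ι_mul hV hU hv]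
    have hr (a b : ℚ) (t : T ⊗[k] T) : TensorProduct.map (weightProj hV r a) (weightProj hV r b)
        (mulRight hD (ι k v) t) = mulRight hD (ι k v)
          (TensorProduct.map (weightProj hV r a) (weightProj hV r (b - d)) t) := by
      induction t using TensorProduct.induction_on with
      | zero => simp
      | add s t hs ht => simp only [map_add, hs, ht]
      | tmul y z =>
        rw [mulRight_tmul, TensorProduct.map_tmul, mulRight_tmul, tensorAlgebra_coact_ι]
        obtain ⟨y, hy⟩ := (hU.isSub hV₁ hV₂).coact_mem v hv
        rw [← hy]
        clear hy
        induction y using TensorProduct.induction_on with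
        | zero => simp
        | add s t hs ht => simp only [map_add, hs, ht]
        | tmul c v' =>
          simp [weightProj_ι_mul hV hU v'.2, (weightProj_isHom hV r hV₁ hV₂ _).map_act]
    rw [weightProj_ι_mul hV hU hv, tensorAlgebraComul_ι_mul hD, tensorAlgebraComul_ι_mul hD,
      map_add, map_add, hl, hr, hl, hr, hx, hx]
    have h1 : (a - d + b = q - d) = (a + b = q) := by
      rw [sub_add_eq_add_sub, sub_left_inj]
    have h2 : (a + (b - d) = q - d) = (a + b = q) := by
      rw [← add_sub_assoc, sub_left_inj]
    simp only [h1, h2]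
    split_ifs <;> simp

end

/-! ### The weight components of the ideal `J(V)` -/

section
variable {k : Type u} {H : Type v} [Field k] [Ring H] [HopfAlgebra k H]
variable {V : Type w} [AddCommGroup V] [Module k V]

local notation "T" => TensorAlgebra k V

variable {V₁ V₂ : Submodule k V} (hV : IsCompl V₁ V₂) (r : ℚ)
variable {D : YDData k H V}

/-- The sum of the weight components of the elements of an ideal `I` of `T(V)`. -/
def weightSpan (I : Ideal T) : Submodule k T :=
  ⨆ q : ℚ, (I.restrictScalars k).map (weightProj hV r q)

theorem weightProj_mem_weightSpan {I : Ideal T} {x : T} (hx : x ∈ I) (q : ℚ) :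
    weightProj hV r q x ∈ weightSpan hV r I :=
  Submodule.mem_iSup_of_mem q (Submodule.mem_map_of_mem hx)

theorem weightSpan_induction {I : Ideal T} {P : T → Prop}
    (proj : ∀ q, ∀ x ∈ I, P (weightProj hV r q x)) (zero : P 0)
    (add : ∀ x y, P x → P y → P (x + y)) {x : T} (hx : x ∈ weightSpan hV r I) : P x := by
  refine Submodule.iSup_induction _ (motive := P) hx ?_ zero add
  rintro q _ ⟨y, hy, rfl⟩
  exact proj q y hy

theorem mul_mem_weightSpan {I : Ideal T} (a : T) {x : T} (hx : x ∈ weightSpan hV r I) :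
    a * x ∈ weightSpan hV r I := by
  induction a using weight_induction hV r with
  | one => rwa [one_mul]
  | add a b ha hb => rw [add_mul]; exact add_mem ha hb
  | smul c a ha => rw [smul_mul_assoc]; exact Submodule.smul_mem _ _ ha
  | ι_mul U d hU v hv a ha =>
    rw [mul_assoc]
    refine weightSpan_induction hV r (P := fun y => ι k v * y ∈ weightSpan hV r I) ?_ ?_ ?_ ha
    · intro q y hy
      have := weightProj_ι_mul hV hU hv (q + d) y
      rw [add_sub_cancel_right] at this
      rw [← this]
      exact weightProj_mem_weightSpan hV r (I.mul_mem_left _ hy) _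
    · simp
    · intro x y hx hy
      rw [mul_add]
      exact add_mem hx hy

theorem weightSpan_mul_mem {I : Ideal T} (hI : I.IsTwoSided) (a : T) {x : T}
    (hx : x ∈ weightSpan hV r I) : x * a ∈ weightSpan hV r I := by
  induction a using TensorAlgebra.induction generalizing x with
  | algebraMap c =>
    rw [Algebra.algebraMap_eq_smul_one, mul_smul_comm, mul_one]
    exact Submodule.smul_mem _ _ hx
  | ι v =>
    have key : ∀ U d, HasWeight V₁ V₂ r U d → ∀ v ∈ U, x * ι k v ∈ weightSpan hV r I := by
      intro U d hU v hv
      refine weightSpan_induction hV r (P := fun y => y * ι k v ∈ weightSpan hV r I) ?_ ?_ ?_ hx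
      · intro q y hy
        have := weightProj_mul_ι hV hU hv (q + d) y
        rw [add_sub_cancel_right] at this
        rw [← this]
        exact weightProj_mem_weightSpan hV r (I.mul_mem_right _ hy) _
      · simp
      · intro x y hx hy
        rw [add_mul]
        exact add_mem hx hy
    obtain ⟨a, ha, b, hb, rfl⟩ := Submodule.mem_sup.mp
      (show v ∈ V₁ ⊔ V₂ by rw [hV.sup_eq_top]; trivial)
    rw [map_add, mul_add]
    exact add_mem (key _ _ .left a ha) (key _ _ .right b hb)
  | mul a b ha hb => rw [← mul_assoc]; exact hb (ha hx)
  | add a b ha hb => rw [mul_add]; exact add_mem (ha hx) (hb hx)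

/-- The sum of the weight components of an ideal, as an ideal. -/
def weightIdeal (I : Ideal T) : Ideal T where
  carrier := weightSpan hV r I
  add_mem' := add_mem
  zero_mem' := zero_mem _
  smul_mem' a _ hx := mul_mem_weightSpan hV r a hx

/-- The weight projection, restricted to an ideal. -/
def weightProjRestrict (I : Ideal T) (q : ℚ) : I.restrictScalars k →ₗ[k] weightSpan hV r I :=
  (weightProj hV r q).restrict fun _ hx => weightProj_mem_weightSpan hV r hx q

theorem subtype_comp_weightProjRestrict (I : Ideal T) (q : ℚ) :
    (weightSpan hV r I).subtype ∘ₗ weightProjRestrict hV r I q =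
      weightProj hV r q ∘ₗ (I.restrictScalars k).subtype := rfl

variable (hV₁ : D.IsSub V₁) (hV₂ : D.IsSub V₂)
include hV₁ hV₂

theorem weightIdeal_isNicholsIdeal (hD : D.IsYD) {I : Ideal T} (hI : IsNicholsIdeal D I) :
    IsNicholsIdeal D (weightIdeal hV r I) where
  isTwoSided := ⟨fun b hx => weightSpan_mul_mem hV r hI.isTwoSided b hx⟩
  isHomogeneous := by
    intro n x hx
    refine weightSpan_induction hV r (P := fun y =>
      GradedRing.proj (tensorGrading k V) n y ∈ weightSpan hV r I) ?_ ?_ ?_ hx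
    · intro q y hy
      rw [proj_weightProj]
      exact weightProj_mem_weightSpan hV r (hI.isHomogeneous n hy) q
    · simp
    · intro x y hx hy
      rw [map_add]
      exact add_mem hx hy
  degree_ge_two := by
    intro x hx n hn
    refine weightSpan_induction hV r (P := fun y =>
      GradedRing.proj (tensorGrading k V) n y = 0) ?_ ?_ ?_ hx
    · intro q y hy
      rw [proj_weightProj, hI.degree_ge_two y hy n hn, map_zero]
    · simp
    · intro x y hx hy
      rw [map_add, hx, hy, add_zero]
  isSub :=
    { act_mem := fun h x hx => by
        refine weightSpan_induction hV r (P := fun y =>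
          (tensorAlgebraYD D).act h y ∈ weightSpan hV r I) ?_ ?_ ?_ hx
        · intro q y hy
          rw [← (weightProj_isHom hV r hV₁ hV₂ q).map_act]
          exact weightProj_mem_weightSpan hV r (hI.isSub.act_mem h y hy) q
        · simp
        · intro x y hx hy
          rw [map_add]
          exact add_mem hx hy
      coact_mem := fun x hx => by
        refine weightSpan_induction hV r (P := fun y => (tensorAlgebraYD D).coact y ∈
          LinearMap.range ((weightSpan hV r I).subtype.lTensor H)) ?_ ?_ ?_ hx
        · intro q y hy
          rw [(weightProj_isHom hV r hV₁ hV₂ q).map_coact]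
          obtain ⟨z, hz⟩ := hI.isSub.coact_mem y hy
          refine ⟨(weightProjRestrict hV r I q).lTensor H z, ?_⟩
          rw [← hz, ← LinearMap.lTensor_comp_apply, subtype_comp_weightProjRestrict,
            LinearMap.lTensor_comp_apply]
        · simp
        · intro x y hx hy
          rw [map_add]
          exact add_mem hx hy }
  coideal := by
    intro x hx
    refine weightSpan_induction hV r (P := fun y => tensorAlgebraComul D y ∈
      coidealSubspace (weightSpan hV r I)) ?_ ?_ ?_ hx
    · intro q y hy
      -- of the components of `Δ(π_q y)`, that of bidegree `(a, b)` vanishes unless `a + b = q`, and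
      -- then it is the component of `Δ(y)`
      refine (isResolution_weightProj hV r).rTensor.mem fun a =>
        (isResolution_weightProj hV r).lTensor.mem fun b => ?_
      rw [← LinearMap.comp_apply, LinearMap.lTensor_comp_rTensor,
        map_weightProj_comul_weightProj hV r hV₁ hV₂ hD]
      split_ifs
      · obtain ⟨_, ⟨s, rfl⟩, _, ⟨t, rfl⟩, hst⟩ := Submodule.mem_sup.mp (hI.coideal y hy)
        rw [← hst, map_add]
        refine add_mem (Submodule.mem_sup_left ?_) (Submodule.mem_sup_right ?_)
        · refine ⟨TensorProduct.map (weightProjRestrict hV r I a) (weightProj hV r b) s, ?_⟩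
          rw [LinearMap.rTensor_map, LinearMap.map_rTensor, subtype_comp_weightProjRestrict]
        · refine ⟨TensorProduct.map (weightProj hV r a) (weightProjRestrict hV r I b) t, ?_⟩
          rw [LinearMap.lTensor_map, LinearMap.map_lTensor, subtype_comp_weightProjRestrict]
      · exact zero_mem _
    · simp
    · intro x y hx hy
      rw [map_add]
      exact add_mem hx hy
  counit_eq_zero := by
    intro x hx
    refine weightSpan_induction hV r (P := fun y =>
      (TensorAlgebra.algebraMapInv : T →ₐ[k] k) y = 0) ?_ ?_ ?_ hx
    · intro q y hy
      rw [counit_weightProj, hI.counit_eq_zero y hy, ite_self]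
    · simp
    · intro x y hx hy
      rw [map_add, hx, hy, add_zero]

/-- The defining ideal of the Nichols algebra is stable under the weight projections: the sum of the
weight components of a Nichols ideal is a Nichols ideal, so it is contained in the largest one. -/
theorem weightProj_mem_nicholsIdeal (hD : D.IsYD) (q : ℚ) :
    ∀ x ∈ nicholsIdeal D, weightProj hV r q x ∈ nicholsIdeal D := by
  refine nicholsIdeal_induction D _ ?_ ?_ ?_
  · intro I hI x hx
    exact le_nicholsIdeal D (weightIdeal_isNicholsIdeal hV r hV₁ hV₂ hD hI)
      (weightProj_mem_weightSpan hV r hx q)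
  · simp
  · intro x y hx hy
    rw [map_add]
    exact add_mem hx hy

end

/-! ### Weight gradings and connected filtrations of braided bialgebras -/

section Graded
variable {k : Type u} {H : Type v} [Field k] [Ring H] [HopfAlgebra k H]
variable {M : Type w} [AddCommGroup M] [Module k M]

/-- A `ℚ`-grading of a braided bialgebra, given by the projections `π q` to its components: all
structure maps are homogeneous of degree zero. -/
structure IsWeightGrading (A : BraidedData k H M) (π : ℚ → M →ₗ[k] M) : Prop where
  isResolution : IsResolution π
  proj_proj : ∀ a b x, π a (π b x) = if a = b then π b x else 0
  isHom : ∀ q, A.toYDData.IsHom A.toYDData (π q)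
  proj_mul : ∀ a q x y, π q (A.mul (π a x) y) = A.mul (π a x) (π (q - a) y)
  proj_one : ∀ q, π q A.one = if q = 0 then A.one else 0
  counit_proj : ∀ q x, A.counit (π q x) = if q = 0 then A.counit x else 0
  map_proj_comul_proj : ∀ a b q x, TensorProduct.map (π a) (π b) (A.comul (π q x)) =
    if a + b = q then TensorProduct.map (π a) (π b) (A.comul x) else 0

/-- The elements all of whose components have weight `≥ 0`. -/
def nonnegPart (π : ℚ → M →ₗ[k] M) : Submodule k M := ⨅ (q : ℚ) (_ : q < 0), LinearMap.ker (π q)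

/-- The elements all of whose components have weight `> 0`. -/
def posPart (π : ℚ → M →ₗ[k] M) : Submodule k M := ⨅ (q : ℚ) (_ : q ≤ 0), LinearMap.ker (π q)

theorem mem_nonnegPart {π : ℚ → M →ₗ[k] M} {x : M} : x ∈ nonnegPart π ↔ ∀ q < 0, π q x = 0 := by
  simp [nonnegPart, Submodule.mem_iInf]

theorem mem_posPart {π : ℚ → M →ₗ[k] M} {x : M} : x ∈ posPart π ↔ ∀ q ≤ 0, π q x = 0 := by
  simp [posPart, Submodule.mem_iInf]

/-- An exhaustive filtration `F` with `F 0 = 0` and `Δ(x) ∈ 1 ⊗ x + A ⊗ F n` for `x ∈ F (n + 1)`;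
such a filtration exists only if `A` is connected. -/
structure IsConnectedFiltration (A : BraidedData k H M) (F : ℕ → Submodule k M) : Prop where
  zero : F 0 = ⊥
  mono : Monotone F
  exhaustive : ∀ x, ∃ n, x ∈ F n
  comul_sub_mem : ∀ n, ∀ x ∈ F (n + 1), A.comul x - A.one ⊗ₜ x ∈
    LinearMap.range ((F n).subtype.lTensor M)

end Graded

/-! ### The Nichols algebra as a braided bialgebra -/

section
variable {k : Type u} {H : Type v} [Field k] [Ring H] [HopfAlgebra k H]
variable {V : Type w} [AddCommGroup V] [Module k V]

local notation "T" => TensorAlgebra k V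

variable {D : YDData k H V}

theorem nicholsProj_surjective : Function.Surjective (nicholsProj D) :=
  Ideal.Quotient.mk_surjective

theorem nicholsProj_isHom :
    (tensorAlgebraYD D).IsHom (nicholsData D).toYDData (nicholsProj D).toLinearMap where
  map_act _ _ := rfl
  map_coact _ := rfl

theorem nicholsData_comul_proj (x : T) : (nicholsData D).comul (nicholsProj D x) =
    TensorProduct.map (nicholsProj D).toLinearMap (nicholsProj D).toLinearMap
      (tensorAlgebraComul D x) := rfl

theorem nicholsData_isBialgebra (hD : D.IsYD) : (nicholsData D).IsBialgebra :=
  (tensorAlgebraData_isBialgebra hD).of_surjective (f := (nicholsProj D).toLinearMap)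
    nicholsProj_surjective nicholsProj_isHom (fun x y => map_mul (nicholsProj D) x y)
    (map_one (nicholsProj D)) (fun _ => rfl) (fun _ => rfl)

/-! ### The connected filtration of the Nichols algebra -/

/-- The elements of degree `< n` of `T(V)`. -/
def lowDegree (k : Type u) (V : Type w) [Field k] [AddCommGroup V] [Module k V] :
    ℕ → Submodule k (TensorAlgebra k V)
  | 0 => ⊥
  | n + 1 => 1 ⊔ LinearMap.range (ι k (M := V)) * lowDegree k V n

theorem one_mem_lowDegree (n : ℕ) : (1 : T) ∈ lowDegree k V (n + 1) :=
  Submodule.mem_sup_left (Submodule.one_le.mp le_rfl)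

theorem ι_mul_mem_lowDegree {n : ℕ} (v : V) {x : T} (hx : x ∈ lowDegree k V n) :
    ι k v * x ∈ lowDegree k V (n + 1) :=
  Submodule.mem_sup_right (Submodule.mul_mem_mul (LinearMap.mem_range_self _ v) hx)

theorem lowDegree_induction {n : ℕ} {P : T → Prop} (one : P 1)
    (add : ∀ x y, P x → P y → P (x + y)) (smul : ∀ (c : k) x, P x → P (c • x))
    (ι_mul : ∀ v, ∀ x ∈ lowDegree k V n, P (ι k v * x)) {x : T}
    (hx : x ∈ lowDegree k V (n + 1)) : P x := by
  obtain ⟨y, hy, z, hz, rfl⟩ := Submodule.mem_sup.mp hx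
  refine add _ _ ?_ ?_
  · obtain ⟨c, rfl⟩ := Submodule.mem_one.mp hy
    rw [Algebra.algebraMap_eq_smul_one]
    exact smul c 1 one
  · refine Submodule.mul_induction_on hz ?_ add
    rintro _ ⟨v, rfl⟩ x hx
    exact ι_mul v x hx

theorem lowDegree_mono : Monotone (lowDegree k V) := by
  refine monotone_nat_of_le_succ fun n => ?_
  induction n with
  | zero => exact bot_le
  | succ n ih => exact sup_le_sup_left (mul_le_mul' le_rfl ih) _

theorem exists_mem_lowDegree (x : T) : ∃ n, x ∈ lowDegree k V n := by
  induction x using tensorAlgebra_left_induction with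
  | one => exact ⟨1, one_mem_lowDegree 0⟩
  | add x y hx hy =>
    obtain ⟨m, hm⟩ := hx
    obtain ⟨n, hn⟩ := hy
    exact ⟨max m n, add_mem (lowDegree_mono (le_max_left m n) hm)
      (lowDegree_mono (le_max_right m n) hn)⟩
  | smul c x hx =>
    obtain ⟨m, hm⟩ := hx
    exact ⟨m, Submodule.smul_mem _ _ hm⟩
  | ι_mul v x hx =>
    obtain ⟨m, hm⟩ := hx
    exact ⟨m + 1, ι_mul_mem_lowDegree v hm⟩

theorem tensorAlgebraComul_sub_mem (hD : D.IsYD) (n : ℕ) {x : T} (hx : x ∈ lowDegree k V (n + 1)) :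
    tensorAlgebraComul D x - 1 ⊗ₜ x ∈ LinearMap.range ((lowDegree k V n).subtype.lTensor T) := by
  induction n generalizing x with
  | zero =>
    refine lowDegree_induction (P := fun x => tensorAlgebraComul D x - 1 ⊗ₜ x ∈
      LinearMap.range ((lowDegree k V 0).subtype.lTensor T)) ?_ ?_ ?_ ?_ hx
    · rw [tensorAlgebraComul_one, sub_self]
      exact zero_mem _
    · intro x y hx hy
      rw [map_add, TensorProduct.tmul_add, add_sub_add_comm]
      exact add_mem hx hy
    · intro c x hx
      have := Submodule.smul_mem _ c hx
      rw [smul_sub, ← TensorProduct.tmul_smul] at this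
      rwa [map_smul]
    · intro v x hx
      rw [(Submodule.mem_bot k).mp hx]
      simp
  | succ n ih =>
    refine lowDegree_induction (P := fun x => tensorAlgebraComul D x - 1 ⊗ₜ x ∈
      LinearMap.range ((lowDegree k V (n + 1)).subtype.lTensor T)) ?_ ?_ ?_ ?_ hx
    · rw [tensorAlgebraComul_one, sub_self]
      exact zero_mem _
    · intro x y hx hy
      rw [map_add, TensorProduct.tmul_add, add_sub_add_comm]
      exact add_mem hx hy
    · intro c x hx
      have := Submodule.smul_mem _ c hx
      rw [smul_sub, ← TensorProduct.tmul_smul] at this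
      rwa [map_smul]
    · intro v x hx
      have h1 : mulRight hD (ι k v) (1 ⊗ₜ x) = 1 ⊗ₜ (ι k v * x) := by
        rw [mulRight_tmul]
        conv_rhs => rw [← tensorAlgebra_counit_coact hD (ι k v)]
        induction (tensorAlgebraYD D).coact (ι k v) using TensorProduct.induction_on with
        | zero => simp
        | add s t hs ht => simp only [map_add, add_mul, TensorProduct.tmul_add, hs, ht]
        | tmul h z => simp [tensorAlgebra_act_one, TensorProduct.smul_tmul]
      have h2 : tensorAlgebraComul D (ι k v * x) - 1 ⊗ₜ (ι k v * x) =
          mulLeft k V (ι k v) (1 ⊗ₜ x) +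
          mulLeft k V (ι k v) (tensorAlgebraComul D x - 1 ⊗ₜ x) +
          mulRight hD (ι k v) (tensorAlgebraComul D x - 1 ⊗ₜ x) := by
        rw [tensorAlgebraComul_ι_mul hD, map_sub, map_sub, h1]
        abel
      rw [h2]
      obtain ⟨s, hs⟩ := ih hx
      rw [← hs]
      refine add_mem (add_mem ?_ ?_) ?_
      · exact ⟨ι k v ⊗ₜ ⟨x, hx⟩, by simp [mulLeft_tmul]⟩
      · clear hs
        induction s using TensorProduct.induction_on with
        | zero => simp
        | add s t hs ht => rw [map_add, map_add]; exact add_mem hs ht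
        | tmul a b => exact ⟨(ι k v * a) ⊗ₜ ⟨b, lowDegree_mono n.le_succ b.2⟩, rfl⟩
      · clear hs
        induction s using TensorProduct.induction_on with
        | zero => simp
        | add s t hs ht => rw [map_add, map_add]; exact add_mem hs ht
        | tmul a b =>
          rw [LinearMap.lTensor_tmul, mulRight_tmul, tensorAlgebra_coact_ι]
          induction D.coact v using TensorProduct.induction_on with
          | zero => simp
          | add s t hs ht => rw [map_add, map_add]; exact add_mem hs ht
          | tmul h z => exact ⟨_ ⊗ₜ ⟨ι k z * b, ι_mul_mem_lowDegree z b.2⟩, rfl⟩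

/-- The elements of degree `< n` of `B(V)`. -/
def nicholsLowDegree (D : YDData k H V) (n : ℕ) : Submodule k (NicholsAlgebra D) :=
  (lowDegree k V n).map (nicholsProj D).toLinearMap

theorem nicholsLowDegree_isConnectedFiltration (hD : D.IsYD) :
    IsConnectedFiltration (nicholsData D) (nicholsLowDegree D) where
  zero := Submodule.map_bot _
  mono _ _ h := Submodule.map_mono (lowDegree_mono h)
  exhaustive x := by
    obtain ⟨x, rfl⟩ := nicholsProj_surjective x
    obtain ⟨n, hn⟩ := exists_mem_lowDegree x
    exact ⟨n, Submodule.mem_map_of_mem hn⟩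
  comul_sub_mem := by
    rintro n _ ⟨x, hx, rfl⟩
    obtain ⟨s, hs⟩ := tensorAlgebraComul_sub_mem hD n hx
    have h1 : (nicholsData D).comul (nicholsProj D x) - (nicholsData D).one ⊗ₜ nicholsProj D x =
        TensorProduct.map (nicholsProj D).toLinearMap (nicholsProj D).toLinearMap
          (tensorAlgebraComul D x - 1 ⊗ₜ x) := by
      rw [map_sub, nicholsData_comul_proj, TensorProduct.map_tmul]
      congr 2
    change (nicholsData D).comul (nicholsProj D x) - (nicholsData D).one ⊗ₜ nicholsProj D x ∈ _
    rw [h1, ← hs]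
    clear hs
    induction s using TensorProduct.induction_on with
    | zero => rw [map_zero, map_zero]; exact zero_mem _
    | add s t hs ht => rw [map_add, map_add]; exact add_mem hs ht
    | tmul a b => exact ⟨nicholsProj D a ⊗ₜ ⟨nicholsProj D b, Submodule.mem_map_of_mem b.2⟩, rfl⟩

/-! ### The weight grading of the Nichols algebra -/

variable {V₁ V₂ : Submodule k V} (hV : IsCompl V₁ V₂) (r : ℚ)
variable (hV₁ : D.IsSub V₁) (hV₂ : D.IsSub V₂) (hD : D.IsYD)

/-- The projection of `B(V)` to the component of weight `q`. -/
def nicholsWeightProj (q : ℚ) : NicholsAlgebra D →ₗ[k] NicholsAlgebra D :=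
  nicholsLift D ((nicholsProj D).toLinearMap ∘ₗ weightProj hV r q) fun x hx =>
    nicholsProj_eq_zero D (weightProj_mem_nicholsIdeal hV r hV₁ hV₂ hD q x hx)

theorem nicholsWeightProj_proj (q : ℚ) (x : T) :
    nicholsWeightProj hV r hV₁ hV₂ hD q (nicholsProj D x) =
      nicholsProj D (weightProj hV r q x) := rfl

theorem nicholsWeightProj_comp (q : ℚ) :
    nicholsWeightProj hV r hV₁ hV₂ hD q ∘ₗ (nicholsProj D).toLinearMap =
      (nicholsProj D).toLinearMap ∘ₗ weightProj hV r q := rfl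

theorem nicholsData_isWeightGrading :
    IsWeightGrading (nicholsData D) (nicholsWeightProj hV r hV₁ hV₂ hD) where
  isResolution := (isResolution_weightProj hV r).of_surjective
    (f := (nicholsProj D).toLinearMap) nicholsProj_surjective fun _ _ => rfl
  proj_proj a b x := by
    obtain ⟨x, rfl⟩ := nicholsProj_surjective x
    simp only [nicholsWeightProj_proj, weightProj_weightProj]
    split_ifs <;> simp
  isHom q := nicholsProj_isHom.of_comp_surjective nicholsProj_surjective
    (nicholsProj_isHom.comp (weightProj_isHom hV r hV₁ hV₂ q))
  proj_mul a q x y := by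
    obtain ⟨x, rfl⟩ := nicholsProj_surjective x
    obtain ⟨y, rfl⟩ := nicholsProj_surjective y
    change nicholsWeightProj hV r hV₁ hV₂ hD q (nicholsProj D (weightProj hV r a x) *
      nicholsProj D y) = nicholsProj D (weightProj hV r a x) * nicholsProj D
        (weightProj hV r (q - a) y)
    rw [← map_mul, ← map_mul, nicholsWeightProj_proj, weightProj_weightProj_mul]
  proj_one q := by
    change nicholsWeightProj hV r hV₁ hV₂ hD q 1 = if q = 0 then 1 else 0
    rw [← map_one (nicholsProj D), nicholsWeightProj_proj, weightProj_one]
    split_ifs <;> simp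
  counit_proj q x := by
    obtain ⟨x, rfl⟩ := nicholsProj_surjective x
    exact counit_weightProj hV r q x
  map_proj_comul_proj a b q x := by
    obtain ⟨x, rfl⟩ := nicholsProj_surjective x
    rw [nicholsWeightProj_proj, nicholsData_comul_proj, nicholsData_comul_proj,
      TensorProduct.map_map, TensorProduct.map_map, nicholsWeightProj_comp, nicholsWeightProj_comp,
      TensorProduct.map_comp, LinearMap.comp_apply, LinearMap.comp_apply,
      map_weightProj_comul_weightProj hV r hV₁ hV₂ hD]
    split_ifs <;> simp

theorem nicholsWeightProj_mem_lowDegree (q : ℚ) (n : ℕ) :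
    ∀ x ∈ nicholsLowDegree D n, nicholsWeightProj hV r hV₁ hV₂ hD q x ∈ nicholsLowDegree D n := by
  rintro _ ⟨x, hx, rfl⟩
  refine ⟨weightProj hV r q x, ?_, rfl⟩
  induction n generalizing x q with
  | zero => rw [(Submodule.mem_bot k).mp hx, map_zero]; exact zero_mem _
  | succ n ih =>
    refine lowDegree_induction (P := fun x => weightProj hV r q x ∈ lowDegree k V (n + 1))
      ?_ ?_ ?_ ?_ hx
    · rw [weightProj_one]
      split_ifs
      · exact one_mem_lowDegree n
      · exact zero_mem _
    · intro x y hx hy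
      rw [map_add]
      exact add_mem hx hy
    · intro c x hx
      rw [map_smul]
      exact Submodule.smul_mem _ _ hx
    · intro v x hx
      obtain ⟨a, ha, b, hb, rfl⟩ := Submodule.mem_sup.mp
        (show v ∈ V₁ ⊔ V₂ by rw [hV.sup_eq_top]; trivial)
      rw [map_add, add_mul, map_add, weightProj_ι_mul hV .left ha, weightProj_ι_mul hV .right hb]
      exact add_mem (ι_mul_mem_lowDegree _ (ih _ _ hx)) (ι_mul_mem_lowDegree _ (ih _ _ hx))

theorem nicholsWeightProj_ι_mul {U : Submodule k V} {d : ℚ} (hU : HasWeight V₁ V₂ r U d) {v : V}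
    (hv : v ∈ U) (q : ℚ) (x : NicholsAlgebra D) :
    nicholsWeightProj hV r hV₁ hV₂ hD q (nicholsProj D (ι k v) * x) =
      nicholsProj D (ι k v) * nicholsWeightProj hV r hV₁ hV₂ hD (q - d) x := by
  obtain ⟨x, rfl⟩ := nicholsProj_surjective x
  rw [← map_mul, nicholsWeightProj_proj, nicholsWeightProj_proj, weightProj_ι_mul hV hU hv,
    map_mul]

theorem nicholsWeightProj_of_mem_component {α : ℕ × ℕ} {x : NicholsAlgebra D}
    (hx : x ∈ nicholsComponent D V₁ V₂ α) (q : ℚ) : nicholsWeightProj hV r hV₁ hV₂ hD q x =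
      if q = α.1 - r * α.2 then x else 0 := by
  induction hx using Submodule.span_induction with
  | zero => simp
  | add x y _ _ hx hy => rw [map_add, hx, hy]; split_ifs <;> simp
  | smul c x _ hx => rw [map_smul, hx]; split_ifs <;> simp
  | mem x hx =>
    obtain ⟨l, h₁, h₂, rfl⟩ := hx
    rw [← h₁, ← h₂]
    clear h₁ h₂
    induction l generalizing q with
    | nil =>
      have : nicholsWeightProj hV r hV₁ hV₂ hD q 1 = if q = 0 then 1 else 0 :=
        (nicholsData_isWeightGrading hV r hV₁ hV₂ hD).proj_one q
      simpa using this
    | cons v l ih =>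
      rw [List.map_cons, List.prod_cons]
      rcases v with v | v
      · rw [Sum.elim_inl, nicholsWeightProj_ι_mul hV r hV₁ hV₂ hD .left v.2, ih]
        have : (q - 1 = (l.countP Sum.isLeft : ℕ) - r * (l.countP Sum.isRight : ℕ)) =
            (q = ((.inl v :: l).countP Sum.isLeft : ℕ) -
              r * ((.inl v :: l).countP Sum.isRight : ℕ)) := by
          simp only [List.countP_cons, Sum.isLeft_inl, Sum.isRight_inl]
          push_cast
          simp only [eq_iff_iff]
          constructor <;> intro h <;> simp at * <;> linarith
        simp only [← this]
        split_ifs <;> simp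
      · rw [Sum.elim_inr, nicholsWeightProj_ι_mul hV r hV₁ hV₂ hD .right v.2, ih]
        have : (q - -r = (l.countP Sum.isLeft : ℕ) - r * (l.countP Sum.isRight : ℕ)) =
            (q = ((.inr v :: l).countP Sum.isLeft : ℕ) -
              r * ((.inr v :: l).countP Sum.isRight : ℕ)) := by
          simp only [List.countP_cons, Sum.isLeft_inr, Sum.isRight_inr]
          push_cast
          simp only [eq_iff_iff]
          constructor <;> intro h <;> simp at * <;> linarith
        simp only [← this]
        split_ifs <;> simp

theorem mul_mem_nicholsComponent (v : V₁ ⊕ V₂) {α β : ℕ × ℕ}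
    (h₁ : β.1 = α.1 + if v.isLeft then 1 else 0) (h₂ : β.2 = α.2 + if v.isRight then 1 else 0)
    {x : NicholsAlgebra D} (hx : x ∈ nicholsComponent D V₁ V₂ α) :
    nicholsProj D (ι k (Sum.elim (fun a : V₁ => (a : V)) (fun b : V₂ => (b : V)) v)) * x ∈
      nicholsComponent D V₁ V₂ β := by
  induction hx using Submodule.span_induction with
  | zero => simp
  | add x y _ _ hx hy => rw [mul_add]; exact add_mem hx hy
  | smul c x _ hx => rw [mul_smul_comm]; exact Submodule.smul_mem _ _ hx
  | mem x hx =>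
    obtain ⟨l, h₁', h₂', rfl⟩ := hx
    exact Submodule.subset_span ⟨v :: l, by rw [List.countP_cons, h₁', h₁],
      by rw [List.countP_cons, h₂', h₂], by rw [List.map_cons, List.prod_cons]⟩

theorem nicholsWeightProj_mem_iSup (q : ℚ) (x : NicholsAlgebra D) :
    nicholsWeightProj hV r hV₁ hV₂ hD q x ∈
      ⨆ (α : ℕ × ℕ) (_ : (α.1 : ℚ) - r * α.2 = q), nicholsComponent D V₁ V₂ α := by
  obtain ⟨x, rfl⟩ := nicholsProj_surjective x
  rw [nicholsWeightProj_proj]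
  induction x using weight_induction hV r generalizing q with
  | one =>
    rw [weightProj_one]
    split_ifs with h
    · refine Submodule.mem_iSup_of_mem (0, 0) (Submodule.mem_iSup_of_mem (by simp [h]) ?_)
      exact Submodule.subset_span ⟨[], by simp, by simp, by simp⟩
    · simp
  | add x y hx hy => rw [map_add, map_add]; exact add_mem (hx q) (hy q)
  | smul c x hx => rw [map_smul, map_smul]; exact Submodule.smul_mem _ _ (hx q)
  | ι_mul U d hU v hv x hx =>
    rw [weightProj_ι_mul hV hU hv, map_mul]
    have hx := hx (q - d)
    simp only [iSup_subtype'] at hx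
    refine Submodule.iSup_induction _ (motive := fun y => nicholsProj D (ι k v) * y ∈
      ⨆ (α : ℕ × ℕ) (_ : (α.1 : ℚ) - r * α.2 = q), nicholsComponent D V₁ V₂ α) hx ?_ ?_ ?_
    · rintro ⟨α, hα⟩ y hy
      cases hU with
      | left =>
        refine Submodule.mem_iSup_of_mem (α.1 + 1, α.2) (Submodule.mem_iSup_of_mem ?_
          (mul_mem_nicholsComponent (.inl ⟨v, hv⟩) (by simp) (by simp) hy))
        push_cast
        linarith
      | right =>
        refine Submodule.mem_iSup_of_mem (α.1, α.2 + 1) (Submodule.mem_iSup_of_mem ?_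
          (mul_mem_nicholsComponent (.inr ⟨v, hv⟩) (by simp) (by simp) hy))
        push_cast
        linarith
    · simp
    · intro x y hx hy
      rw [mul_add]
      exact add_mem hx hy

theorem BGe_eq_nonnegPart :
    BGe D V₁ V₂ r = nonnegPart (nicholsWeightProj hV r hV₁ hV₂ hD) := by
  apply le_antisymm
  · refine iSup₂_le fun α hα x hx => mem_nonnegPart.mpr fun q hq => ?_
    rw [nicholsWeightProj_of_mem_component hV r hV₁ hV₂ hD hx, if_neg]
    rintro rfl
    linarith
  · intro x hx
    refine (nicholsData_isWeightGrading hV r hV₁ hV₂ hD).isResolution.mem fun q => ?_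
    rcases lt_or_ge q 0 with hq | hq
    · rw [mem_nonnegPart.mp hx q hq]
      exact zero_mem _
    · refine (iSup₂_le fun α hα => ?_ : _ ≤ BGe D V₁ V₂ r)
        (nicholsWeightProj_mem_iSup hV r hV₁ hV₂ hD q x)
      exact le_iSup₂_of_le α (by linarith : (α.1 : ℚ) ≥ r * α.2) le_rfl

theorem BGt_eq_posPart :
    BGt D V₁ V₂ r = posPart (nicholsWeightProj hV r hV₁ hV₂ hD) := by
  apply le_antisymm
  · refine iSup₂_le fun α hα x hx => mem_posPart.mpr fun q hq => ?_
    rw [nicholsWeightProj_of_mem_component hV r hV₁ hV₂ hD hx, if_neg]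
    rintro rfl
    linarith
  · intro x hx
    refine (nicholsData_isWeightGrading hV r hV₁ hV₂ hD).isResolution.mem fun q => ?_
    rcases le_or_gt q 0 with hq | hq
    · rw [mem_posPart.mp hx q hq]
      exact zero_mem _
    · refine (iSup₂_le fun α hα => ?_ : _ ≤ BGt D V₁ V₂ r)
        (nicholsWeightProj_mem_iSup hV r hV₁ hV₂ hD q x)
      exact le_iSup₂_of_le α (by linarith : (α.1 : ℚ) > r * α.2) le_rfl

end

/-! ### Subspaces of tensor products -/

section TensorMem
variable {k : Type u} [Field k]
variable {M : Type w} [AddCommGroup M] [Module k M]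
variable {N : Type w₁} [AddCommGroup N] [Module k N]
variable {L : Type w₂} [AddCommGroup L] [Module k L] {J : Type w₃}

/-- If `P` is cut out by a family of linear maps, then so is `P ⊗ N`. -/
theorem mem_range_rTensor_subtype {P : Submodule k M} (Φ : J → M →ₗ[k] L)
    (hΦ : ∀ x, (∀ j, Φ j x = 0) → x ∈ P) {t : M ⊗[k] N} (ht : ∀ j, (Φ j).rTensor N t = 0) :
    t ∈ LinearMap.range (P.subtype.rTensor N) := by
  obtain ⟨c, rfl⟩ := TensorProduct.eq_repr_basis_right (Module.Basis.ofVectorSpace k N) t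
  refine Submodule.sum_mem _ fun i _ => ⟨⟨c i, hΦ _ fun j => ?_⟩ ⊗ₜ _, rfl⟩
  have h := TensorProduct.sum_tmul_basis_right_eq_zero (Module.Basis.ofVectorSpace k N)
    (c.mapRange (Φ j) (map_zero _)) (by
      rw [Finsupp.sum_mapRange_index (by simp), ← ht j]
      simp [Finsupp.sum])
  simpa using DFunLike.congr_fun h i

theorem mem_range_lTensor_subtype {P : Submodule k M} (Φ : J → M →ₗ[k] L)
    (hΦ : ∀ x, (∀ j, Φ j x = 0) → x ∈ P) {t : N ⊗[k] M} (ht : ∀ j, (Φ j).lTensor N t = 0) :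
    t ∈ LinearMap.range (P.subtype.lTensor N) := by
  obtain ⟨c, rfl⟩ := TensorProduct.eq_repr_basis_left (Module.Basis.ofVectorSpace k N) t
  refine Submodule.sum_mem _ fun i _ => ⟨_ ⊗ₜ ⟨c i, hΦ _ fun j => ?_⟩, rfl⟩
  have h := TensorProduct.sum_tmul_basis_left_eq_zero (Module.Basis.ofVectorSpace k N)
    (c.mapRange (Φ j) (map_zero _)) (by
      rw [Finsupp.sum_mapRange_index (by simp), ← ht j]
      simp [Finsupp.sum])
  simpa using DFunLike.congr_fun h i

/-- `(P ⊗ M) ∩ (M ⊗ P) = P ⊗ P`. -/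
theorem mem_range_map_subtype {P : Submodule k M} {t : M ⊗[k] M}
    (h₁ : t ∈ LinearMap.range (P.subtype.rTensor M))
    (h₂ : t ∈ LinearMap.range (P.subtype.lTensor M)) :
    t ∈ LinearMap.range (TensorProduct.map P.subtype P.subtype) := by
  obtain ⟨s, hs⟩ := h₁
  obtain ⟨u, rfl⟩ := h₂
  have h : u ∈ LinearMap.range (P.subtype.rTensor P) := by
    refine mem_range_rTensor_subtype (fun _ : Unit => P.mkQ)
      (fun x hx => (Submodule.Quotient.mk_eq_zero P).mp (hx ())) fun _ => ?_
    apply Module.Flat.lTensor_preserves_injective_linearMap (M := M ⧸ P) P.subtype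
      P.injective_subtype
    rw [map_zero, ← LinearMap.comp_apply, LinearMap.lTensor_comp_rTensor,
      ← LinearMap.rTensor_comp_lTensor, LinearMap.comp_apply, ← hs, ← LinearMap.comp_apply,
      ← LinearMap.rTensor_comp]
    have : P.mkQ ∘ₗ P.subtype = 0 := LinearMap.ext fun z => by simp
    rw [this, LinearMap.rTensor_zero, LinearMap.zero_apply]
  obtain ⟨y, rfl⟩ := h
  exact ⟨y, by rw [← LinearMap.lTensor_comp_rTensor]; rfl⟩

end TensorMem

section
variable {k : Type u} {H : Type v} [Field k] [Ring H] [HopfAlgebra k H]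
variable {M : Type w} [AddCommGroup M] [Module k M]
variable {N : Type w₁} [AddCommGroup N] [Module k N]

theorem YDData.IsSub.of_forall {D : YDData k H M} {E : YDData k H N} {J : Type w₂}
    {P : Submodule k M} (Φ : J → M →ₗ[k] N) (hΦ : ∀ j, D.IsHom E (Φ j))
    (hP : ∀ x, x ∈ P ↔ ∀ j, Φ j x = 0) : D.IsSub P where
  act_mem h m hm := (hP _).mpr fun j => by rw [(hΦ j).map_act, (hP m).mp hm, map_zero]
  coact_mem m hm := mem_range_lTensor_subtype Φ (fun x => (hP x).mpr) fun j => by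
    rw [← (hΦ j).map_coact, (hP m).mp hm, map_zero]

/-! ### The subspaces `K_{≥ r}` and `K_{> r}` -/

/-- The elements `x` with `Δ(x) ∈ B ⊗ A`, where `B` is the part of `A` of nonnegative weight. -/
def kernelGe (A : BraidedData k H M) (π : ℚ → M →ₗ[k] M) : Submodule k M :=
  (LinearMap.range ((nonnegPart π).subtype.rTensor M)).comap A.comul

/-- The elements of `kernelGe A π` of positive weight. -/
def kernelGt (A : BraidedData k H M) (π : ℚ → M →ₗ[k] M) : Submodule k M :=
  kernelGe A π ⊓ posPart π

theorem mem_range_nonnegPart {π : ℚ → M →ₗ[k] M} {t : M ⊗[k] N} :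
    t ∈ LinearMap.range ((nonnegPart π).subtype.rTensor N) ↔
      ∀ q : {q : ℚ // q < 0}, (π q).rTensor N t = 0 := by
  constructor
  · rintro ⟨s, rfl⟩ q
    have : π q ∘ₗ (nonnegPart π).subtype = 0 :=
      LinearMap.ext fun z => mem_nonnegPart.mp z.2 q q.2
    rw [← LinearMap.rTensor_comp_apply, this, LinearMap.rTensor_zero, LinearMap.zero_apply]
  · exact mem_range_rTensor_subtype (fun q : {q : ℚ // q < 0} => π q)
      fun x hx => mem_nonnegPart.mpr fun q hq => hx ⟨q, hq⟩

variable {A : BraidedData k H M} {π : ℚ → M →ₗ[k] M}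

theorem mem_kernelGe {x : M} : x ∈ kernelGe A π ↔
    ∀ q : {q : ℚ // q < 0}, ((π q).rTensor M ∘ₗ A.comul) x = 0 :=
  mem_range_nonnegPart

variable (hA : A.IsBialgebra) (hπ : IsWeightGrading A π)

include hπ in
theorem IsWeightGrading.map_proj_comul {a b q : ℚ} (h : a + b = q) (x : M) :
    TensorProduct.map (π a) (π b) (A.comul (π q x)) =
      TensorProduct.map (π a) (π b) (A.comul x) := by
  rw [hπ.map_proj_comul_proj, if_pos h]

include hπ in
theorem IsWeightGrading.proj_mul_eq_sum (q : ℚ) (x y : M) : ∃ s : Finset ℚ, 0 ∈ s ∧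
    π q (A.mul x y) = ∑ a ∈ s, A.mul (π a x) (π (q - a) y) := by
  classical
  obtain ⟨s, hs⟩ := hπ.isResolution x
  refine ⟨insert 0 s, Finset.mem_insert_self _ _, ?_⟩
  conv_lhs => rw [← hs (insert 0 s) (Finset.subset_insert _ _)]
  simp only [map_sum, LinearMap.sum_apply, hπ.proj_mul]

include hπ in
theorem IsWeightGrading.mul_mem_nonnegPart {x y : M} (hx : x ∈ nonnegPart π)
    (hy : y ∈ nonnegPart π) : A.mul x y ∈ nonnegPart π := by
  refine mem_nonnegPart.mpr fun q hq => ?_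
  obtain ⟨s, -, hs⟩ := hπ.proj_mul_eq_sum q x y
  rw [hs]
  refine Finset.sum_eq_zero fun a _ => ?_
  rcases lt_or_ge a 0 with ha | ha
  · rw [mem_nonnegPart.mp hx a ha, map_zero, LinearMap.zero_apply]
  · rw [mem_nonnegPart.mp hy (q - a) (by linarith), map_zero]

include hπ in
/-- On the part of nonnegative weight, the projection to weight zero is multiplicative. -/
theorem IsWeightGrading.proj_zero_mul {x y : M} (hx : x ∈ nonnegPart π)
    (hy : y ∈ nonnegPart π) : π 0 (A.mul x y) = A.mul (π 0 x) (π 0 y) := by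
  obtain ⟨s, h0, hs⟩ := hπ.proj_mul_eq_sum 0 x y
  rw [hs, Finset.sum_eq_single 0 _ fun h => (h h0).elim, sub_zero]
  intro a _ ha
  rcases lt_or_gt_of_ne ha with ha | ha
  · rw [mem_nonnegPart.mp hx a ha, map_zero, LinearMap.zero_apply]
  · rw [mem_nonnegPart.mp hy (0 - a) (by linarith), map_zero]

include hπ in
theorem IsWeightGrading.nonnegPart_isSub : A.toYDData.IsSub (nonnegPart π) :=
  YDData.IsSub.of_forall (fun q : {q : ℚ // q < 0} => π q) (fun q => hπ.isHom q) fun x => by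
    rw [mem_nonnegPart, Subtype.forall]

include hπ in
theorem IsWeightGrading.braidedMul_mem {s t : M ⊗[k] M}
    (hs : s ∈ LinearMap.range ((nonnegPart π).subtype.rTensor M))
    (ht : t ∈ LinearMap.range ((nonnegPart π).subtype.rTensor M)) :
    A.toYDData.braidedMul A.mul s t ∈ LinearMap.range ((nonnegPart π).subtype.rTensor M) := by
  obtain ⟨s, rfl⟩ := hs
  obtain ⟨t, rfl⟩ := ht
  induction s using TensorProduct.induction_on with
  | zero => simp
  | add s₁ s₂ h₁ h₂ => simp only [map_add, LinearMap.add_apply]; exact add_mem h₁ h₂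
  | tmul a b =>
    induction t using TensorProduct.induction_on with
    | zero => simp
    | add t₁ t₂ h₁ h₂ => simp only [map_add]; exact add_mem h₁ h₂
    | tmul a' b' =>
      rw [LinearMap.rTensor_tmul, LinearMap.rTensor_tmul, YDData.braidedMul_tmul]
      induction A.coact b using TensorProduct.induction_on with
      | zero => simp
      | add s₁ s₂ h₁ h₂ => simp only [map_add]; exact add_mem h₁ h₂
      | tmul h z => exact ⟨⟨_, hπ.mul_mem_nonnegPart a.2
          (hπ.nonnegPart_isSub.act_mem h _ a'.2)⟩ ⊗ₜ _, rfl⟩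

include hπ in
/-- On `B ⊗ A`, for the part `B` of `A` of nonnegative weight, the map `π₀ ⊗ id` is
multiplicative for the braided product. -/
theorem IsWeightGrading.rTensor_braidedMul {s t : M ⊗[k] M}
    (hs : s ∈ LinearMap.range ((nonnegPart π).subtype.rTensor M))
    (ht : t ∈ LinearMap.range ((nonnegPart π).subtype.rTensor M)) :
    (π 0).rTensor M (A.toYDData.braidedMul A.mul s t) =
      A.toYDData.braidedMul A.mul ((π 0).rTensor M s) ((π 0).rTensor M t) := by
  obtain ⟨s, rfl⟩ := hs
  obtain ⟨t, rfl⟩ := ht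
  induction s using TensorProduct.induction_on with
  | zero => simp
  | add s₁ s₂ h₁ h₂ => simp only [map_add, LinearMap.add_apply, h₁, h₂]
  | tmul a b =>
    induction t using TensorProduct.induction_on with
    | zero => simp
    | add t₁ t₂ h₁ h₂ => simp only [map_add, h₁, h₂]
    | tmul a' b' =>
      simp only [LinearMap.rTensor_tmul, YDData.braidedMul_tmul]
      induction A.coact b using TensorProduct.induction_on with
      | zero => simp
      | add s₁ s₂ h₁ h₂ => simp only [map_add, h₁, h₂]
      | tmul h z =>
        simp only [TensorProduct.map_tmul, LinearMap.rTensor_tmul, LinearMap.comp_apply,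
          LinearMap.flip_apply, Submodule.subtype_apply]
        rw [hπ.proj_zero_mul a.2 (hπ.nonnegPart_isSub.act_mem h _ a'.2), (hπ.isHom 0).map_act]

include hA hπ

theorem kernelGe_isSub : A.toYDData.IsSub (kernelGe A π) :=
  YDData.IsSub.of_forall (E := A.toYDData.tensor A.toYDData)
    (fun q : {q : ℚ // q < 0} => (π q).rTensor M ∘ₗ A.comul)
    (fun q => ((hπ.isHom q).tensor .id).comp hA.comul_hom) fun _ => mem_kernelGe

theorem one_mem_kernelGe : A.one ∈ kernelGe A π := mem_kernelGe.mpr fun q => by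
  rw [LinearMap.comp_apply, hA.comul_one, LinearMap.rTensor_tmul, hπ.proj_one,
    if_neg q.2.ne, TensorProduct.zero_tmul]

theorem mul_mem_kernelGe {x y : M} (hx : x ∈ kernelGe A π) (hy : y ∈ kernelGe A π) :
    A.mul x y ∈ kernelGe A π := by
  rw [kernelGe, Submodule.mem_comap, hA.comul_mul]
  exact hπ.braidedMul_mem hx hy

omit hπ in
theorem kernelGe_le_nonnegPart : kernelGe A π ≤ nonnegPart π := fun x hx =>
  mem_nonnegPart.mpr fun q hq => by
    have h := mem_kernelGe.mp hx ⟨q, hq⟩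
    rw [← hA.comul_counit x]
    trans TensorProduct.rid k M (A.counit.lTensor M ((π q).rTensor M (A.comul x)))
    · induction A.comul x using TensorProduct.induction_on with
      | zero => simp
      | add s t hs ht => simp only [map_add, hs, ht]
      | tmul a b => simp
    · rw [LinearMap.comp_apply] at h
      rw [h, map_zero, map_zero]

omit hπ in
/-- `Δ(K_{≥ r}) ⊆ K_{≥ r} ⊗ A`, by coassociativity. -/
theorem comul_mem_range_rTensor {x : M} (hx : x ∈ kernelGe A π) :
    A.comul x ∈ LinearMap.range ((kernelGe A π).subtype.rTensor M) := by
  refine mem_range_rTensor_subtype (fun q : {q : ℚ // q < 0} => (π q).rTensor M ∘ₗ A.comul)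
    (fun _ => mem_kernelGe.mpr) fun q => ?_
  apply (TensorProduct.assoc k M M M).injective
  rw [map_zero]
  trans (π q).rTensor (M ⊗[k] M) (TensorProduct.assoc k M M M
    (A.comul.rTensor M (A.comul x)))
  · rw [LinearMap.rTensor_comp_apply]
    induction A.comul.rTensor M (A.comul x) using TensorProduct.induction_on with
    | zero => simp
    | add s t hs ht => simp only [map_add, hs, ht]
    | tmul a b =>
      induction a using TensorProduct.induction_on with
      | zero => simp
      | add s t hs ht => simp only [map_add, TensorProduct.add_tmul, hs, ht]
      | tmul c d => simp
  · rw [hA.comul_coassoc, ← LinearMap.comp_apply, LinearMap.rTensor_comp_lTensor,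
      ← LinearMap.lTensor_comp_rTensor, LinearMap.comp_apply, ← LinearMap.comp_apply _ A.comul,
      mem_kernelGe.mp hx, map_zero]

omit hA in
theorem proj_mem_kernelGe (a : ℚ) {x : M} (hx : x ∈ kernelGe A π) : π a x ∈ kernelGe A π := by
  refine mem_kernelGe.mpr fun q => (hπ.isResolution.lTensor (N := M)).eq_zero fun b => ?_
  have h : ∀ y, (π b).lTensor M (((π q).rTensor M ∘ₗ A.comul) y) =
      TensorProduct.map (π q) (π b) (A.comul y) := fun y => by
    rw [LinearMap.comp_apply, ← LinearMap.comp_apply, LinearMap.lTensor_comp_rTensor]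
  rw [h, hπ.map_proj_comul_proj, ← h, mem_kernelGe.mp hx, map_zero, ite_self]

omit hπ in
theorem mem_kernelGt {x : M} : x ∈ kernelGt A π ↔ x ∈ kernelGe A π ∧ π 0 x = 0 := by
  refine ⟨fun h => ⟨h.1, mem_posPart.mp h.2 0 le_rfl⟩, fun h => ⟨h.1, mem_posPart.mpr ?_⟩⟩
  intro q hq
  rcases hq.lt_or_eq with hq | rfl
  · exact mem_nonnegPart.mp (kernelGe_le_nonnegPart hA h.1) q hq
  · exact h.2

/-- `(π₀ ⊗ id) Δ(K_{≥ r}) ⊆ A ⊗ K_{≥ r}`: by coassociativity it suffices that `π₀ ⊗ π_q` kills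
`Δ(K_{≥ r})` for `q < 0`, and this holds as all weights of `K_{≥ r}` are nonnegative. -/
theorem rTensor_proj_comul_mem_range_lTensor {x : M} (hx : x ∈ kernelGe A π) :
    (π 0).rTensor M (A.comul x) ∈ LinearMap.range ((kernelGe A π).subtype.lTensor M) := by
  refine mem_range_lTensor_subtype (fun q : {q : ℚ // q < 0} => (π q).rTensor M ∘ₗ A.comul)
    (fun _ => mem_kernelGe.mpr) fun q => ?_
  trans TensorProduct.map (π 0) ((π q).rTensor M) (TensorProduct.assoc k M M M
    (A.comul.rTensor M (A.comul x)))
  · rw [hA.comul_coassoc]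
    induction A.comul x using TensorProduct.induction_on with
    | zero => simp
    | add s t hs ht => simp only [map_add, hs, ht]
    | tmul a b => simp
  · obtain ⟨w, hw⟩ := comul_mem_range_rTensor hA hx
    rw [← hw]
    have h0 : TensorProduct.map (π 0) (π q) ∘ₗ A.comul ∘ₗ (kernelGe A π).subtype = 0 := by
      ext1 y
      rw [LinearMap.comp_apply, LinearMap.comp_apply, ← hπ.map_proj_comul (zero_add (q : ℚ)),
        Submodule.subtype_apply, mem_nonnegPart.mp (kernelGe_le_nonnegPart hA y.2) q q.2]
      simp
    trans TensorProduct.assoc k M M M ((TensorProduct.map (π 0) (π q) ∘ₗ A.comul ∘ₗ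
      (kernelGe A π).subtype).rTensor M w)
    · clear hw
      induction w using TensorProduct.induction_on with
      | zero => simp
      | add s t hs ht => simp only [map_add, hs, ht]
      | tmul a b =>
        simp only [LinearMap.rTensor_tmul, LinearMap.comp_apply]
        induction A.comul ((kernelGe A π).subtype a) using TensorProduct.induction_on with
        | zero => simp
        | add s t hs ht => simp only [map_add, TensorProduct.add_tmul, hs, ht]
        | tmul c d => simp
    · rw [h0]
      simp

/-- The decomposition of `Δ(x)` which defines the comultiplication of `K_{≥ r} / K_{> r}`. -/
theorem exists_comul_eq_add {x : M} (hx : x ∈ kernelGe A π) :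
    ∃ (y : kernelGe A π ⊗[k] kernelGe A π) (z : kernelGt A π ⊗[k] M),
      A.comul x = TensorProduct.map (kernelGe A π).subtype (kernelGe A π).subtype y +
        (kernelGt A π).subtype.rTensor M z ∧
      TensorProduct.map (kernelGe A π).subtype (kernelGe A π).subtype y =
        (π 0).rTensor M (A.comul x) := by
  obtain ⟨w, hw⟩ := comul_mem_range_rTensor hA hx
  let f : kernelGe A π →ₗ[k] kernelGe A π :=
    (π 0).restrict fun _ h => proj_mem_kernelGe hπ 0 h
  have hf : (kernelGe A π).subtype ∘ₗ f = π 0 ∘ₗ (kernelGe A π).subtype := rfl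
  have hu : (kernelGe A π).subtype.rTensor M (f.rTensor M w) = (π 0).rTensor M (A.comul x) := by
    rw [← LinearMap.rTensor_comp_apply, hf, LinearMap.rTensor_comp_apply, hw]
  obtain ⟨y, hy⟩ := mem_range_map_subtype ⟨_, hu⟩
    (rTensor_proj_comul_mem_range_lTensor hA hπ hx)
  let g : kernelGe A π →ₗ[k] kernelGt A π :=
    ((kernelGe A π).subtype - π 0 ∘ₗ (kernelGe A π).subtype).codRestrict _ fun x =>
      (mem_kernelGt hA).mpr ⟨sub_mem x.2 (proj_mem_kernelGe hπ 0 x.2), by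
        simp [map_sub, hπ.proj_proj]⟩
  have hg : (kernelGt A π).subtype ∘ₗ g =
      (kernelGe A π).subtype - π 0 ∘ₗ (kernelGe A π).subtype := rfl
  refine ⟨y, g.rTensor M w, ?_, hy⟩
  rw [← LinearMap.rTensor_comp_apply, hg, LinearMap.rTensor_sub, LinearMap.sub_apply,
    LinearMap.rTensor_comp_apply, hw, hy, add_sub_cancel]

end

/-! ### The induced structure on `K_{≥ r} / K_{> r}` -/

section
variable {k : Type u} {H : Type v} [Field k] [Ring H] [HopfAlgebra k H]
variable {M : Type w} [AddCommGroup M] [Module k M]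
variable {N : Type w₁} [AddCommGroup N] [Module k N]

/-- The structure maps on `N` obtained from those of `A` along linear maps `p : N → M` and
`ρ : M → N`. -/
def BraidedData.transport (A : BraidedData k H M) (p : N →ₗ[k] M) (ρ : M →ₗ[k] N) :
    BraidedData k H N where
  act := (A.act.compl₂ p).compr₂ ρ
  coact := ρ.lTensor H ∘ₗ A.coact ∘ₗ p
  mul := (A.mul.compl₁₂ p p).compr₂ ρ
  one := ρ A.one
  comul := TensorProduct.map ρ ρ ∘ₗ A.comul ∘ₗ p
  counit := A.counit ∘ₗ p

/-- The quotient `K_{≥ r} / K_{> r}`. -/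
abbrev kernelQuotient (A : BraidedData k H M) (π : ℚ → M →ₗ[k] M) : Type w :=
  kernelGe A π ⧸ (kernelGt A π).submoduleOf (kernelGe A π)

/-- The projection `K_{≥ r} → K_{≥ r} / K_{> r}`. -/
abbrev kernelMk (A : BraidedData k H M) (π : ℚ → M →ₗ[k] M) :
    kernelGe A π →ₗ[k] kernelQuotient A π :=
  ((kernelGt A π).submoduleOf (kernelGe A π)).mkQ

/-- The linear map `p` identifies `K_{≥ r} / K_{> r}` with the part of weight zero of `K_{≥ r}`,
and `ρ` is a retraction of `p` which factors through the projection to weight zero. -/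
structure IsSplitting (A : BraidedData k H M) (π : ℚ → M →ₗ[k] M)
    (p : kernelQuotient A π →ₗ[k] M) (ρ : M →ₗ[k] kernelQuotient A π) : Prop where
  p_mk : ∀ x, p (kernelMk A π x) = π 0 x
  ρ_proj : ∀ x, ρ (π 0 x) = ρ x
  ρ_p : ∀ a, ρ (p a) = a

variable {A : BraidedData k H M} {π : ℚ → M →ₗ[k] M}

theorem exists_isSplitting (hA : A.IsBialgebra) (hπ : IsWeightGrading A π) :
    ∃ p ρ, IsSplitting A π p ρ := by
  let p : kernelQuotient A π →ₗ[k] M :=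
    ((kernelGt A π).submoduleOf (kernelGe A π)).liftQ (π 0 ∘ₗ (kernelGe A π).subtype)
      fun x hx => ((mem_kernelGt hA).mp hx).2
  have hp : ∀ x, p (kernelMk A π x) = π 0 x := fun _ => rfl
  have hker : LinearMap.ker p = ⊥ := Submodule.ker_liftQ_eq_bot _ _ _ fun x hx =>
    (mem_kernelGt hA).mpr ⟨x.2, hx⟩
  obtain ⟨ρ, hρ⟩ := p.exists_leftInverse_of_injective hker
  refine ⟨p, ρ ∘ₗ π 0, hp, fun x => ?_, fun a => ?_⟩
  · simp [hπ.proj_proj]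
  · obtain ⟨x, rfl⟩ := Submodule.mkQ_surjective _ a
    have hx : p (kernelMk A π x) = π 0 x := hp x
    have h := LinearMap.congr_fun hρ (kernelMk A π x)
    rw [LinearMap.comp_apply, hx] at h
    rw [LinearMap.comp_apply, hx, hπ.proj_proj, if_pos rfl]
    exact h

variable {p : kernelQuotient A π →ₗ[k] M} {ρ : M →ₗ[k] kernelQuotient A π}

namespace IsSplitting

variable (h : IsSplitting A π p ρ) (hA : A.IsBialgebra) (hπ : IsWeightGrading A π)
include h

theorem mk_eq (x : kernelGe A π) : kernelMk A π x = ρ x := by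
  rw [← h.ρ_p (kernelMk A π x), h.p_mk, h.ρ_proj]

theorem comp_subtype : ρ ∘ₗ (kernelGe A π).subtype = kernelMk A π :=
  LinearMap.ext fun x => (h.mk_eq x).symm

theorem ρ_comp_proj : ρ ∘ₗ π 0 = ρ := LinearMap.ext h.ρ_proj

theorem p_injective : Function.Injective p := Function.LeftInverse.injective h.ρ_p

include hA in
theorem comp_subtype_kernelGt : ρ ∘ₗ (kernelGt A π).subtype = 0 := LinearMap.ext fun x => by
  rw [LinearMap.comp_apply, ← h.ρ_proj, Submodule.subtype_apply, ((mem_kernelGt hA).mp x.2).2,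
    map_zero, LinearMap.zero_apply]

include hA in
theorem map_ρ_comul (x : kernelGe A π) (y : kernelGe A π ⊗[k] kernelGe A π)
    (z : kernelGt A π ⊗[k] M) (hyz : A.comul x =
      TensorProduct.map (kernelGe A π).subtype (kernelGe A π).subtype y +
        (kernelGt A π).subtype.rTensor M z) :
    TensorProduct.map ρ ρ (A.comul x) =
      TensorProduct.map (kernelMk A π) (kernelMk A π) y := by
  rw [hyz, map_add, TensorProduct.map_map, LinearMap.map_rTensor, h.comp_subtype,
    h.comp_subtype_kernelGt hA, TensorProduct.map_zero_left, LinearMap.zero_apply, add_zero]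

include hπ in
theorem transport_comul_mk (x : kernelGe A π) :
    (A.transport p ρ).comul (kernelMk A π x) = TensorProduct.map ρ ρ (A.comul x) := by
  change TensorProduct.map ρ ρ (A.comul (p (kernelMk A π x))) = _
  rw [h.p_mk, ← h.ρ_comp_proj, TensorProduct.map_comp, LinearMap.comp_apply,
    hπ.map_proj_comul (add_zero 0)]
  rfl

include hπ in
theorem transport_act_mk (c : H) (x : kernelGe A π) :
    (A.transport p ρ).act c (kernelMk A π x) = ρ (A.act c x) := by
  change ρ (A.act c (p (kernelMk A π x))) = _
  rw [h.p_mk, ← (hπ.isHom 0).map_act, h.ρ_proj]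

include hπ in
theorem transport_coact_mk (x : kernelGe A π) :
    (A.transport p ρ).coact (kernelMk A π x) = ρ.lTensor H (A.coact x) := by
  change ρ.lTensor H (A.coact (p (kernelMk A π x))) = _
  rw [h.p_mk, (hπ.isHom 0).map_coact, ← LinearMap.lTensor_comp_apply, h.ρ_comp_proj]

include hA hπ in
theorem transport_mul_mk (x y : kernelGe A π) :
    (A.transport p ρ).mul (kernelMk A π x) (kernelMk A π y) = ρ (A.mul x y) := by
  change ρ (A.mul (p (kernelMk A π x)) (p (kernelMk A π y))) = _
  rw [h.p_mk, h.p_mk, ← hπ.proj_zero_mul (kernelGe_le_nonnegPart hA x.2)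
    (kernelGe_le_nonnegPart hA y.2), h.ρ_proj]

include hπ in
theorem transport_counit_mk (x : kernelGe A π) :
    (A.transport p ρ).counit (kernelMk A π x) = A.counit x := by
  change A.counit (p (kernelMk A π x)) = _
  rw [h.p_mk, hπ.counit_proj, if_pos rfl]

include hA hπ in
theorem transport_isInduced :
    A.IsInduced (kernelGe A π) (kernelGt A π) (A.transport p ρ) where
  le := inf_le_left
  act c x := ⟨⟨_, (kernelGe_isSub hA hπ).act_mem c x x.2⟩, rfl,
    (h.transport_act_mk hπ c x).trans
      (h.mk_eq ⟨A.act c x, (kernelGe_isSub hA hπ).act_mem c x x.2⟩).symm⟩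
  coact x := by
    obtain ⟨y, hy⟩ := (kernelGe_isSub hA hπ).coact_mem x x.2
    refine ⟨y, hy, (h.transport_coact_mk hπ x).trans ?_⟩
    rw [← hy, ← LinearMap.lTensor_comp_apply, h.comp_subtype]
  mul x y := ⟨⟨_, mul_mem_kernelGe hA hπ x.2 y.2⟩, rfl,
    (h.transport_mul_mk hA hπ x y).trans
      (h.mk_eq ⟨A.mul x y, mul_mem_kernelGe hA hπ x.2 y.2⟩).symm⟩
  one := ⟨⟨A.one, one_mem_kernelGe hA hπ⟩, rfl,
    (h.mk_eq ⟨A.one, one_mem_kernelGe hA hπ⟩).symm⟩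
  comul x := by
    obtain ⟨y, z, hyz, -⟩ := exists_comul_eq_add hA hπ x.2
    exact ⟨y, z, hyz, (h.transport_comul_mk hπ x).trans (h.map_ρ_comul hA x y z hyz)⟩
  counit x := h.transport_counit_mk hπ x

include hA hπ in
theorem eq_transport {E : BraidedData k H (kernelQuotient A π)}
    (hE : A.IsInduced (kernelGe A π) (kernelGt A π) E) : E = A.transport p ρ := by
  have hs := Submodule.mkQ_surjective ((kernelGt A π).submoduleOf (kernelGe A π))
  have h_act : E.act = (A.transport p ρ).act := by
    refine LinearMap.ext₂ fun c a => ?_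
    obtain ⟨x, rfl⟩ := hs a
    obtain ⟨y, hy, hxy⟩ := hE.act c x
    rw [hxy, h.transport_act_mk hπ, ← hy, h.mk_eq]
  have h_coact : E.coact = (A.transport p ρ).coact := by
    refine LinearMap.ext fun a => ?_
    obtain ⟨x, rfl⟩ := hs a
    obtain ⟨y, hy, hxy⟩ := hE.coact x
    rw [hxy, h.transport_coact_mk hπ, ← hy, ← LinearMap.lTensor_comp_apply, h.comp_subtype]
  have h_mul : E.mul = (A.transport p ρ).mul := by
    refine LinearMap.ext₂ fun a b => ?_
    obtain ⟨x, rfl⟩ := hs a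
    obtain ⟨y, rfl⟩ := hs b
    obtain ⟨z, hz, hxy⟩ := hE.mul x y
    rw [hxy, h.transport_mul_mk hA hπ, ← hz, h.mk_eq]
  have h_one : E.one = (A.transport p ρ).one := by
    obtain ⟨z, hz, hE⟩ := hE.one
    rw [hE, h.mk_eq, hz]
    rfl
  have h_comul : E.comul = (A.transport p ρ).comul := by
    refine LinearMap.ext fun a => ?_
    obtain ⟨x, rfl⟩ := hs a
    obtain ⟨y, z, hyz, hxy⟩ := hE.comul x
    rw [hxy, h.transport_comul_mk hπ, h.map_ρ_comul hA x y z hyz]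
  have h_counit : E.counit = (A.transport p ρ).counit := by
    refine LinearMap.ext fun a => ?_
    obtain ⟨x, rfl⟩ := hs a
    rw [hE.counit, h.transport_counit_mk hπ]
  exact BraidedData.ext h_act h_coact h_mul h_one h_comul h_counit

include hπ in
theorem proj_p (a) : π 0 (p a) = p a := by
  obtain ⟨x, rfl⟩ := Submodule.mkQ_surjective _ a
  rw [h.p_mk, hπ.proj_proj, if_pos rfl]

include hπ in
theorem p_mem (a) : p a ∈ kernelGe A π := by
  obtain ⟨x, rfl⟩ := Submodule.mkQ_surjective _ a
  rw [h.p_mk]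
  exact proj_mem_kernelGe hπ 0 x.2

theorem p_ρ {x : M} (hx : x ∈ kernelGe A π) : p (ρ x) = π 0 x := by
  rw [← h.p_mk ⟨x, hx⟩, h.mk_eq]

include hπ in
/-- As `p a` has weight zero, so has the second factor of `(π₀ ⊗ id) Δ(p a)`. -/
theorem rTensor_proj_comul_p (a) : (π 0).rTensor M (A.comul (p a)) =
    TensorProduct.map (π 0) (π 0) (A.comul (p a)) := by
  have h1 : ∀ (b : ℚ) (t : M ⊗[k] M), (π b).lTensor M ((π 0).rTensor M t) =
      TensorProduct.map (π 0) (π b) t := fun b t => by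
    rw [← LinearMap.comp_apply, LinearMap.lTensor_comp_rTensor]
  rw [← sub_eq_zero, ← h1]
  refine (hπ.isResolution.lTensor (N := M)).eq_zero fun b => ?_
  have h2 : π b ∘ₗ π 0 = if b = 0 then π 0 else 0 := LinearMap.ext fun x => by
    rw [LinearMap.comp_apply, hπ.proj_proj]; split_ifs <;> rfl
  rw [map_sub, ← LinearMap.lTensor_comp_apply, h2]
  split_ifs with hb
  · rw [hb, sub_self]
  · rw [h1, ← h.proj_p hπ, hπ.map_proj_comul_proj, if_neg (by simpa using hb),
      LinearMap.lTensor_zero, LinearMap.zero_apply, sub_zero]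

include hA hπ in
theorem map_p_comul (a) : TensorProduct.map p p ((A.transport p ρ).comul a) =
    TensorProduct.map (π 0) (π 0) (A.comul (p a)) := by
  obtain ⟨y, z, hyz, hy⟩ := exists_comul_eq_add hA hπ (h.p_mem hπ a)
  have hp : p ∘ₗ kernelMk A π = π 0 ∘ₗ (kernelGe A π).subtype := LinearMap.ext h.p_mk
  have hπ0 : π 0 ∘ₗ π 0 = π 0 := LinearMap.ext fun x => by
    rw [LinearMap.comp_apply, hπ.proj_proj, if_pos rfl]
  change TensorProduct.map p p (TensorProduct.map ρ ρ (A.comul (p a))) = _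
  rw [h.map_ρ_comul hA ⟨p a, h.p_mem hπ a⟩ y z hyz, TensorProduct.map_map, hp,
    ← TensorProduct.map_map, hy, LinearMap.map_rTensor, hπ0]

include hA hπ in
theorem p_isHom : (A.transport p ρ).toYDData.IsHom A.toYDData p where
  map_act c a := by
    change p (ρ (A.act c (p a))) = _
    rw [h.p_ρ ((kernelGe_isSub hA hπ).act_mem c _ (h.p_mem hπ a)), (hπ.isHom 0).map_act,
      h.proj_p hπ]
  map_coact a := by
    obtain ⟨y, hy⟩ := (kernelGe_isSub hA hπ).coact_mem _ (h.p_mem hπ a)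
    have hp : p ∘ₗ kernelMk A π = π 0 ∘ₗ (kernelGe A π).subtype := LinearMap.ext h.p_mk
    change _ = p.lTensor H (ρ.lTensor H (A.coact (p a)))
    rw [← hy, ← LinearMap.lTensor_comp_apply, ← LinearMap.lTensor_comp_apply, LinearMap.comp_assoc,
      h.comp_subtype, hp, LinearMap.lTensor_comp_apply, hy, ← (hπ.isHom 0).map_coact, h.proj_p hπ]

include hA hπ in
theorem p_mul (a b) : p ((A.transport p ρ).mul a b) = A.mul (p a) (p b) := by
  change p (ρ (A.mul (p a) (p b))) = _
  have hK := kernelGe_le_nonnegPart (π := π) hA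
  rw [h.p_ρ (mul_mem_kernelGe hA hπ (h.p_mem hπ a) (h.p_mem hπ b)),
    hπ.proj_zero_mul (hK (h.p_mem hπ a)) (hK (h.p_mem hπ b)), h.proj_p hπ, h.proj_p hπ]

include hA hπ in
theorem p_one : p (A.transport p ρ).one = A.one := by
  change p (ρ A.one) = _
  rw [h.p_ρ (one_mem_kernelGe hA hπ), hπ.proj_one, if_pos rfl]

include hA hπ in
theorem transport_isBialgebra : (A.transport p ρ).IsBialgebra := by
  refine hA.of_injective h.p_injective (h.p_isHom hA hπ) (hπ.isHom 0) (h.proj_p hπ)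
    (hπ.map_proj_comul (add_zero 0)) (fun x => ?_) (h.p_mul hA hπ) (h.p_one hA hπ)
    (h.map_p_comul hA hπ) (fun _ => rfl) fun a b => ?_
  · rw [hπ.counit_proj, if_pos rfl]
  · have hp : π 0 ∘ₗ p = p := LinearMap.ext (h.proj_p hπ)
    rw [← LinearMap.lTensor_comp_rTensor, LinearMap.comp_apply,
      hπ.rTensor_braidedMul (h.p_mem hπ a) (h.p_mem hπ b), h.rTensor_proj_comul_p hπ,
      h.rTensor_proj_comul_p hπ, LinearMap.lTensor_comp_rTensor, ← h.map_p_comul hA hπ,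
      ← h.map_p_comul hA hπ, ← YDData.map_braidedMul (h.p_isHom hA hπ) (h.p_mul hA hπ),
      LinearMap.lTensor_map, hp]

/-- A connected filtration of `A` that is compatible with the weights induces one on
`K_{≥ r} / K_{> r}`. -/
theorem transport_isConnectedFiltration (hA : A.IsBialgebra) (hπ : IsWeightGrading A π)
    {F : ℕ → Submodule k M} (hF : IsConnectedFiltration A F)
    (hFπ : ∀ n, ∀ x ∈ F n, π 0 x ∈ F n) :
    IsConnectedFiltration (A.transport p ρ) fun n => (F n).comap p where
  zero := by
    simp only [hF.zero]
    exact LinearMap.ker_eq_bot.mpr h.p_injective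
  mono _ _ hmn := Submodule.comap_mono (hF.mono hmn)
  exhaustive a := hF.exhaustive (p a)
  comul_sub_mem n a ha := by
    refine mem_range_lTensor_subtype (fun _ : Unit => (F n).mkQ ∘ₗ p)
      (fun x hx => (Submodule.Quotient.mk_eq_zero (F n)).mp (hx ())) fun _ => ?_
    apply Module.Flat.rTensor_preserves_injective_linearMap (M := M ⧸ F n) p h.p_injective
    have hp : TensorProduct.map p p ((A.transport p ρ).comul a - (A.transport p ρ).one ⊗ₜ a) =
        TensorProduct.map (π 0) (π 0) (A.comul (p a) - A.one ⊗ₜ p a) := by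
      rw [map_sub, map_sub, h.map_p_comul hA hπ, TensorProduct.map_tmul, TensorProduct.map_tmul,
        h.p_one hA hπ, h.proj_p hπ, hπ.proj_one, if_pos rfl]
    have h0 : ((F n).mkQ ∘ₗ π 0) ∘ₗ (F n).subtype = 0 := LinearMap.ext fun x =>
      (Submodule.Quotient.mk_eq_zero _).mpr (hFπ n x x.2)
    obtain ⟨s, hs⟩ := hF.comul_sub_mem n (p a) ha
    rw [map_zero, ← LinearMap.comp_apply, LinearMap.rTensor_comp_lTensor,
      ← LinearMap.lTensor_comp_map, LinearMap.comp_apply, hp, LinearMap.lTensor_map, ← hs,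
      LinearMap.map_lTensor, h0, TensorProduct.map_zero_right, LinearMap.zero_apply]

end IsSplitting

end

/-! ### The antipode of a connected braided bialgebra -/

section
variable {k : Type u} [Field k]
variable {M : Type w} [AddCommGroup M] [Module k M]
variable {N : Type w₁} [AddCommGroup N] [Module k N]
variable {L : Type w₂} [AddCommGroup L] [Module k L]

/-- `f` is the pointwise limit, for the discrete topology, of the sequence `P`. -/
def IsEventually (P : ℕ → M →ₗ[k] N) (f : M →ₗ[k] N) : Prop :=
  ∀ x, ∃ n, ∀ m ≥ n, P m x = f x

theorem exists_isEventually {P : ℕ → M →ₗ[k] N} (h : ∀ x, ∃ n, ∀ m ≥ n, P m x = P n x) :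
    ∃ f, IsEventually P f := by
  choose n hn using h
  let f : M →ₗ[k] N :=
    { toFun := fun x => P (n x) x
      map_add' := fun x y => by
        let m := max (n x) (max (n y) (n (x + y)))
        have h₁ : n x ≤ m := le_max_left _ _
        have h₂ : n y ≤ m := (le_max_left _ _).trans (le_max_right _ _)
        have h₃ : n (x + y) ≤ m := (le_max_right _ _).trans (le_max_right _ _)
        rw [← hn _ m h₁, ← hn _ m h₂, ← hn _ m h₃, map_add]
      map_smul' := fun c x => by
        rw [← hn _ _ (le_max_left (n (c • x)) (n x)), ← hn x _ (le_max_right (n (c • x)) (n x)),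
          map_smul, RingHom.id_apply] }
  exact ⟨f, fun x => ⟨n x, hn x⟩⟩

theorem IsEventually.lTensor {P : ℕ → M →ₗ[k] N} {f : M →ₗ[k] N} (h : IsEventually P f) :
    IsEventually (fun n => (P n).lTensor L) (f.lTensor L) := by
  intro t
  induction t using TensorProduct.induction_on with
  | zero => exact ⟨0, by simp⟩
  | tmul x y =>
    obtain ⟨n, hn⟩ := h y
    exact ⟨n, fun m hm => by simp [hn m hm]⟩
  | add s t hs ht =>
    obtain ⟨n₁, h₁⟩ := hs
    obtain ⟨n₂, h₂⟩ := ht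
    exact ⟨max n₁ n₂, fun m hm => by
      rw [map_add, map_add, h₁ m (le_of_max_le_left hm), h₂ m (le_of_max_le_right hm)]⟩

end

section
variable {k : Type u} {H : Type v} [Field k] [Ring H] [HopfAlgebra k H]
variable {M : Type w} [AddCommGroup M] [Module k M]
variable {N : Type w₁} [AddCommGroup N] [Module k N]

namespace YDData

variable {D : YDData k H M} {E : YDData k H N}

theorem IsHom.zero : D.IsHom E 0 := ⟨fun _ _ => by simp, fun _ => by simp⟩

theorem IsHom.add {f g : M →ₗ[k] N} (hf : D.IsHom E f) (hg : D.IsHom E g) : D.IsHom E (f + g) :=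
  ⟨fun _ _ => by simp [hf.map_act, hg.map_act],
    fun _ => by simp [hf.map_coact, hg.map_coact, LinearMap.lTensor_add]⟩

theorem IsHom.sub {f g : M →ₗ[k] N} (hf : D.IsHom E f) (hg : D.IsHom E g) : D.IsHom E (f - g) :=
  ⟨fun _ _ => by simp [hf.map_act, hg.map_act],
    fun _ => by simp [hf.map_coact, hg.map_coact, LinearMap.lTensor_sub]⟩

theorem IsHom.of_isEventually {P : ℕ → M →ₗ[k] N} {f : M →ₗ[k] N} (hP : ∀ n, D.IsHom E (P n))
    (h : IsEventually P f) : D.IsHom E f where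
  map_act c x := by
    obtain ⟨n₁, h₁⟩ := h (D.act c x)
    obtain ⟨n₂, h₂⟩ := h x
    rw [← h₁ _ (le_max_left n₁ n₂), ← h₂ _ (le_max_right n₁ n₂), (hP _).map_act]
  map_coact x := by
    obtain ⟨n₁, h₁⟩ := h.lTensor (L := H) (D.coact x)
    obtain ⟨n₂, h₂⟩ := h x
    rw [← h₁ _ (le_max_left n₁ n₂), ← h₂ _ (le_max_right n₁ n₂), (hP _).map_coact]

end YDData

namespace BraidedData

/-- The convolution product of two endomorphisms of a braided bialgebra. -/
def conv (A : BraidedData k H M) (f g : M →ₗ[k] M) : M →ₗ[k] M :=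
  TensorProduct.lift A.mul ∘ₗ TensorProduct.map f g ∘ₗ A.comul

/-- The unit `η ε` for the convolution product. -/
def convOne (A : BraidedData k H M) : M →ₗ[k] M :=
  LinearMap.toSpanSingleton k M A.one ∘ₗ A.counit

variable {A : BraidedData k H M}

theorem conv_apply (f g : M →ₗ[k] M) (x : M) :
    A.conv f g x = TensorProduct.lift A.mul (TensorProduct.map f g (A.comul x)) := rfl

theorem convOne_apply (x : M) : A.convOne x = A.counit x • A.one := rfl

theorem sub_conv (f f' g : M →ₗ[k] M) : A.conv (f - f') g = A.conv f g - A.conv f' g := by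
  ext x
  have h : TensorProduct.map (f - f') g = TensorProduct.map f g - TensorProduct.map f' g :=
    TensorProduct.ext' fun a b => by simp [TensorProduct.sub_tmul]
  simp [conv_apply, h]

theorem conv_sub (f g g' : M →ₗ[k] M) : A.conv f (g - g') = A.conv f g - A.conv f g' := by
  ext x
  have h : TensorProduct.map f (g - g') = TensorProduct.map f g - TensorProduct.map f g' :=
    TensorProduct.ext' fun a b => by simp [TensorProduct.tmul_sub]
  simp [conv_apply, h]

section
variable (hA : A.IsBialgebra)
include hA

theorem IsBialgebra.convOne_conv (f : M →ₗ[k] M) : A.conv A.convOne f = f := by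
  ext x
  conv_rhs => rw [← hA.counit_comul x]
  rw [conv_apply]
  induction A.comul x using TensorProduct.induction_on with
  | zero => simp
  | add s t hs ht => simp only [map_add, hs, ht]
  | tmul a b => simp [convOne_apply, hA.one_mul]

theorem IsBialgebra.conv_convOne (f : M →ₗ[k] M) : A.conv f A.convOne = f := by
  ext x
  conv_rhs => rw [← hA.comul_counit x]
  rw [conv_apply]
  induction A.comul x using TensorProduct.induction_on with
  | zero => simp
  | add s t hs ht => simp only [map_add, hs, ht]
  | tmul a b => simp [convOne_apply, hA.mul_one]

theorem IsBialgebra.conv_assoc (f g h : M →ₗ[k] M) :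
    A.conv (A.conv f g) h = A.conv f (A.conv g h) := by
  ext x
  let μ : M ⊗[k] (M ⊗[k] M) →ₗ[k] M := TensorProduct.lift A.mul ∘ₗ
    TensorProduct.map f (TensorProduct.lift A.mul ∘ₗ TensorProduct.map g h)
  trans μ (TensorProduct.assoc k M M M (A.comul.rTensor M (A.comul x)))
  · rw [conv_apply]
    induction A.comul x using TensorProduct.induction_on with
    | zero => simp
    | add s t hs ht => simp only [map_add, hs, ht]
    | tmul a b =>
      rw [TensorProduct.map_tmul, conv_apply, LinearMap.rTensor_tmul]
      induction A.comul a using TensorProduct.induction_on with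
      | zero => simp
      | add s t hs ht => simp only [map_add, TensorProduct.add_tmul, hs, ht]
      | tmul c d => simp [μ, hA.mul_assoc]
  · rw [hA.comul_coassoc, conv_apply]
    induction A.comul x using TensorProduct.induction_on with
    | zero => simp
    | add s t hs ht => simp only [map_add, hs, ht]
    | tmul a b => simp [μ, conv_apply]

theorem IsBialgebra.conv_isHom {f g : M →ₗ[k] M} (hf : A.toYDData.IsHom A.toYDData f)
    (hg : A.toYDData.IsHom A.toYDData g) : A.toYDData.IsHom A.toYDData (A.conv f g) :=
  hA.mul_hom.comp ((hf.tensor hg).comp hA.comul_hom)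

theorem IsBialgebra.convOne_isHom : A.toYDData.IsHom A.toYDData A.convOne :=
  hA.one_hom.comp hA.counit_hom

theorem IsBialgebra.conv_one (f g : M →ₗ[k] M) :
    A.conv f g A.one = A.mul (f A.one) (g A.one) := by
  rw [conv_apply, hA.comul_one, TensorProduct.map_tmul, TensorProduct.lift.tmul]

theorem IsBialgebra.convOne_one : A.convOne A.one = A.one := by
  rw [convOne_apply, hA.counit_one, one_smul]

/-- In a connected braided bialgebra, an endomorphism `g` with `g 1 = 1` has a right convolution
inverse. It is the fixed point of `R ↦ η ε + (η ε - g) * R`; the iteration from `R = 0` becomes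
stationary on each step of the filtration since `η ε - g` vanishes at `1`. -/
theorem IsBialgebra.exists_conv_eq {F : ℕ → Submodule k M} (hF : IsConnectedFiltration A F)
    {g : M →ₗ[k] M} (hg : A.toYDData.IsHom A.toYDData g) (hg1 : g A.one = A.one) :
    ∃ R, A.toYDData.IsHom A.toYDData R ∧ R A.one = A.one ∧ A.conv g R = A.convOne := by
  let f := A.convOne - g
  have hf1 : f A.one = 0 := by simp [f, hA.convOne_one, hg1]
  let P : ℕ → M →ₗ[k] M := fun n => (fun R => A.convOne + A.conv f R)^[n] 0
  have hP : ∀ n, P (n + 1) = A.convOne + A.conv f (P n) := fun n =>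
    Function.iterate_succ_apply' _ _ _
  have hP_hom : ∀ n, A.toYDData.IsHom A.toYDData (P n) := by
    intro n
    induction n with
    | zero => exact .zero
    | succ n ih =>
      rw [hP]
      exact hA.convOne_isHom.add (hA.conv_isHom (hA.convOne_isHom.sub hg) ih)
  have hP_succ : ∀ n, ∀ x ∈ F n, P (n + 1) x = P n x := by
    intro n
    induction n with
    | zero =>
      intro x hx
      rw [hF.zero] at hx
      rw [(Submodule.mem_bot k).mp hx, map_zero, map_zero]
    | succ n ih =>
      intro x hx
      have h : (P (n + 1) - P n) ∘ₗ (F n).subtype = 0 := LinearMap.ext fun y =>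
        sub_eq_zero.mpr (ih y y.2)
      obtain ⟨s, hs⟩ := hF.comul_sub_mem n x hx
      rw [hP (n + 1), hP n, ← sub_eq_zero, ← LinearMap.sub_apply, add_sub_add_left_eq_sub, ← hP n,
        ← conv_sub, conv_apply, ← sub_add_cancel (A.comul x) (A.one ⊗ₜ x), ← hs, map_add,
        LinearMap.map_lTensor, h, TensorProduct.map_zero_right, TensorProduct.map_tmul, hf1]
      simp
  have hP_stable : ∀ n, ∀ x ∈ F n, ∀ m ≥ n, P m x = P n x := by
    intro n x hx m hm
    induction m, hm using Nat.le_induction with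
    | base => rfl
    | succ m hm ih => rw [hP_succ m x (hF.mono hm hx), ih]
  obtain ⟨R, hR⟩ := exists_isEventually (P := P) fun x => by
    obtain ⟨n, hn⟩ := hF.exhaustive x
    exact ⟨n, hP_stable n x hn⟩
  have hR_eq : R = A.convOne + A.conv f R := by
    ext x
    obtain ⟨n₁, h₁⟩ := hR x
    obtain ⟨n₂, h₂⟩ := hR.lTensor (L := M) (A.comul x)
    rw [← h₁ _ ((le_max_left n₁ n₂).trans (Nat.le_succ _)), hP, LinearMap.add_apply,
      LinearMap.add_apply, conv_apply, conv_apply, ← LinearMap.rTensor_comp_lTensor,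
      ← LinearMap.rTensor_comp_lTensor, LinearMap.comp_apply, LinearMap.comp_apply,
      ← h₂ _ (le_max_right n₁ n₂)]
  refine ⟨R, .of_isEventually hP_hom hR, ?_, ?_⟩
  · rw [hR_eq, LinearMap.add_apply, hA.conv_one, hf1, hA.convOne_one]
    simp
  · have h : A.conv f R = R - A.conv g R := by rw [sub_conv, hA.convOne_conv]
    rw [h] at hR_eq
    rw [← sub_eq_zero, ← sub_eq_zero.mpr hR_eq]
    abel

/-- A connected braided bialgebra is a braided Hopf algebra: the right convolution inverse `S` of
the identity has itself a right convolution inverse, so it is a two-sided inverse. -/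
theorem IsBialgebra.isHopf {F : ℕ → Submodule k M} (hF : IsConnectedFiltration A F) :
    A.IsHopf := by
  obtain ⟨S, hS, hS1, hidS⟩ := hA.exists_conv_eq hF .id (LinearMap.id_apply _)
  obtain ⟨R, -, -, hSR⟩ := hA.exists_conv_eq hF hS hS1
  have hR : R = LinearMap.id := by
    rw [← hA.convOne_conv R, ← hidS, hA.conv_assoc, hSR, hA.conv_convOne]
  rw [hR] at hSR
  exact ⟨hA, S, hS, LinearMap.congr_fun hSR, LinearMap.congr_fun hidS⟩

end

end BraidedData

end

/-! ### The braided Hopf algebra `K_{≥ r} / K_{> r}` -/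

section
variable {k : Type u} {H : Type v} [Field k] [Ring H] [HopfAlgebra k H]

/-- For a braided bialgebra with a weight grading and a connected filtration that is compatible with
the weights, the quotient `K_{≥ r} / K_{> r}` is a braided Hopf algebra in a unique way. -/
theorem existsUnique_isInduced_isHopf {M : Type w} [AddCommGroup M] [Module k M]
    {A : BraidedData k H M} (hA : A.IsBialgebra) {π : ℚ → M →ₗ[k] M} (hπ : IsWeightGrading A π)
    {F : ℕ → Submodule k M} (hF : IsConnectedFiltration A F)
    (hFπ : ∀ n, ∀ x ∈ F n, π 0 x ∈ F n) :
    ∃! E : BraidedData k H (kernelQuotient A π),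
      A.IsInduced (kernelGe A π) (kernelGt A π) E ∧ E.IsHopf := by
  obtain ⟨p, ρ, h⟩ := exists_isSplitting hA hπ
  exact ⟨A.transport p ρ, ⟨h.transport_isInduced hA hπ,
    (h.transport_isBialgebra hA hπ).isHopf (h.transport_isConnectedFiltration hA hπ hF hFπ)⟩,
    fun E hE => h.eq_transport hA hπ hE.1⟩

variable {V : Type w} [AddCommGroup V] [Module k V] {D : YDData k H V}
variable {V₁ V₂ : Submodule k V} (hV : IsCompl V₁ V₂) (r : ℚ)
variable (hV₁ : D.IsSub V₁) (hV₂ : D.IsSub V₂) (hD : D.IsYD)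

theorem KGe_eq_kernelGe : KGe D V₁ V₂ r =
    kernelGe (nicholsData D) (nicholsWeightProj hV r hV₁ hV₂ hD) := by
  rw [KGe, BGe_eq_nonnegPart hV r hV₁ hV₂ hD]
  rfl

theorem KGt_eq_kernelGt : KGt D V₁ V₂ r =
    kernelGt (nicholsData D) (nicholsWeightProj hV r hV₁ hV₂ hD) := by
  rw [KGt, KGe_eq_kernelGe hV r hV₁ hV₂ hD, BGt_eq_posPart hV r hV₁ hV₂ hD]
  rfl

end

end YetterDrinfeld

end

theorem proposition3 {k : Type*} {H : Type*} {V : Type*} [Field k] [Ring H] [HopfAlgebra k H]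
    (hS : Function.Bijective (HopfAlgebra.antipode k (A := H)))
    [AddCommGroup V] [Module k V]
    (D : YetterDrinfeld.YDData k H V) (hD : D.IsYD)
    (V₁ V₂ : Submodule k V) (hV₁ : D.IsSub V₁) (hV₂ : D.IsSub V₂) (hV : IsCompl V₁ V₂)
    (r : ℚ) (hr : 0 ≤ r) :
    ∃! E : YetterDrinfeld.BraidedData k H
        (YetterDrinfeld.KGe D V₁ V₂ r ⧸
          (YetterDrinfeld.KGt D V₁ V₂ r).submoduleOf (YetterDrinfeld.KGe D V₁ V₂ r)),
      (YetterDrinfeld.nicholsData D).IsInduced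
        (YetterDrinfeld.KGe D V₁ V₂ r) (YetterDrinfeld.KGt D V₁ V₂ r) E ∧
      E.IsHopf := by
  rw [YetterDrinfeld.KGe_eq_kernelGe hV r hV₁ hV₂ hD,
    YetterDrinfeld.KGt_eq_kernelGt hV r hV₁ hV₂ hD]
  exact YetterDrinfeld.existsUnique_isInduced_isHopf
    (YetterDrinfeld.nicholsData_isBialgebra hD)
    (YetterDrinfeld.nicholsData_isWeightGrading hV r hV₁ hV₂ hD)
    (YetterDrinfeld.nicholsLowDegree_isConnectedFiltration hD)
    (YetterDrinfeld.nicholsWeightProj_mem_lowDegree hV r hV₁ hV₂ hD 0)
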